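/- All commutative DGAs are graded commutative differential graded algebras $A=\bigoplus_{n\ge 0}A^n$ over $\mathbb{Q}$ with differential of degree $+1$; $A$ is connected if $A^0=\mathbb{Q}$. An algebraic fibration over $(A,d)$ is an inclusion of commutative DGAs $\iota\colon (A,d)\hookrightarrow (A\otimes\Lambda V,d)$, where $V=\bigoplus_{k\ge1}V^k$ is a graded vector space, $\Lambda V$ is the free graded commutative algebra on $V$, and $V=\bigcup_{n\ge0}V(n)$ for an increasing sequence of graded subspaces $V(0)\subseteq V(1)\subseteq\cdots$ with $d(V(0))\subseteq A$ and $d(V(n))\subseteq A\otimes\Lambda V(n-1)$ for $n\ge1$. For connected $A$, its fiber is the DGA $\mathbb{Q}\otimes_A(A\otimes\Lambda V)=(A\otimes\Lambda V)/(A^+)$, where $A^+=\bigoplus_{i>0}A^i$; the fiber has finite cohomological dimension if its cohomology vanishes in all sufficiently large degrees. The fibration is iterated odd spherical if $V^k=0$ for all even $k$, and finitely iterated odd spherical if moreover $\dim V<\infty$. For connected $A$, let $\operatorname{ann}(A)\subseteq H^\bullet(A)$ be the set of classes $a$ for which there is an algebraic fibration $\iota\colon A\hookrightarrow A\otimes\Lambda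 V$ whose fiber has finite cohomological dimension and such that $\iota_*(a)=0$ in $H^\bullet(A\otimes\Lambda V)$. **Proposition 4.1.** Let $A$ be a connected commutative DGA. There exists an iterated odd algebraic spherical fibration $\tau\colon (A,d)\hookrightarrow(TA,d)$ such that $H^{2i}(TA)=0$ for all $i>0$. For every such $\tau$ and every $a\in H^\bullet(A)$, the following are equivalent: 1. $a\in\operatorname{ann}(A)$; 2. $a\in\operatorname{Ker}\bigl(\tau_*\colon H^\bullet(A)\to H^\bullet(TA)\bigr)$; 3. there exists a finitely iterated odd algebraic spherical fibration $\iota\colon (A,d)\hookrightarrow(A\otimes\Lambda V,d)$ such that $\iota_*(a)=0$. -/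

import Mathlib

universe u

open scoped TensorProduct

noncomputable section

/-! ### Cohomology of a graded vector space with a differential -/

section Cohomology

variable {M : Type u} [AddCommGroup M] [Module ℚ M]

/-- Total cohomology `ker d / im d` of a differential `d` on a vector space.  When `M = ⨁ Mⁿ`
is graded and `d` has degree one, this is `⨁ Hⁿ(M)`. -/
abbrev Cohomology (d : M →ₗ[ℚ] M) : Type u :=
  LinearMap.ker d ⧸ (LinearMap.range d).submoduleOf (LinearMap.ker d)

/-- The degree `n` part `Hⁿ` of the cohomology: the classes of the cocycles in `gr n`. -/
def cohomologyDeg (gr : ℕ → Submodule ℚ M) (d : M →ₗ[ℚ] M) (n : ℕ) :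
    Submodule ℚ (Cohomology d) :=
  ((gr n).submoduleOf (LinearMap.ker d)).map
    ((LinearMap.range d).submoduleOf (LinearMap.ker d)).mkQ

end Cohomology

/-! ### Commutative differential graded algebras -/

/-- A commutative differential graded algebra over `ℚ`, graded in degrees `≥ 0`, with a
differential of degree `+1`. -/
structure CDGA where
  carrier : Type u
  [ring : Ring carrier]
  [algebra : Algebra ℚ carrier]
  /-- the homogeneous parts -/
  gr : ℕ → Submodule ℚ carrier
  [graded : GradedAlgebra gr]
  /-- the differential -/
  d : carrier →ₗ[ℚ] carrier
  d_mem : ∀ {n : ℕ} {x : carrier}, x ∈ gr n → d x ∈ gr (n + 1)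
  d_d : ∀ x : carrier, d (d x) = 0
  leibniz : ∀ {n : ℕ} {x : carrier} (y : carrier), x ∈ gr n →
    d (x * y) = d x * y + (-1 : ℚ) ^ n • (x * d y)
  graded_comm : ∀ {m n : ℕ} {x y : carrier}, x ∈ gr m → y ∈ gr n →
    x * y = (-1 : ℚ) ^ (m * n) • (y * x)

namespace CDGA

instance : CoeSort CDGA.{u} (Type u) := ⟨CDGA.carrier⟩

attribute [instance] CDGA.ring CDGA.algebra CDGA.graded

/-- The cohomology `H(A) = ⨁ Hⁿ(A)`. -/
abbrev H (A : CDGA.{u}) : Type u := Cohomology A.d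

/-- The subspace `Hⁿ(A)` of `H(A)`. -/
def Hdeg (A : CDGA.{u}) (n : ℕ) : Submodule ℚ A.H := cohomologyDeg A.gr A.d n

/-- `A` is connected: `A⁰ = ℚ`. -/
structure IsConnected (A : CDGA.{u}) : Prop where
  one_ne_zero : (1 : A) ≠ 0
  gr_zero : A.gr 0 = Submodule.span ℚ {(1 : A)}

/-- Morphisms of commutative DGAs. -/
structure Hom (A B : CDGA.{u}) where
  toAlgHom : A →ₐ[ℚ] B
  map_gr : ∀ {n : ℕ} {x : A}, x ∈ A.gr n → toAlgHom x ∈ B.gr n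
  map_d : ∀ x : A, toAlgHom (A.d x) = B.d (toAlgHom x)

/-- The map induced by a morphism on cocycles. -/
def Hom.mapCocycles {A B : CDGA.{u}} (f : Hom A B) :
    LinearMap.ker A.d →ₗ[ℚ] LinearMap.ker B.d :=
  f.toAlgHom.toLinearMap.restrict (fun x hx => by
    have hx' : A.d x = 0 := hx
    change B.d (f.toAlgHom x) = 0
    rw [← f.map_d, hx', map_zero])

/-- The map `f_* : H(A) → H(B)` induced by a morphism in cohomology. -/
def Hom.mapH {A B : CDGA.{u}} (f : Hom A B) : A.H →ₗ[ℚ] B.H :=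
  Submodule.mapQ _ _ f.mapCocycles (by
    rintro ⟨x, hx⟩ ⟨y, hy⟩
    exact ⟨f.toAlgHom y, by rw [← f.map_d, hy]; rfl⟩)

end CDGA

/-! ### The free graded commutative algebra -/

section FreeGCA

variable {V : Type u} [AddCommGroup V] [Module ℚ V]

/-- The relations `v w = (-1)^(|v||w|) w v` for homogeneous `v`, `w` in `V`. -/
inductive FreeGCA.Rel (𝒱 : ℕ → Submodule ℚ V) : TensorAlgebra ℚ V → TensorAlgebra ℚ V → Prop
  | comm {m n : ℕ} {v w : V} (hv : v ∈ 𝒱 m) (hw : w ∈ 𝒱 n) :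
      FreeGCA.Rel 𝒱 (TensorAlgebra.ι ℚ v * TensorAlgebra.ι ℚ w)
        ((-1 : ℚ) ^ (m * n) • (TensorAlgebra.ι ℚ w * TensorAlgebra.ι ℚ v))

/-- The free graded commutative algebra `ΛV` on a graded vector space `V`: the quotient of the
tensor algebra by graded commutativity. -/
abbrev FreeGCA (𝒱 : ℕ → Submodule ℚ V) : Type u := RingQuot (FreeGCA.Rel 𝒱)

/-- A degree preserving linear map from `V` to a commutative DGA `E` extends to an algebra map
`ΛV → E`. -/
def FreeGCA.lift (𝒱 : ℕ → Submodule ℚ V) (E : CDGA.{u}) (j : V →ₗ[ℚ] E)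
    (hj : ∀ {k : ℕ} {v : V}, v ∈ 𝒱 k → j v ∈ E.gr k) : FreeGCA 𝒱 →ₐ[ℚ] E :=
  RingQuot.liftAlgHom ℚ ⟨TensorAlgebra.lift ℚ j, by
    rintro _ _ ⟨hv, hw⟩
    simpa using E.graded_comm (hj hv) (hj hw)⟩

end FreeGCA

/-! ### Algebraic fibrations -/

/-- An algebraic fibration `A ↪ (A ⊗ ΛV, d)` over `A`.

The commutative DGA `A ⊗ ΛV` is recorded as a commutative DGA `total` with a morphism `incl` from
`A` and a degree preserving linear map `gen` from `V`, such that the multiplication map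
`A ⊗ ΛV → total`, `a ⊗ w ↦ a w`, is bijective.  By graded commutativity this map is then an
isomorphism of graded algebras, where `A ⊗ ΛV` has its usual product with signs. -/
structure AlgFibration (A : CDGA.{u}) where
  /-- the commutative DGA `(A ⊗ ΛV, d)` -/
  total : CDGA.{u}
  /-- the inclusion `a ↦ a ⊗ 1` -/
  incl : CDGA.Hom A total
  V : Type u
  [addCommGroup : AddCommGroup V]
  [module : Module ℚ V]
  /-- the grading of `V` -/
  grV : ℕ → Submodule ℚ V
  [decomposition : DirectSum.Decomposition grV]
  /-- `V` is concentrated in degrees `≥ 1` -/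
  grV_zero : grV 0 = ⊥
  /-- the inclusion `v ↦ 1 ⊗ v` -/
  gen : V →ₗ[ℚ] total
  gen_mem : ∀ {k : ℕ} {v : V}, v ∈ grV k → gen v ∈ total.gr k
  bijective : Function.Bijective
    (TensorProduct.lift ((LinearMap.mul ℚ total).compl₁₂ incl.toAlgHom.toLinearMap
      (FreeGCA.lift grV total gen gen_mem).toLinearMap) : A ⊗[ℚ] FreeGCA grV →ₗ[ℚ] total)
  /-- the filtration `V(0) ⊆ V(1) ⊆ ⋯` -/
  fil : ℕ → Submodule ℚ V
  fil_mono : Monotone fil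
  /-- each `V(n)` is a graded subspace -/
  fil_graded : ∀ (n : ℕ) (v : V), v ∈ fil n → ∀ k : ℕ,
    (DirectSum.decompose grV v k : V) ∈ fil n
  fil_exhaust : ∀ v : V, ∃ n : ℕ, v ∈ fil n
  /-- `d` maps `V(0)` to `A` -/
  d_fil_zero : ∀ v ∈ fil 0, total.d (gen v) ∈ incl.toAlgHom.range
  /-- `d` maps `V(n+1)` to `A ⊗ ΛV(n)`, the subalgebra generated by `A` and `V(n)` -/
  d_fil_succ : ∀ (n : ℕ), ∀ v ∈ fil (n + 1),
    total.d (gen v) ∈ incl.toAlgHom.range ⊔ Algebra.adjoin ℚ (gen '' (fil n : Set V))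

namespace AlgFibration

attribute [instance] AlgFibration.addCommGroup AlgFibration.module AlgFibration.decomposition

variable {A : CDGA.{u}}

/-- The ideal of `A ⊗ ΛV` generated by `A⁺ = ⨁_{i > 0} Aⁱ`. -/
def fiberIdeal (σ : AlgFibration A) : Submodule ℚ σ.total :=
  Submodule.span ℚ {z | ∃ (e : σ.total) (i : ℕ) (a : A),
    0 < i ∧ a ∈ A.gr i ∧ z = e * σ.incl.toAlgHom a}

theorem fiberIdeal_le_comap (σ : AlgFibration A) :
    σ.fiberIdeal ≤ σ.fiberIdeal.comap σ.total.d := by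
  refine Submodule.span_le.2 ?_
  rintro _ ⟨e, i, a, hi, ha, rfl⟩
  change σ.total.d (e * σ.incl.toAlgHom a) ∈ σ.fiberIdeal
  induction e using DirectSum.Decomposition.inductionOn σ.total.gr with
  | zero => simp
  | @homogeneous m e =>
    rw [σ.total.leibniz _ e.2, ← σ.incl.map_d]
    refine add_mem (Submodule.subset_span ⟨_, i, a, hi, ha, rfl⟩)
      (Submodule.smul_mem _ _ (Submodule.subset_span ⟨_, i + 1, _, i.succ_pos, A.d_mem ha, rfl⟩))
  | add e e' he he' =>
    rw [add_mul, map_add]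
    exact add_mem he he'

/-- The algebraic fiber of a fibration over a connected `A` (so that `A / A⁺ = ℚ`): the complex
`ℚ ⊗_A (A ⊗ ΛV) = (A ⊗ ΛV) / (A⁺)`, whose underlying graded space is `ΛV`. -/
abbrev Fiber (σ : AlgFibration A) : Type u := σ.total ⧸ σ.fiberIdeal

/-- The grading of the fiber. -/
def fiberGr (σ : AlgFibration A) (n : ℕ) : Submodule ℚ σ.Fiber :=
  (σ.total.gr n).map σ.fiberIdeal.mkQ

/-- The differential induced on the fiber. -/
def fiberD (σ : AlgFibration A) : σ.Fiber →ₗ[ℚ] σ.Fiber :=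
  Submodule.mapQ _ _ σ.total.d σ.fiberIdeal_le_comap

/-- The fiber has finite cohomological dimension: its cohomology vanishes in all sufficiently
large degrees. -/
def FiberHasFiniteCohomDim (σ : AlgFibration A) : Prop :=
  ∃ N : ℕ, ∀ n : ℕ, N < n → cohomologyDeg σ.fiberGr σ.fiberD n = ⊥

/-- Iterated odd algebraic spherical fibrations: `Vᵏ = 0` for all even `k`. -/
def IsIteratedOdd (σ : AlgFibration A) : Prop := ∀ k : ℕ, Even k → σ.grV k = ⊥

/-- Finitely iterated odd algebraic spherical fibrations: moreover `dim V < ∞`. -/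
def IsFinitelyIteratedOdd (σ : AlgFibration A) : Prop :=
  σ.IsIteratedOdd ∧ Module.Finite ℚ σ.V

end AlgFibration

/-- `ann(A)`, for connected `A`: the classes in `H(A)` that are annihilated by an algebraic
fibration whose fiber has finite cohomological dimension. -/
def CDGA.ann (A : CDGA.{u}) : Set A.H :=
  {a | ∃ σ : AlgFibration A, σ.FiberHasFiniteCohomDim ∧ σ.incl.mapH a = 0}

end

/-!
# Annihilated classes and iterated odd spherical fibrations

**Classes killed by a fibration die in `TA`** (`AlgFibration.mapH_eq_zero_of_mem_ann`). Let
`A ↪ A ⊗ ΛV` be a fibration whose fiber has finite cohomological dimension, let `y` be an element of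
`A ⊗ ΛV` with `d y = a`, and let `f : A → B` be a map to a connected algebra without cohomology in
positive even degrees, for instance `B = TA`. Only classes `a` of odd degree at least three need an
argument. Suppose that `f a` is not exact. Choose odd cocycles `z j` of `B`, one of them `f a`, that
represent a basis of the odd cohomology. All obstructions to extending `z` to a twisting function
`c` on words, `d c + c ⋆ c = 0`, are even cocycles, so that they vanish (`exists_isTwisting`). The
free right `B`-module `S` on words with the differential twisted by `c` is a resolution of `ℚ`
(`WordModule.exists_primitive`), and therefore `S ⊗_A (A ⊗ ΛV)` has the cohomology of the fiber
(`AlgFibration.exists_baseChangeD_eq`). In this complex `y` and the letter `j` of `f a` are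
primitives of the same element, because `f a` has square zero and `c` can be chosen to vanish on
longer powers of `j`. Hence the divided powers `(y - j)^N / N!` are cocycles, and for large `N` they
are exact for degree reasons. Stripping a first letter `j` from the words is a chain map that sends
the `N`-th divided power to minus the one before, so that finally `1` would be exact.

**Existence of `TA`** (`CDGA.IsConnected.exists_iteratedOdd`). Generators of odd degree are added in
countably many stages, at each stage one for every even cocycle of positive degree in the algebra
that has been built so far. All generators are introduced at once, labelled by triples `(m, k, x)`
of a stage, a degree and an element of `A`; by cardinality the elements of `A` suffice as labels for
all elements of `A ⊗ ΛV`. That a differential on `A ⊗ ΛV` may be prescribed on generators comes from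
the algebra maps `x ↦ [[±x, D x], [0, x]]` into triangular matrices (`FreeExt.der`).

**Finite subfibrations** (`AlgFibration.exists_finitelyIteratedOdd`). A primitive `b` of `a` in `TA`
involves finitely many generators, their differentials involve finitely many generators of an
earlier stage, and so on. This ends after finitely many steps, with a finite-dimensional graded
space `W` of generators such that `A ⊗ ΛW` is a fibration that contains `b`.

**Finite odd fibrations have finite fibers** (`AlgFibration.fiberHasFiniteCohomDim_of_finite`). If
`V` is finite-dimensional and odd, then `ΛV` is an exterior algebra, hence finite-dimensional.
-/

noncomputable section

/-! ### Graded vector spaces and the grading involution -/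

section Grading

variable {M : Type*} [AddCommGroup M] [Module ℚ M]

theorem isInternal_of_projections (gr : ℕ → Submodule ℚ M) (π : ℕ → M →ₗ[ℚ] M)
    (h_same : ∀ {n : ℕ} {x : M}, x ∈ gr n → π n x = x)
    (h_ne : ∀ {m n : ℕ} {x : M}, x ∈ gr m → m ≠ n → π n x = 0)
    (h_top : ⨆ n, gr n = ⊤) : DirectSum.IsInternal gr := by
  rw [DirectSum.isInternal_submodule_iff_iSupIndep_and_iSup_eq_top]
  refine ⟨fun n => ?_, h_top⟩
  rw [Submodule.disjoint_def]
  intro x hx hx'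
  rw [← h_same hx]
  have : ⨆ j, ⨆ (_ : j ≠ n), gr j ≤ LinearMap.ker (π n) :=
    iSup₂_le fun j hj y hy => h_ne hy hj
  exact this hx'

variable {N : Type*} [AddCommMonoid N] [Module ℚ N]

/-- The linear map which applies `f n` to the component of degree `n` and adds up the results. -/
def ofComponents (gr : ℕ → Submodule ℚ M) [DirectSum.Decomposition gr] (f : ℕ → M →ₗ[ℚ] N) :
    M →ₗ[ℚ] N :=
  (DirectSum.toModule ℚ ℕ N fun n => f n ∘ₗ (gr n).subtype) ∘ₗ
    (DirectSum.decomposeLinearEquiv gr).toLinearMap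

theorem ofComponents_of_mem (gr : ℕ → Submodule ℚ M) [DirectSum.Decomposition gr]
    (f : ℕ → M →ₗ[ℚ] N) {n : ℕ} {x : M} (hx : x ∈ gr n) : ofComponents gr f x = f n x := by
  simp only [ofComponents, LinearMap.comp_apply, LinearEquiv.coe_coe,
    DirectSum.decomposeLinearEquiv_apply, DirectSum.decompose_of_mem _ hx,
    ← DirectSum.lof_eq_of ℚ, DirectSum.toModule_lof, Submodule.subtype_apply]

end Grading

section GradedAlgebra

variable {A : Type*} [Ring A] [Algebra ℚ A] (gr : ℕ → Submodule ℚ A) [GradedAlgebra gr]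

theorem linearMap_ext_of_graded {M : Type*} [AddCommGroup M] [Module ℚ M] {f g : A →ₗ[ℚ] M}
    (h : ∀ (n : ℕ) (x : A), x ∈ gr n → f x = g x) : f = g :=
  LinearMap.ext fun x => DirectSum.Decomposition.inductionOn gr (by simp)
    (fun m => h _ _ m.2) (fun x y hx hy => by rw [map_add, map_add, hx, hy]) x

theorem proj_of_mem_same {n : ℕ} {x : A} (hx : x ∈ gr n) : GradedAlgebra.proj gr n x = x := by
  rw [GradedAlgebra.proj_apply, DirectSum.decompose_of_mem_same _ hx]

theorem proj_of_mem_ne {m n : ℕ} {x : A} (hx : x ∈ gr m) (h : m ≠ n) :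
    GradedAlgebra.proj gr n x = 0 := by
  rw [GradedAlgebra.proj_apply, DirectSum.decompose_of_mem_ne _ hx h]

theorem proj_mem (n : ℕ) (x : A) : GradedAlgebra.proj gr n x ∈ gr n := by
  rw [GradedAlgebra.proj_apply]; exact Subtype.prop _

/-- The grading involution as a linear map. -/
def signLinear : A →ₗ[ℚ] A := ofComponents gr fun n => (-1 : ℚ) ^ n • LinearMap.id

theorem signLinear_of_mem {n : ℕ} {x : A} (hx : x ∈ gr n) :
    signLinear gr x = (-1 : ℚ) ^ n • x := ofComponents_of_mem gr _ hx

/-- The grading involution `x ↦ (-1)^|x| x` of a graded algebra. -/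
def gradeSign : A →ₐ[ℚ] A :=
  AlgHom.ofLinearMap (signLinear gr)
    (by rw [signLinear_of_mem gr (SetLike.GradedOne.one_mem), pow_zero, one_smul])
    (fun x y => by
      induction x using DirectSum.Decomposition.inductionOn gr with
      | zero => simp
      | @homogeneous m x =>
        induction y using DirectSum.Decomposition.inductionOn gr with
        | zero => simp
        | @homogeneous n y =>
          rw [signLinear_of_mem gr x.2, signLinear_of_mem gr y.2,
            signLinear_of_mem gr (SetLike.GradedMul.mul_mem x.2 y.2), smul_mul_smul_comm, pow_add]
        | add y y' hy hy' => rw [mul_add, map_add, hy, hy', map_add, mul_add]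
      | add x x' hx hx' => rw [add_mul, map_add, hx, hx', map_add, add_mul])

theorem gradeSign_of_mem {n : ℕ} {x : A} (hx : x ∈ gr n) :
    gradeSign gr x = (-1 : ℚ) ^ n • x := signLinear_of_mem gr hx

theorem gradeSign_gradeSign (x : A) : gradeSign gr (gradeSign gr x) = x := by
  have : (gradeSign gr).toLinearMap ∘ₗ (gradeSign gr).toLinearMap = LinearMap.id :=
    linearMap_ext_of_graded gr fun n x hx => by
      simp only [LinearMap.comp_apply, AlgHom.toLinearMap_apply, LinearMap.id_apply]
      rw [gradeSign_of_mem gr hx, map_smul, gradeSign_of_mem gr hx, smul_smul, ← mul_pow]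
      simp
  exact LinearMap.congr_fun this x

theorem gradeSign_iterate_of_mem {n : ℕ} {x : A} (hx : x ∈ gr n) (k : ℕ) :
    (gradeSign gr)^[k] x = (-1 : ℚ) ^ (n * k) • x := by
  induction k with
  | zero => simp
  | succ k ih =>
    rw [Function.iterate_succ_apply', ih, map_smul, gradeSign_of_mem gr hx, smul_smul, ← pow_add]
    ring_nf

end GradedAlgebra

namespace CDGA

variable (A : CDGA.{u})

/-- The grading involution `x ↦ (-1)^|x| x` of a commutative DGA. -/
def sgn : A →ₐ[ℚ] A := gradeSign A.gr

variable {A}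

theorem sgn_of_mem {n : ℕ} {x : A} (hx : x ∈ A.gr n) : A.sgn x = (-1 : ℚ) ^ n • x :=
  gradeSign_of_mem _ hx

theorem sgn_of_even {n : ℕ} (hn : Even n) {x : A} (hx : x ∈ A.gr n) : A.sgn x = x := by
  rw [sgn_of_mem hx, hn.neg_one_pow, one_smul]

theorem sgn_of_odd {n : ℕ} (hn : Odd n) {x : A} (hx : x ∈ A.gr n) : A.sgn x = -x := by
  rw [sgn_of_mem hx, hn.neg_one_pow, neg_one_smul]

@[simp]
theorem sgn_sgn (x : A) : A.sgn (A.sgn x) = x := gradeSign_gradeSign _ x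

theorem sgn_d (x : A) : A.sgn (A.d x) = -A.d (A.sgn x) := by
  have : A.sgn.toLinearMap ∘ₗ A.d = -(A.d ∘ₗ A.sgn.toLinearMap) :=
    linearMap_ext_of_graded A.gr fun n x hx => by
      simp only [LinearMap.comp_apply, LinearMap.neg_apply, AlgHom.toLinearMap_apply]
      rw [sgn_of_mem (A.d_mem hx), sgn_of_mem hx, map_smul, pow_succ]
      simp
  exact LinearMap.congr_fun this x

theorem d_mul (x y : A) : A.d (x * y) = A.d x * y + A.sgn x * A.d y := by
  induction x using DirectSum.Decomposition.inductionOn A.gr with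
  | zero => simp
  | @homogeneous m x => rw [A.leibniz y x.2, sgn_of_mem x.2, smul_mul_assoc]
  | add x x' hx hx' => rw [add_mul, map_add, hx, hx', map_add, map_add, add_mul, add_mul]; abel

@[simp]
theorem d_one : A.d 1 = 0 := by
  have h := A.d_mul 1 1
  simpa using h

/-- A homogeneous element commutes past any other one at the price of an iterated sign. -/
theorem mul_comm_of_mem {n : ℕ} {x : A} (hx : x ∈ A.gr n) (y : A) :
    y * x = x * (A.sgn^[n] y) := by
  induction y using DirectSum.Decomposition.inductionOn A.gr with
  | zero => simp [Function.iterate_fixed (map_zero A.sgn)]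
  | @homogeneous m y => rw [A.graded_comm y.2 hx, sgn, gradeSign_iterate_of_mem _ y.2, mul_smul_comm]
  | add y y' hy hy' => rw [add_mul, hy, hy', iterate_map_add, mul_add]

theorem d_proj (n : ℕ) (x : A) :
    A.d (GradedAlgebra.proj A.gr n x) = GradedAlgebra.proj A.gr (n + 1) (A.d x) := by
  have : A.d ∘ₗ GradedAlgebra.proj A.gr n = GradedAlgebra.proj A.gr (n + 1) ∘ₗ A.d :=
    linearMap_ext_of_graded A.gr fun m x hx => by
      simp only [LinearMap.comp_apply]
      rcases eq_or_ne m n with rfl | h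
      · rw [proj_of_mem_same _ hx, proj_of_mem_same _ (A.d_mem hx)]
      · rw [proj_of_mem_ne _ hx h, proj_of_mem_ne _ (A.d_mem hx) (by omega), map_zero]
  exact LinearMap.congr_fun this x

theorem proj_zero_d (x : A) : GradedAlgebra.proj A.gr 0 (A.d x) = 0 := by
  have : GradedAlgebra.proj A.gr 0 ∘ₗ A.d = 0 :=
    linearMap_ext_of_graded A.gr fun m x hx => by
      simp only [LinearMap.comp_apply, LinearMap.zero_apply]
      rw [proj_of_mem_ne _ (A.d_mem hx) (by omega)]
  exact LinearMap.congr_fun this x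

theorem Hom.map_sgn {B : CDGA.{u}} (f : Hom A B) (x : A) :
    f.toAlgHom (A.sgn x) = B.sgn (f.toAlgHom x) := by
  have : f.toAlgHom.toLinearMap ∘ₗ A.sgn.toLinearMap =
      B.sgn.toLinearMap ∘ₗ f.toAlgHom.toLinearMap :=
    linearMap_ext_of_graded A.gr fun m x hx => by
      simp only [LinearMap.comp_apply, AlgHom.toLinearMap_apply]
      rw [sgn_of_mem hx, sgn_of_mem (f.map_gr hx), map_smul]
  exact LinearMap.congr_fun this x

theorem Hom.map_proj {B : CDGA.{u}} (f : Hom A B) (n : ℕ) (x : A) :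
    f.toAlgHom (GradedAlgebra.proj A.gr n x) = GradedAlgebra.proj B.gr n (f.toAlgHom x) := by
  have : f.toAlgHom.toLinearMap ∘ₗ GradedAlgebra.proj A.gr n =
      GradedAlgebra.proj B.gr n ∘ₗ f.toAlgHom.toLinearMap :=
    linearMap_ext_of_graded A.gr fun m x hx => by
      simp only [LinearMap.comp_apply, AlgHom.toLinearMap_apply]
      rcases eq_or_ne m n with rfl | h
      · rw [proj_of_mem_same _ hx, proj_of_mem_same _ (f.map_gr hx)]
      · rw [proj_of_mem_ne _ hx h, proj_of_mem_ne _ (f.map_gr hx) h, map_zero]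
  exact LinearMap.congr_fun this x

theorem mapH_mk_eq_zero {B : CDGA.{u}} (f : Hom A B) (x : LinearMap.ker A.d) :
    f.mapH (Submodule.Quotient.mk x) = 0 ↔ ∃ y : B, B.d y = f.toAlgHom x := by
  change Submodule.Quotient.mk (f.mapCocycles x) = _ ↔ _
  rw [Submodule.Quotient.mk_eq_zero]
  rfl

theorem hdeg_eq_bot_iff (n : ℕ) :
    A.Hdeg n = ⊥ ↔ ∀ x ∈ A.gr n, A.d x = 0 → ∃ y, A.d y = x := by
  unfold Hdeg cohomologyDeg
  rw [← le_bot_iff, Submodule.map_le_iff_le_comap, Submodule.comap_bot, Submodule.ker_mkQ]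
  constructor
  · intro h x hx hdx
    exact h (show (⟨x, hdx⟩ : LinearMap.ker A.d) ∈ _ from hx)
  · rintro h ⟨x, hdx⟩ hx
    exact h x hx hdx

end CDGA

/-! ### The grading of the free graded commutative algebra -/

namespace FreeGCA

variable {V : Type u} [AddCommGroup V] [Module ℚ V] (𝒱 : ℕ → Submodule ℚ V)

/-- The canonical map `V → ΛV`. -/
def ι : V →ₗ[ℚ] FreeGCA 𝒱 :=
  (RingQuot.mkAlgHom ℚ (Rel 𝒱)).toLinearMap ∘ₗ TensorAlgebra.ι ℚ

theorem ι_mul_ι {m n : ℕ} {v w : V} (hv : v ∈ 𝒱 m) (hw : w ∈ 𝒱 n) :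
    ι 𝒱 v * ι 𝒱 w = (-1 : ℚ) ^ (m * n) • (ι 𝒱 w * ι 𝒱 v) := by
  have := RingQuot.mkAlgHom_rel ℚ (Rel.comm hv hw)
  simpa [ι] using this

section Lift

variable {C : Type*} [Semiring C] [Algebra ℚ C]

/-- The universal property of `ΛV` for arbitrary target algebras. -/
def liftAlg (j : V →ₗ[ℚ] C)
    (hj : ∀ {m n : ℕ} {v w : V}, v ∈ 𝒱 m → w ∈ 𝒱 n →
      j v * j w = (-1 : ℚ) ^ (m * n) • (j w * j v)) : FreeGCA 𝒱 →ₐ[ℚ] C :=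
  RingQuot.liftAlgHom ℚ ⟨TensorAlgebra.lift ℚ j, by
    rintro _ _ ⟨hv, hw⟩
    simpa using hj hv hw⟩

@[simp]
theorem liftAlg_ι (j : V →ₗ[ℚ] C) (hj) (v : V) : liftAlg 𝒱 j hj (ι 𝒱 v) = j v := by
  simp [liftAlg, ι]

@[simp]
theorem lift_ι (E : CDGA.{u}) (j : V →ₗ[ℚ] E)
    (hj : ∀ {k : ℕ} {v : V}, v ∈ 𝒱 k → j v ∈ E.gr k) (v : V) :
    FreeGCA.lift 𝒱 E j hj (ι 𝒱 v) = j v := by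
  simp [FreeGCA.lift, ι]

variable {𝒱}

theorem algHom_ext {f g : FreeGCA 𝒱 →ₐ[ℚ] C} (h : ∀ v, f (ι 𝒱 v) = g (ι 𝒱 v)) : f = g := by
  apply RingQuot.ringQuot_ext'
  apply TensorAlgebra.hom_ext
  ext v
  exact h v

end Lift

variable {𝒱}

theorem adjoin_range_ι : Algebra.adjoin ℚ (Set.range (ι 𝒱)) = ⊤ := by
  have h1 : (RingQuot.mkAlgHom ℚ (Rel 𝒱)).range = ⊤ :=
    AlgHom.range_eq_top _ |>.2 (RingQuot.mkAlgHom_surjective ℚ _)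
  rw [← h1, ← Algebra.map_top, ← TensorAlgebra.adjoin_range_ι, AlgHom.map_adjoin, ← Set.range_comp]
  rfl

@[elab_as_elim]
theorem induction {P : FreeGCA 𝒱 → Prop} (x : FreeGCA 𝒱)
    (algebraMap : ∀ r : ℚ, P (algebraMap ℚ _ r)) (ι : ∀ v, P (ι 𝒱 v))
    (mul : ∀ x y, P x → P y → P (x * y)) (add : ∀ x y, P x → P y → P (x + y)) : P x := by
  have hx : x ∈ Algebra.adjoin ℚ (Set.range (FreeGCA.ι 𝒱)) := by
    rw [adjoin_range_ι]; trivial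
  induction hx using Algebra.adjoin_induction with
  | mem x hx => obtain ⟨v, rfl⟩ := hx; exact ι v
  | algebraMap r => exact algebraMap r
  | add x y _ _ hx hy => exact add x y hx hy
  | mul x y _ _ hx hy => exact mul x y hx hy

variable (𝒱)
variable [DirectSum.Decomposition 𝒱]

/-- The algebra map `ΛV → ΛV[X]` which multiplies a generator of degree `k` by `X ^ k`; it encodes
the grading of `ΛV`. -/
def weight : FreeGCA 𝒱 →ₐ[ℚ] Polynomial (FreeGCA 𝒱) :=
  liftAlg 𝒱
    (ofComponents 𝒱 fun n => (Polynomial.monomial n).restrictScalars ℚ ∘ₗ ι 𝒱)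
    (fun {m n v w} hv hw => by
      rw [ofComponents_of_mem _ _ hv, ofComponents_of_mem _ _ hw]
      simp only [LinearMap.comp_apply, LinearMap.restrictScalars_apply,
        Polynomial.monomial_mul_monomial]
      rw [ι_mul_ι 𝒱 hv hw, Polynomial.smul_monomial, add_comm])

theorem weight_ι {n : ℕ} {v : V} (hv : v ∈ 𝒱 n) :
    weight 𝒱 (ι 𝒱 v) = Polynomial.monomial n (ι 𝒱 v) := by
  rw [weight, liftAlg_ι, ofComponents_of_mem _ _ hv]; rfl

/-- The degree `n` part of `ΛV`: the elements of weight `X ^ n`. -/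
def gr (n : ℕ) : Submodule ℚ (FreeGCA 𝒱) :=
  LinearMap.eqLocus (weight 𝒱).toLinearMap ((Polynomial.monomial n).restrictScalars ℚ)

theorem mem_gr {n : ℕ} {x : FreeGCA 𝒱} : x ∈ gr 𝒱 n ↔ weight 𝒱 x = Polynomial.monomial n x :=
  Iff.rfl

theorem ι_mem {n : ℕ} {v : V} (hv : v ∈ 𝒱 n) : ι 𝒱 v ∈ gr 𝒱 n := weight_ι 𝒱 hv

instance : SetLike.GradedMonoid (gr 𝒱) where
  one_mem := by rw [mem_gr, map_one]; rfl
  mul_mem := by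
    intro m n x y hx hy
    rw [mem_gr] at *
    rw [map_mul, hx, hy, Polynomial.monomial_mul_monomial]

theorem iSup_gr : ⨆ n, gr 𝒱 n = ⊤ := by
  rw [Submodule.iSup_eq_toSubmodule_range, ← Algebra.top_toSubmodule]
  congr 1
  rw [eq_top_iff, ← adjoin_range_ι, Algebra.adjoin_le_iff]
  rintro _ ⟨v, rfl⟩
  induction v using DirectSum.Decomposition.inductionOn 𝒱 with
  | zero => rw [map_zero]; exact zero_mem _
  | @homogeneous m v => exact ⟨DirectSum.of _ m ⟨_, ι_mem 𝒱 v.2⟩, DirectSum.coeAlgHom_of _ _ _⟩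
  | add v w hv hw => rw [map_add]; exact add_mem hv hw

instance : GradedAlgebra (gr 𝒱) where
  toDecomposition := by
    refine (isInternal_of_projections (gr 𝒱)
      (fun n => ((Polynomial.lcoeff _ n).restrictScalars ℚ) ∘ₗ (weight 𝒱).toLinearMap)
      ?_ ?_ (iSup_gr 𝒱)).chooseDecomposition
    · intro n x hx
      simp [(mem_gr 𝒱).1 hx]
    · intro m n x hx h
      simp [(mem_gr 𝒱).1 hx, Polynomial.coeff_monomial, h]

variable {𝒱} in
/-- Induction on homogeneous elements of `ΛV`, as sums of products of homogeneous generators. -/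
theorem gr_induction {P : ℕ → FreeGCA 𝒱 → Prop} {n : ℕ} {x : FreeGCA 𝒱} (hx : x ∈ gr 𝒱 n)
    (zero : ∀ n, P n 0) (scalar : ∀ r : ℚ, P 0 (algebraMap ℚ _ r))
    (ι : ∀ (k : ℕ) (v : V), v ∈ 𝒱 k → P k (ι 𝒱 v))
    (mul : ∀ m n x y, P m x → P n y → P (m + n) (x * y))
    (add : ∀ n x y, P n x → P n y → P n (x + y)) : P n x := by
  suffices h : ∀ x : FreeGCA 𝒱, ∀ n : ℕ, P n (GradedAlgebra.proj (gr 𝒱) n x) by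
    have := h x n
    rwa [proj_of_mem_same _ hx] at this
  clear hx x n
  intro x
  induction x using FreeGCA.induction with
  | algebraMap r =>
    intro n
    have h0 : algebraMap ℚ (FreeGCA 𝒱) r ∈ gr 𝒱 0 := SetLike.algebraMap_mem_graded _ r
    rcases eq_or_ne 0 n with rfl | h
    · rw [proj_of_mem_same _ h0]; exact scalar r
    · rw [proj_of_mem_ne _ h0 h]; exact zero n
  | ι v =>
    intro n
    induction v using DirectSum.Decomposition.inductionOn 𝒱 with
    | zero => rw [map_zero, map_zero]; exact zero n
    | @homogeneous m v =>
      rcases eq_or_ne m n with rfl | h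
      · rw [proj_of_mem_same _ (ι_mem 𝒱 v.2)]; exact ι _ _ v.2
      · rw [proj_of_mem_ne _ (ι_mem 𝒱 v.2) h]; exact zero n
    | add v w hv hw => rw [map_add, map_add]; exact add _ _ _ hv hw
  | mul x y hx hy =>
    intro n
    rw [GradedAlgebra.proj_apply, DirectSum.decompose_mul,
      DirectSum.coe_mul_apply_eq_sum_antidiagonal]
    refine Finset.sum_induction _ (P n) (add n) (zero n) fun ij hij => ?_
    rw [← Finset.HasAntidiagonal.mem_antidiagonal.1 hij]
    exact mul _ _ _ _ (hx ij.1) (hy ij.2)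
  | add x y hx hy => intro n; rw [map_add]; exact add _ _ _ (hx n) (hy n)

variable {𝒱} in
theorem lift_mem (E : CDGA.{u}) (j : V →ₗ[ℚ] E)
    (hj : ∀ {k : ℕ} {v : V}, v ∈ 𝒱 k → j v ∈ E.gr k) {n : ℕ} {x : FreeGCA 𝒱} (hx : x ∈ gr 𝒱 n) :
    FreeGCA.lift 𝒱 E j hj x ∈ E.gr n := by
  refine gr_induction (P := fun n x => FreeGCA.lift 𝒱 E j hj x ∈ E.gr n) hx (fun n => ?_)
    (fun r => ?_) (fun k v hv => ?_) (fun m n x y hx hy => ?_) (fun n x y hx hy => ?_)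
  · rw [map_zero]; exact zero_mem _
  · rw [AlgHom.commutes]; exact SetLike.algebraMap_mem_graded _ r
  · rw [lift_ι]; exact hj hv
  · rw [map_mul]; exact SetLike.GradedMul.mul_mem hx hy
  · rw [map_add]; exact add_mem hx hy

variable {𝒱} in
theorem mul_comm_of_mem {m : ℕ} {x : FreeGCA 𝒱} (hx : x ∈ gr 𝒱 m) (y : FreeGCA 𝒱) :
    y * x = x * (gradeSign (gr 𝒱))^[m] y := by
  have hgen : ∀ {n : ℕ} {v : V}, v ∈ 𝒱 n → ∀ x : FreeGCA 𝒱,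
      x * ι 𝒱 v = ι 𝒱 v * (gradeSign (gr 𝒱))^[n] x := by
    intro n v hv x
    induction x using FreeGCA.induction with
    | algebraMap r =>
      rw [Function.iterate_fixed (AlgHom.commutes _ r), Algebra.commutes]
    | ι w =>
      induction w using DirectSum.Decomposition.inductionOn 𝒱 with
      | zero => rw [map_zero, Function.iterate_fixed (map_zero _), zero_mul, mul_zero]
      | @homogeneous k w =>
        rw [ι_mul_ι 𝒱 w.2 hv, gradeSign_iterate_of_mem _ (ι_mem 𝒱 w.2), mul_smul_comm]
      | add v w hv hw => rw [map_add, iterate_map_add, add_mul, mul_add, hv, hw]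
    | mul x y hx hy => rw [iterate_map_mul, mul_assoc, hy, ← mul_assoc, hx, mul_assoc]
    | add x y hx hy => rw [iterate_map_add, add_mul, mul_add, hx, hy]
  induction y using FreeGCA.induction with
  | algebraMap r => rw [Function.iterate_fixed (AlgHom.commutes _ r), Algebra.commutes]
  | ι v =>
    induction v using DirectSum.Decomposition.inductionOn 𝒱 with
    | zero => rw [map_zero, Function.iterate_fixed (map_zero _), zero_mul, mul_zero]
    | @homogeneous k v =>
      have h := hgen v.2 x
      rw [gradeSign_iterate_of_mem _ hx, mul_smul_comm] at h
      rw [gradeSign_iterate_of_mem _ (ι_mem 𝒱 v.2), mul_smul_comm, h, smul_smul, ← pow_add,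
        mul_comm m k, ← two_mul, pow_mul]
      simp
    | add v w hv hw => rw [map_add, iterate_map_add, add_mul, mul_add, hv, hw]
  | mul y z hy hz => rw [iterate_map_mul, mul_assoc, hz, ← mul_assoc, hy, mul_assoc]
  | add y z hy hz => rw [iterate_map_add, add_mul, mul_add, hy, hz]

variable {𝒱} in
theorem graded_comm {m n : ℕ} {x y : FreeGCA 𝒱} (hx : x ∈ gr 𝒱 m) (hy : y ∈ gr 𝒱 n) :
    x * y = (-1 : ℚ) ^ (m * n) • (y * x) := by
  rw [mul_comm_of_mem hy, gradeSign_iterate_of_mem _ hx, mul_smul_comm]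

end FreeGCA

/-! ### Connected commutative DGAs without even cohomology -/

section GradedSubmodule

variable {A : Type*} [Ring A] [Algebra ℚ A] (gr : ℕ → Submodule ℚ A) [GradedAlgebra gr]

theorem mem_of_proj_mem (N : Submodule ℚ A) {x : A}
    (h : ∀ n, GradedAlgebra.proj gr n x ∈ N) : x ∈ N := by
  classical
  rw [← DirectSum.sum_support_decompose gr x]
  exact sum_mem fun i _ => h i

theorem eq_zero_of_proj_eq_zero {x : A} (h : ∀ n, GradedAlgebra.proj gr n x = 0) : x = 0 := by
  have := mem_of_proj_mem gr ⊥ (x := x) (by simpa using h)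
  simpa using this

end GradedSubmodule

namespace CDGA

variable {B : CDGA.{u}}

theorem proj_sgn (n : ℕ) (x : B) :
    GradedAlgebra.proj B.gr n (B.sgn x) = (-1 : ℚ) ^ n • GradedAlgebra.proj B.gr n x := by
  have : GradedAlgebra.proj B.gr n ∘ₗ B.sgn.toLinearMap =
      (-1 : ℚ) ^ n • GradedAlgebra.proj B.gr n :=
    linearMap_ext_of_graded B.gr fun m x hx => by
      simp only [LinearMap.comp_apply, AlgHom.toLinearMap_apply, LinearMap.smul_apply]
      rw [sgn_of_mem hx, map_smul]
      rcases eq_or_ne m n with rfl | h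
      · rfl
      · rw [proj_of_mem_ne _ hx h, smul_zero, smul_zero]
  exact LinearMap.congr_fun this x

namespace IsConnected

variable (hB : B.IsConnected)
include hB

theorem exists_functional : ∃ φ : B →ₗ[ℚ] ℚ, φ 1 = 1 := by
  obtain ⟨g, hg⟩ := LinearMap.exists_leftInverse_of_injective (LinearMap.toSpanSingleton ℚ B 1)
    (LinearMap.ker_eq_bot.2 (smul_left_injective ℚ hB.one_ne_zero))
  exact ⟨g, by simpa using LinearMap.congr_fun hg 1⟩

/-- The augmentation of a connected commutative DGA, as a linear map. -/
def augLinear : B →ₗ[ℚ] ℚ := hB.exists_functional.choose ∘ₗ GradedAlgebra.proj B.gr 0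

theorem augLinear_smul_one (x : B) : hB.augLinear x • (1 : B) = GradedAlgebra.proj B.gr 0 x := by
  have h : GradedAlgebra.proj B.gr 0 x ∈ Submodule.span ℚ {(1 : B)} := by
    rw [← hB.gr_zero]; exact proj_mem _ _ _
  obtain ⟨r, hr⟩ := Submodule.mem_span_singleton.1 h
  rw [augLinear, LinearMap.comp_apply, ← hr, map_smul, hB.exists_functional.choose_spec,
    smul_eq_mul, mul_one]

/-- The augmentation `B → B⁰ = ℚ` of a connected commutative DGA. -/
def aug : B →ₐ[ℚ] ℚ :=
  AlgHom.ofLinearMap hB.augLinear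
    (smul_left_injective ℚ hB.one_ne_zero (by
      simp only [augLinear_smul_one, one_smul]
      exact proj_of_mem_same _ SetLike.GradedOne.one_mem))
    (fun x y => smul_left_injective ℚ hB.one_ne_zero (by
      have h := hB.augLinear_smul_one
      simp only
      rw [h, ← mul_one (1 : B), ← smul_mul_smul_comm, h, h]
      exact map_mul (GradedRing.projZeroRingHom B.gr) x y))

theorem aug_smul_one (x : B) : hB.aug x • (1 : B) = GradedAlgebra.proj B.gr 0 x :=
  hB.augLinear_smul_one x

theorem aug_eq_zero_iff (x : B) : hB.aug x = 0 ↔ GradedAlgebra.proj B.gr 0 x = 0 := by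
  rw [← hB.aug_smul_one, smul_eq_zero, or_iff_left hB.one_ne_zero]

theorem aug_d (x : B) : hB.aug (B.d x) = 0 := by
  rw [hB.aug_eq_zero_iff, proj_zero_d]

theorem aug_of_mem {n : ℕ} (hn : 0 < n) {x : B} (hx : x ∈ B.gr n) : hB.aug x = 0 := by
  rw [hB.aug_eq_zero_iff, proj_of_mem_ne _ hx hn.ne']

theorem aug_sgn (x : B) : hB.aug (B.sgn x) = hB.aug x := by
  apply smul_left_injective ℚ hB.one_ne_zero
  simp only [aug_smul_one, proj_sgn, pow_zero, one_smul]

theorem aug_of_odd {x : B} (hx : B.sgn x = -x) : hB.aug x = 0 := by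
  have := hB.aug_sgn x
  rw [hx, map_neg] at this
  linarith

/-- If the cohomology vanishes in positive even degrees, an even cocycle without constant term is
the differential of an odd element. -/
theorem exists_odd_primitive (hev : ∀ i : ℕ, 0 < i → B.Hdeg (2 * i) = ⊥) {x : B}
    (hx : B.sgn x = x) (hdx : B.d x = 0) (haug : hB.aug x = 0) :
    ∃ y, B.sgn y = -y ∧ B.d y = x := by
  have hmem : x ∈ LinearMap.range B.d := by
    refine mem_of_proj_mem B.gr _ fun n => ?_
    rcases Nat.even_or_odd' n with ⟨i, rfl | rfl⟩
    · rcases Nat.eq_zero_or_pos i with rfl | hi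
      · rw [Nat.mul_zero, (hB.aug_eq_zero_iff x).1 haug]; exact zero_mem _
      · exact (hdeg_eq_bot_iff _).1 (hev i hi) _ (proj_mem _ _ _)
          (by rw [d_proj, hdx, map_zero])
    · have h := proj_sgn (2 * i + 1) x
      rw [hx, (odd_two_mul_add_one i).neg_one_pow, neg_one_smul] at h
      have h2 : (2 : ℚ) • GradedAlgebra.proj B.gr (2 * i + 1) x = 0 := by
        rw [two_smul]; exact eq_neg_iff_add_eq_zero.1 h
      rw [(smul_eq_zero.1 h2).resolve_left two_ne_zero]; exact zero_mem _
  obtain ⟨y, rfl⟩ := hmem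
  rw [sgn_d] at hx
  refine ⟨(2⁻¹ : ℚ) • (y - B.sgn y), ?_, ?_⟩
  · rw [map_smul, map_sub, sgn_sgn, ← smul_neg, neg_sub]
  · rw [map_smul, map_sub, sub_eq_add_neg, hx, ← two_smul ℚ, smul_smul]; norm_num

end IsConnected

end CDGA

/-! ### Twisting functions on words -/

section Words

variable {B : CDGA.{u}} {J : Type u}

/-- The convolution `(f ⋆ g)(w) = ∑ f(u) g(v)` over all factorizations `w = u v` of a word. -/
def conv : (List J → B) → (List J → B) → List J → B
  | f, g, [] => f [] * g []
  | f, g, j :: w => f [] * g (j :: w) + conv (fun u => f (j :: u)) g w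

theorem conv_mem {N : Type*} [SetLike N B] [AddSubmonoidClass N B] (S : N) {f g : List J → B}
    {w : List J} (h : ∀ u v, u ++ v = w → f u * g v ∈ S) : conv f g w ∈ S := by
  induction w generalizing f with
  | nil => exact h [] [] rfl
  | cons j w ih =>
    exact add_mem (h [] _ rfl) (ih fun u v huv => h (j :: u) v (by simp [huv]))

theorem conv_congr {f g f' g' : List J → B} {w : List J}
    (h : ∀ u v, u ++ v = w → f u * g v = f' u * g' v) : conv f g w = conv f' g' w := by
  induction w generalizing f f' with
  | nil => exact h [] [] rfl
  | cons j w ih =>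
    rw [conv, conv, h [] _ rfl, ih fun u v huv => h (j :: u) v (by simp [huv])]

theorem conv_add_left (f f' g : List J → B) (w : List J) :
    conv (f + f') g w = conv f g w + conv f' g w := by
  induction w generalizing f f' with
  | nil => simp [conv, add_mul]
  | cons j w ih =>
    have := ih (fun u => f (j :: u)) (fun u => f' (j :: u))
    simp only [conv, Pi.add_apply, add_mul]
    rw [show (fun u => f (j :: u) + f' (j :: u)) =
      (fun u => f (j :: u)) + (fun u => f' (j :: u)) from rfl, this]
    abel

theorem conv_mul_left (b : B) (f g : List J → B) (w : List J) :
    conv (fun u => b * f u) g w = b * conv f g w := by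
  induction w generalizing f with
  | nil => simp [conv, mul_assoc]
  | cons j w ih => simp only [conv, ih, mul_add, mul_assoc]

theorem conv_assoc (f g h : List J → B) (w : List J) :
    conv (conv f g) h w = conv f (conv g h) w := by
  induction w generalizing f with
  | nil => simp [conv, mul_assoc]
  | cons j w ih =>
    have : (fun u => conv f g (j :: u)) =
        (fun u => f [] * g (j :: u)) + conv (fun u => f (j :: u)) g := by
      funext u; rfl
    rw [conv, this, conv_add_left, conv_mul_left, ih, conv, conv, conv]
    simp only [mul_add, mul_assoc, add_assoc]

theorem d_conv (f g : List J → B) (w : List J) :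
    B.d (conv f g w) =
      conv (fun u => B.d (f u)) g w + conv (fun u => B.sgn (f u)) (fun u => B.d (g u)) w := by
  induction w generalizing f with
  | nil => simp [conv, CDGA.d_mul]
  | cons j w ih => simp only [conv, map_add, ih, CDGA.d_mul]; abel

theorem sgn_conv (f g : List J → B) (w : List J) :
    B.sgn (conv f g w) = conv (fun u => B.sgn (f u)) (fun u => B.sgn (g u)) w := by
  induction w generalizing f with
  | nil => simp [conv]
  | cons j w ih => simp only [conv, map_add, ih, map_mul]

/-- Approximations to the solution of `c w = -h ((c ⋆ c) w)` with prescribed values on words of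
length one: `twistingApprox z h n` is the solution on words of length at most `n`. -/
def twistingApprox (z : J → B) (h : B → B) : ℕ → List J → B
  | 0, _ => 0
  | n + 1, w =>
    if w.length ≤ n then twistingApprox z h n w
    else if w.length = 1 then w.head?.elim 0 z
    else -h (conv (twistingApprox z h n) (twistingApprox z h n) w)

theorem exists_solution_conv (z : J → B) (h : B → B) :
    ∃ c : List J → B, c [] = 0 ∧ (∀ j, c [j] = z j) ∧
      ∀ w : List J, 2 ≤ w.length → c w = -h (conv c c w) := by
  have hnil : ∀ n, twistingApprox z h n [] = 0 := by
    intro n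
    induction n with
    | zero => rfl
    | succ n ih => rw [twistingApprox, if_pos (by simp), ih]
  have hstab : ∀ n (w : List J), w.length ≤ n →
      twistingApprox z h n w = twistingApprox z h w.length w := by
    intro n w hw
    induction n with
    | zero => rw [Nat.le_zero.1 hw]
    | succ n ih =>
      rcases Nat.lt_or_ge n w.length with h' | h'
      · rw [show w.length = n + 1 by omega]
      · rw [twistingApprox, if_pos h', ih h']
  refine ⟨fun w => twistingApprox z h w.length w, rfl, fun j => by simp [twistingApprox],
    fun w hw => ?_⟩
  obtain ⟨i, j, w, rfl⟩ : ∃ i j w', w = i :: j :: w' := by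
    match w, hw with
    | i :: j :: w', _ => exact ⟨i, j, w', rfl⟩
  simp only [List.length_cons]
  rw [twistingApprox, if_neg (by simp), if_neg (by simp)]
  congr 2
  refine conv_congr fun u v huv => ?_
  have hl : u.length + v.length = w.length + 2 := by
    rw [← List.length_append, huv]; rfl
  rcases u.eq_nil_or_concat with rfl | hu
  · simp [hnil]
  rcases v.eq_nil_or_concat with rfl | hv
  · simp [hnil]
  have hu' : u.length ≠ 0 := by rintro h0; simp_all
  have hv' : v.length ≠ 0 := by rintro h0; simp_all
  rw [hstab _ u (by omega), hstab _ v (by omega)]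

/-- A twisting function: a function on words with odd values such that `d c + c ⋆ c = 0`.  Its
values on words of length one are then odd cocycles. -/
structure IsTwisting (c : List J → B) : Prop where
  nil : c [] = 0
  odd : ∀ w, B.sgn (c w) = -c w
  d_eq : ∀ w, B.d (c w) = -conv c c w

/-- In the absence of even cohomology, every family of odd cocycles extends to a twisting function:
the obstructions are even cocycles.  Letters of square zero may be kept free of higher terms. -/
theorem exists_isTwisting (hB : B.IsConnected) (hev : ∀ i : ℕ, 0 < i → B.Hdeg (2 * i) = ⊥)
    (z : J → B) (hodd : ∀ j, B.sgn (z j) = -z j) (hd : ∀ j, B.d (z j) = 0) :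
    ∃ c : List J → B, IsTwisting c ∧ (∀ j, c [j] = z j) ∧
      ∀ j, z j * z j = 0 → ∀ n, c (List.replicate (n + 2) j) = 0 := by
  classical
  obtain ⟨h, hh0, hh⟩ : ∃ h : B → B, h 0 = 0 ∧ ∀ x, B.sgn x = x → B.d x = 0 → hB.aug x = 0 →
      B.sgn (h x) = -h x ∧ B.d (h x) = x := by
    refine ⟨fun x => if hx : (x ≠ 0 ∧ B.sgn x = x ∧ B.d x = 0 ∧ hB.aug x = 0) then
      (hB.exists_odd_primitive hev hx.2.1 hx.2.2.1 hx.2.2.2).choose else 0, by simp, ?_⟩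
    intro x h1 h2 h3
    by_cases h0 : x = 0
    · simp [h0]
    · have hx : x ≠ 0 ∧ B.sgn x = x ∧ B.d x = 0 ∧ hB.aug x = 0 := ⟨h0, h1, h2, h3⟩
      simp only [dif_pos hx]
      exact (hB.exists_odd_primitive hev h1 h2 h3).choose_spec
  obtain ⟨c, hnil, hone, hc⟩ := exists_solution_conv z h
  have key : ∀ n, ∀ w : List J, w.length ≤ n → B.sgn (c w) = -c w ∧ B.d (c w) = -conv c c w := by
    intro n
    induction n with
    | zero =>
      intro w hw
      obtain rfl := List.length_eq_zero_iff.1 (Nat.le_zero.1 hw)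
      simp [hnil, conv]
    | succ n ih =>
      intro w hw
      rcases Nat.lt_or_ge n w.length with hlt | hle
      swap
      · exact ih w hle
      match w, hw, hlt with
      | [j], _, _ => simp [hone, hodd, hd, conv, hnil]
      | i :: j :: w', hw, hlt =>
        set w := i :: j :: w' with hwdef
        have hsplit : ∀ u v, u ++ v = w → (u = [] ∧ v = w) ∨ (u = w ∧ v = []) ∨
            (u.length ≤ n ∧ v.length ≤ n) := by
          intro u v huv
          have hl : u.length + v.length = w.length := by rw [← List.length_append, huv]
          rcases Nat.eq_zero_or_pos u.length with h0 | h0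
          · left
            obtain rfl := List.length_eq_zero_iff.1 h0
            exact ⟨rfl, huv⟩
          rcases Nat.eq_zero_or_pos v.length with h1 | h1
          · right; left
            obtain rfl := List.length_eq_zero_iff.1 h1
            exact ⟨by simpa using huv, rfl⟩
          · right; right; omega
        have hsgn : B.sgn (conv c c w) = conv c c w := by
          rw [sgn_conv]
          refine conv_congr fun u v huv => ?_
          rcases hsplit u v huv with ⟨rfl, rfl⟩ | ⟨rfl, rfl⟩ | ⟨h1, h2⟩
          · simp [hnil]
          · simp [hnil]
          · rw [(ih u h1).1, (ih v h2).1, neg_mul_neg]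
        have haug : hB.aug (conv c c w) = 0 := by
          have : conv c c w ∈ LinearMap.ker hB.aug.toLinearMap := by
            refine conv_mem _ fun u v huv => ?_
            rcases hsplit u v huv with ⟨rfl, rfl⟩ | ⟨rfl, rfl⟩ | ⟨h1, h2⟩
            · simp [hnil]
            · simp [hnil]
            · rw [LinearMap.mem_ker, AlgHom.toLinearMap_apply, map_mul,
                hB.aug_of_odd (ih u h1).1, zero_mul]
          exact this
        have hdc : B.d (conv c c w) = 0 := by
          rw [d_conv]
          have e1 : conv (fun u => B.d (c u)) c w = conv (fun u => (-1 : B) * conv c c u) c w := by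
            refine conv_congr fun u v huv => ?_
            rcases hsplit u v huv with ⟨rfl, rfl⟩ | ⟨rfl, rfl⟩ | ⟨h1, h2⟩
            · simp [hnil, conv]
            · simp [hnil]
            · rw [(ih u h1).2, neg_one_mul]
          have e2 : conv (fun u => B.sgn (c u)) (fun u => B.d (c u)) w = conv c (conv c c) w := by
            refine conv_congr fun u v huv => ?_
            rcases hsplit u v huv with ⟨rfl, rfl⟩ | ⟨rfl, rfl⟩ | ⟨h1, h2⟩
            · simp [hnil]
            · simp [hnil, conv]
            · rw [(ih u h1).1, (ih v h2).2, neg_mul_neg]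
          rw [e1, e2, conv_mul_left, conv_assoc]
          simp
        have hw2 := hc w (by simp [hwdef])
        obtain ⟨h1, h2⟩ := hh _ hsgn hdc haug
        rw [hw2, map_neg, map_neg, h1, h2]
        exact ⟨rfl, rfl⟩
  refine ⟨c, ⟨hnil, fun w => (key _ w le_rfl).1, fun w => (key _ w le_rfl).2⟩, hone, ?_⟩
  intro j hj n
  induction n using Nat.strong_induction_on with
  | _ n ih =>
    rw [hc _ (by simp)]
    have : conv c c (List.replicate (n + 2) j) ∈ (⊥ : Submodule ℚ B) := by
      refine conv_mem _ fun u v huv => ?_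
      obtain ⟨hl, hu, hv⟩ := List.append_eq_replicate_iff.1 huv
      rw [Submodule.mem_bot, hu, hv]
      rcases hp : u.length with _ | _ | p
      · simp [hnil]
      · rcases hq : v.length with _ | _ | q
        · simp [hnil]
        · simp [hone, hj]
        · rw [ih q (by omega), mul_zero]
      · rcases hq : v.length with _ | q
        · simp [hnil]
        · rw [ih p (by omega), zero_mul]
    rw [(Submodule.mem_bot ℚ).1 this, hh0, neg_zero]

end Words

/-! ### The twisted module on words -/

section WordModule

variable {B : CDGA.{u}} {J : Type u}

/-- The free right `B`-module on the words in `J`. -/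
abbrev WordModule (B : CDGA.{u}) (J : Type u) : Type u := List J →₀ B

namespace WordModule

/-- The right action of `B`. -/
def act : WordModule B J →ₗ[ℚ] B →ₗ[ℚ] WordModule B J :=
  Finsupp.lsum ℚ fun w => (LinearMap.mul ℚ B).compr₂ (Finsupp.lsingle w)

@[simp]
theorem act_single (w : List J) (b b' : B) :
    act (Finsupp.single w b) b' = Finsupp.single w (b * b') := by
  simp [act]

theorem act_act (x : WordModule B J) (b b' : B) : act (act x b) b' = act x (b * b') := by
  induction x using Finsupp.induction_linear with
  | zero => simp
  | add x y hx hy => simp [hx, hy]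
  | single w c => simp [-Finsupp.single_mul, mul_assoc]

theorem act_apply_nil (x : WordModule B J) (b : B) : act x b [] = x [] * b := by
  induction x using Finsupp.induction_linear with
  | zero => simp
  | add x y hx hy => simp [hx, hy, add_mul]
  | single w c => by_cases h : w = [] <;> simp [h]

/-- The grading involution of the coefficients (all words have even degree). -/
def sgn : WordModule B J →ₗ[ℚ] WordModule B J := Finsupp.mapRange.linearMap B.sgn.toLinearMap

@[simp]
theorem sgn_single (w : List J) (b : B) :
    sgn (Finsupp.single w b) = Finsupp.single w (B.sgn b) := by
  simp [sgn]

theorem sgn_act (x : WordModule B J) (b : B) : sgn (act x b) = act (sgn x) (B.sgn b) := by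
  induction x using Finsupp.induction_linear with
  | zero => simp
  | add x y hx hy => simp [hx, hy]
  | single w c => simp [-Finsupp.single_mul]

@[simp]
theorem sgn_sgn (x : WordModule B J) : sgn (sgn x) = x := by
  induction x using Finsupp.induction_linear with
  | zero => simp
  | add x y hx hy => simp [hx, hy]
  | single w c => simp [-Finsupp.single_mul]

/-- Prefixing all words with a letter. -/
def shift (j : J) : WordModule B J →ₗ[ℚ] WordModule B J := Finsupp.lmapDomain B ℚ (List.cons j)

@[simp]
theorem shift_single (j : J) (w : List J) (b : B) :
    shift j (Finsupp.single w b) = Finsupp.single (j :: w) b := by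
  simp [shift]

/-- Stripping a given first letter; words starting differently are sent to zero. -/
def strip (j : J) : WordModule B J →ₗ[ℚ] WordModule B J :=
  Finsupp.lcomapDomain (List.cons j) List.cons_injective

@[simp]
theorem strip_apply (j : J) (x : WordModule B J) (w : List J) : strip j x w = x (j :: w) := rfl

@[simp]
theorem strip_single_cons (j : J) (w : List J) (b : B) :
    strip j (Finsupp.single (j :: w) b) = Finsupp.single w b := by
  classical
  ext v; simp [Finsupp.single_apply]

theorem strip_single_cons_ne {i j : J} (h : i ≠ j) (w : List J) (b : B) :
    strip j (Finsupp.single (i :: w) b) = 0 := by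
  ext v; simp [h]

@[simp]
theorem strip_single_nil (j : J) (b : B) : strip j (Finsupp.single [] b) = 0 := by
  ext v; simp

@[simp]
theorem strip_shift (j : J) (x : WordModule B J) : strip j (shift j x) = x := by
  induction x using Finsupp.induction_linear with
  | zero => simp
  | add x y hx hy => simp [hx, hy]
  | single w c => simp [-Finsupp.single_mul]

theorem strip_shift_ne {i j : J} (h : i ≠ j) (x : WordModule B J) : strip j (shift i x) = 0 := by
  induction x using Finsupp.induction_linear with
  | zero => simp
  | add x y hx hy => simp [hx, hy]
  | single w c => rw [shift_single, strip_single_cons_ne h]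

theorem shift_act (j : J) (x : WordModule B J) (b : B) : shift j (act x b) = act (shift j x) b := by
  induction x using Finsupp.induction_linear with
  | zero => simp
  | add x y hx hy => simp [hx, hy]
  | single w c => simp [-Finsupp.single_mul]

theorem strip_act (j : J) (x : WordModule B J) (b : B) : strip j (act x b) = act (strip j x) b := by
  induction x using Finsupp.induction_linear with
  | zero => simp
  | add x y hx hy => simp [hx, hy]
  | single w c =>
    rcases w with _ | ⟨i, w⟩
    · simp [-Finsupp.single_mul]
    · rcases eq_or_ne i j with rfl | h
      · simp [-Finsupp.single_mul]
      · simp [-Finsupp.single_mul, strip_single_cons_ne h]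

theorem sgn_shift (j : J) (x : WordModule B J) : sgn (shift j x) = shift j (sgn x) := by
  induction x using Finsupp.induction_linear with
  | zero => simp
  | add x y hx hy => simp [hx, hy]
  | single w c => simp [-Finsupp.single_mul]

theorem strip_sgn (j : J) (x : WordModule B J) : strip j (sgn x) = sgn (strip j x) := by
  ext w; simp [sgn]

/-- The right `B`-linear extension of a function on words. -/
def pair (f : List J → B) : WordModule B J →ₗ[ℚ] B :=
  Finsupp.lsum ℚ fun w => LinearMap.mulLeft ℚ (f w)

@[simp]
theorem pair_single (f : List J → B) (w : List J) (b : B) :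
    pair f (Finsupp.single w b) = f w * b := by
  simp [pair]

theorem pair_shift (f : List J → B) (j : J) (x : WordModule B J) :
    pair f (shift j x) = pair (fun w => f (j :: w)) x := by
  induction x using Finsupp.induction_linear with
  | zero => simp
  | add x y hx hy => simp [hx, hy]
  | single w c => simp [-Finsupp.single_mul]

/-- The differential `b ↦ d (w b)` on the summand of a word `w`, defined by recursion on `w`. -/
def wordD (c : List J → B) : List J → B →ₗ[ℚ] WordModule B J
  | [] => Finsupp.lsingle [] ∘ₗ B.d
  | j :: w => shift j ∘ₗ wordD c w + Finsupp.lsingle [] ∘ₗ LinearMap.mulLeft ℚ (c (j :: w))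

/-- The twisted differential on the word module,
`d (w b) = w d(b) + ∑ u c(v) b`, the sum being over the factorizations `w = u v`. -/
def diff (c : List J → B) : WordModule B J →ₗ[ℚ] WordModule B J := Finsupp.lsum ℚ (wordD c)

variable (c : List J → B)

@[simp]
theorem diff_single_nil (b : B) :
    diff c (Finsupp.single [] b) = Finsupp.single [] (B.d b) := by
  simp [diff, wordD]

theorem diff_single_cons (j : J) (w : List J) (b : B) :
    diff c (Finsupp.single (j :: w) b) =
      shift j (diff c (Finsupp.single w b)) + Finsupp.single [] (c (j :: w) * b) := by
  simp [diff, wordD]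

theorem diff_shift (j : J) (x : WordModule B J) :
    diff c (shift j x) =
      shift j (diff c x) + Finsupp.single [] (pair (fun w => c (j :: w)) x) := by
  induction x using Finsupp.induction_linear with
  | zero => simp
  | add x y hx hy => simp only [map_add, hx, hy, Finsupp.single_add]; abel
  | single w b => rw [shift_single, diff_single_cons, pair_single]

theorem strip_diff (j : J) (x : WordModule B J) : strip j (diff c x) = diff c (strip j x) := by
  induction x using Finsupp.induction_linear with
  | zero => simp
  | add x y hx hy => simp [hx, hy]
  | single w b =>
    rcases w with _ | ⟨i, w⟩
    · simp
    · rw [diff_single_cons, map_add, strip_single_nil, add_zero]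
      rcases eq_or_ne i j with rfl | h
      · simp
      · rw [strip_shift_ne h, strip_single_cons_ne h, map_zero]

theorem diff_act (x : WordModule B J) (b : B) :
    diff c (act x b) = act (diff c x) b + act (sgn x) (B.d b) := by
  induction x using Finsupp.induction_linear with
  | zero => simp
  | add x y hx hy => simp only [map_add, LinearMap.add_apply, hx, hy]; abel
  | single w b' =>
    induction w with
    | nil => simp [-Finsupp.single_mul, CDGA.d_mul]
    | cons j w ih =>
      rw [act_single, sgn_single, act_single] at ih
      rw [act_single, diff_single_cons, ih, diff_single_cons]
      simp only [map_add, LinearMap.add_apply, act_single, shift_act, sgn_single, shift_single,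
        mul_assoc]
      abel

variable {c}
variable (hc : IsTwisting c)
include hc

theorem diff_sgn (x : WordModule B J) : diff c (sgn x) = -sgn (diff c x) := by
  induction x using Finsupp.induction_linear with
  | zero => simp
  | add x y hx hy => simp only [map_add, hx, hy]; abel
  | single w b =>
    induction w with
    | nil => simp [CDGA.sgn_d]
    | cons j w ih =>
      rw [sgn_single] at ih
      rw [sgn_single, diff_single_cons, ih, diff_single_cons, map_add, sgn_single, map_mul, hc.odd,
        sgn_shift, map_neg, neg_add, ← Finsupp.single_neg, neg_mul, neg_neg]

theorem pair_diff_single (f : List J → B) (w : List J) (b : B) :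
    pair f (diff c (Finsupp.single w b)) = f w * B.d b + conv f c w * b := by
  induction w generalizing f with
  | nil => simp [conv, hc.nil]
  | cons j w ih =>
    rw [diff_single_cons, map_add, pair_shift, ih, pair_single, conv]
    simp only [add_mul, mul_assoc]
    abel

theorem diff_diff (x : WordModule B J) : diff c (diff c x) = 0 := by
  induction x using Finsupp.induction_linear with
  | zero => simp
  | add x y hx hy => simp [hx, hy]
  | single w b =>
    induction w with
    | nil => simp [B.d_d]
    | cons j w ih =>
      have h := hc.d_eq (j :: w)
      rw [conv, hc.nil, zero_mul, zero_add] at h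
      rw [diff_single_cons, map_add, diff_shift, ih, map_zero, zero_add, pair_diff_single hc,
        diff_single_nil, CDGA.d_mul, h, hc.odd, ← Finsupp.single_add]
      simp

section Acyclic

variable (hB : B.IsConnected)

theorem aug_diff (x : WordModule B J) : hB.aug (diff c x []) = 0 := by
  induction x using Finsupp.induction_linear with
  | zero => simp
  | add x y hx hy => simp [hx, hy]
  | single w b =>
    rcases w with _ | ⟨j, w⟩
    · simp [hB.aug_d]
    · have : ∀ y : WordModule B J, shift j y [] = 0 := by
        intro y
        rw [shift, Finsupp.lmapDomain_apply]
        exact Finsupp.mapDomain_of_notMem_range _ _ (by simp)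
      rw [diff_single_cons, Finsupp.add_apply, this]
      simp [hB.aug_of_odd (hc.odd _)]

omit hc in
theorem exists_eq_sum_shift_strip (x : WordModule B J) : ∃ F : Finset J,
    x = Finsupp.single [] (x []) + ∑ j ∈ F, shift j (strip j x) := by
  classical
  induction x using Finsupp.induction_linear with
  | zero => exact ⟨∅, by simp⟩
  | add x y hx hy =>
    have aux : ∀ (x : WordModule B J) (F : Finset J),
        x = Finsupp.single [] (x []) + ∑ j ∈ F, shift j (strip j x) → ∀ G, F ⊆ G →
        x = Finsupp.single [] (x []) + ∑ j ∈ G, shift j (strip j x) := by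
      intro x F hF G hFG
      rw [← Finset.sum_subset hFG, ← hF]
      intro j _ hj
      have : strip j x = 0 := by
        rw [hF, map_add, strip_single_nil, zero_add, map_sum]
        refine Finset.sum_eq_zero fun i hi => strip_shift_ne ?_ _
        rintro rfl; exact hj hi
      rw [this, map_zero]
    obtain ⟨F, hF⟩ := hx
    obtain ⟨G, hG⟩ := hy
    refine ⟨F ∪ G, ?_⟩
    have h1 := aux x F hF (F ∪ G) Finset.subset_union_left
    have h2 := aux y G hG (F ∪ G) Finset.subset_union_right
    simp only [map_add, Finset.sum_add_distrib, Finsupp.add_apply, Finsupp.single_add]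
    conv_lhs => rw [h1, h2]
    abel
  | single w b =>
    rcases w with _ | ⟨j, w⟩
    · exact ⟨∅, by simp⟩
    · exact ⟨{j}, by simp⟩

/-- If the letters represent a basis of the odd cohomology of `B`, and `B` has no even cohomology
in positive degrees, the word module is a resolution of `ℚ`: its augmented complex is exact. -/
theorem exists_primitive (hev : ∀ i : ℕ, 0 < i → B.Hdeg (2 * i) = ⊥)
    (hspan : ∀ x, B.sgn x = -x → B.d x = 0 →
      ∃ (l : J →₀ ℚ) (y : B), x = (l.sum fun j r => r • c [j]) + B.d y)
    (hindep : ∀ (l : J →₀ ℚ) (y : B), (l.sum fun j r => r • c [j]) = B.d y → l = 0)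
    {x : WordModule B J} (hx : diff c x = 0) (haug : hB.aug (x []) = 0) :
    ∃ y, diff c y = x := by
  classical
  have hletter : ∀ (j : J) (r : ℚ), diff c (Finsupp.single [j] (r • (1 : B))) =
      Finsupp.single [] (r • c [j]) := by
    intro j r
    rw [diff_single_cons, diff_single_nil]; simp
  -- the case of the empty word
  have base : ∀ b : B, B.d b = 0 → hB.aug b = 0 →
      Finsupp.single [] b ∈ LinearMap.range (diff c) := by
    intro b hb hb'
    have hsb : B.d (B.sgn b) = 0 := by
      have := CDGA.sgn_d b
      rw [hb, map_zero, eq_comm, neg_eq_zero] at this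
      exact this
    obtain ⟨y, -, hy⟩ := hB.exists_odd_primitive hev (x := (2⁻¹ : ℚ) • (b + B.sgn b))
      (by rw [map_smul, map_add, CDGA.sgn_sgn, add_comm])
      (by rw [map_smul, map_add, hb, hsb, add_zero, smul_zero])
      (by rw [map_smul, map_add, hB.aug_sgn, hb', add_zero, smul_zero])
    obtain ⟨l, y', hy'⟩ := hspan ((2⁻¹ : ℚ) • (b - B.sgn b))
      (by rw [map_smul, map_sub, CDGA.sgn_sgn, ← smul_neg, neg_sub])
      (by rw [map_smul, map_sub, hb, hsb, sub_zero, smul_zero])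
    have hsum : b = B.d y + ((l.sum fun j r => r • c [j]) + B.d y') := by
      rw [← hy', hy, ← smul_add, add_add_sub_cancel, ← two_smul ℚ, smul_smul]
      norm_num
    refine ⟨Finsupp.single [] (y + y') + l.sum fun j r => Finsupp.single [j] (r • (1 : B)), ?_⟩
    rw [map_add, diff_single_nil, hsum, Finsupp.sum, map_sum, Finsupp.sum]
    simp only [hletter, ← Finsupp.single_finsetSum]
    rw [← Finsupp.single_add, map_add]
    congr 1
    abel
  have key : ∀ n, ∀ x : WordModule B J, (∀ w, x w ≠ 0 → w.length < n) → diff c x = 0 →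
      hB.aug (x []) = 0 → x ∈ LinearMap.range (diff c) := by
    intro n
    induction n with
    | zero =>
      intro x hx _ _
      have : x = 0 := by
        ext w
        by_contra h
        exact absurd (hx w h) (by simp)
      rw [this]; exact zero_mem _
    | succ n ih =>
      intro x hlen hx haug
      obtain ⟨F, hF⟩ := exists_eq_sum_shift_strip x
      -- each stripped element is a scalar plus a boundary, by induction on the length of words
      have hstrip : ∀ j, ∃ y, strip j x = Finsupp.single [] (hB.aug (x [j]) • (1 : B)) + diff c y := by
        intro j
        obtain ⟨y, hy⟩ := ih (strip j x - Finsupp.single [] (hB.aug (x [j]) • (1 : B))) (by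
            intro w hw
            rcases w with _ | ⟨i, w⟩
            · by_contra hn
              obtain rfl : n = 0 := by simpa using hn
              have h1 : x [j] = 0 := by
                by_contra h0
                exact absurd (hlen _ h0) (by simp)
              simp [h1] at hw
            · have h1 : x (j :: i :: w) ≠ 0 := by simpa using hw
              have := hlen _ h1
              simp only [List.length_cons] at this ⊢
              omega)
          (by rw [map_sub, ← strip_diff, hx, map_zero, diff_single_nil]; simp)
          (by simp)
        exact ⟨y, by rw [hy]; abel⟩
      choose y hy using hstrip
      have hred : ∃ b : B, x - diff c (∑ j ∈ F, shift j (y j)) = Finsupp.single [] b +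
          ∑ j ∈ F, Finsupp.single [j] (hB.aug (x [j]) • (1 : B)) := by
        refine ⟨x [] - ∑ j ∈ F, pair (fun w => c (j :: w)) (y j), ?_⟩
        conv_lhs => rw [hF]
        simp only [hy, map_add, shift_single, map_sum, diff_shift, Finset.sum_add_distrib,
          Finsupp.single_sub, Finsupp.single_finsetSum]
        abel
      obtain ⟨b, hb⟩ := hred
      have hd : diff c (x - diff c (∑ j ∈ F, shift j (y j))) = 0 := by
        rw [map_sub, hx, diff_diff hc, sub_zero]
      -- the scalars vanish, because the letters are linearly independent in cohomology
      have hlin : ∀ j ∈ F, hB.aug (x [j]) = 0 := by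
        rw [hb, map_add, diff_single_nil, map_sum] at hd
        simp only [hletter, ← Finsupp.single_finsetSum, ← Finsupp.single_add] at hd
        rw [Finsupp.single_eq_zero] at hd
        set l : J →₀ ℚ := Finsupp.onFinset F (fun j => if j ∈ F then hB.aug (x [j]) else 0)
          (fun j hj => by by_contra h; simp [h] at hj) with hl
        have hl0 := hindep l (-b) (by
          rw [map_neg, eq_neg_iff_add_eq_zero, add_comm, ← hd, hl,
            Finsupp.onFinset_sum _ (by simp)]
          congr 1
          exact Finset.sum_congr rfl fun j hj => by rw [if_pos hj])
        intro j hj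
        have := DFunLike.congr_fun hl0 j
        simpa [hl, hj] using this
      have hzero : ∑ j ∈ F, Finsupp.single [j] (hB.aug (x [j]) • (1 : B)) = 0 :=
        Finset.sum_eq_zero fun j hj => by rw [hlin j hj, zero_smul, Finsupp.single_zero]
      rw [hzero, add_zero] at hb
      have hb1 : B.d b = 0 := by
        rw [hb, diff_single_nil, Finsupp.single_eq_zero] at hd; exact hd
      have hb2 : hB.aug b = 0 := by
        have h := congrArg (fun v : WordModule B J => hB.aug (v [])) hb
        simp only [Finsupp.sub_apply, map_sub, haug, aug_diff hc, sub_zero,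
          Finsupp.single_eq_same] at h
        exact h.symm
      have := add_mem (base b hb1 hb2) (LinearMap.mem_range_self (diff c) (∑ j ∈ F, shift j (y j)))
      rwa [← hb, sub_add_cancel] at this
  obtain ⟨n, hn⟩ : ∃ n, ∀ w, x w ≠ 0 → w.length < n :=
    ⟨x.support.sup List.length + 1, fun w hw =>
      Nat.lt_succ_of_le (Finset.le_sup (f := List.length) (Finsupp.mem_support_iff.2 hw))⟩
  exact key n x hn hx haug

end Acyclic

omit hc in
/-- The powers of a letter of square zero form a sequence of divided powers of a primitive of that
letter. -/
theorem diff_replicate (j : J) (h : ∀ n, c (List.replicate (n + 2) j) = 0)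
    (n : ℕ) (b : B) :
    diff c (Finsupp.single (List.replicate (n + 1) j) b) =
      Finsupp.single (List.replicate n j) (c [j] * b) +
        Finsupp.single (List.replicate (n + 1) j) (B.d b) := by
  induction n with
  | zero => simp [diff_single_cons, add_comm]
  | succ n ih =>
    rw [List.replicate_succ, diff_single_cons, ih, ← List.replicate_succ, h]
    simp [← List.replicate_succ, -Finsupp.single_mul]

end WordModule

end WordModule

/-! ### Contractions of acyclic complexes -/

section Contraction

variable {S : Type*} [AddCommGroup S] [Module ℚ S]

/-- An exact complex of vector spaces is contractible relative to an augmentation `ε` with a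
section `e`. -/
theorem exists_contraction (d : S →ₗ[ℚ] S) (ε : S →ₗ[ℚ] ℚ) (e : S)
    (hd : ∀ x, d (d x) = 0) (hεd : ∀ x, ε (d x) = 0) (hε : ε e = 1) (he : d e = 0)
    (hex : ∀ x, d x = 0 → ε x = 0 → ∃ y, d y = x) :
    ∃ h : S →ₗ[ℚ] S, (∀ x, ε (h x) = 0) ∧ ∀ x, d (h x) + h (d x) = x - ε x • e := by
  -- `p` projects to the kernel of the augmentation
  let p : S →ₗ[ℚ] S := LinearMap.id - ε.smulRight e
  have hp : ∀ x, p x = x - ε x • e := fun x => rfl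
  have hεp : ∀ x, ε (p x) = 0 := fun x => by rw [hp, map_sub, map_smul, hε]; simp
  have hdp : ∀ x, d (p x) = d x := fun x => by rw [hp, map_sub, map_smul, he]; simp
  obtain ⟨t, ht⟩ : ∃ t : LinearMap.range d →ₗ[ℚ] S, d.rangeRestrict ∘ₗ t = LinearMap.id :=
    LinearMap.exists_rightInverse_of_surjective _ (LinearMap.range_rangeRestrict d)
  obtain ⟨q, hq⟩ : ∃ q : S →ₗ[ℚ] LinearMap.range d, q ∘ₗ (LinearMap.range d).subtype =
      LinearMap.id :=
    LinearMap.exists_leftInverse_of_injective _ (Submodule.ker_subtype _)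
  let s : S →ₗ[ℚ] S := p ∘ₗ t ∘ₗ q
  have hs : ∀ x, d x = 0 → ε x = 0 → d (s x) = x := by
    intro x hx hx'
    obtain ⟨y, rfl⟩ := hex x hx hx'
    have h1 : q (d y) = ⟨d y, y, rfl⟩ := LinearMap.congr_fun hq ⟨d y, y, rfl⟩
    have h2 := congrArg Subtype.val (LinearMap.congr_fun ht ⟨d y, y, rfl⟩)
    change d (p (t (q (d y)))) = d y
    rw [hdp, h1]
    exact h2
  refine ⟨s ∘ₗ (p - s ∘ₗ d), fun x => hεp _, fun x => ?_⟩
  have h1 : d (p x - s (d x)) = 0 := by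
    rw [map_sub, hdp, hs _ (hd x) (hεd x), sub_self]
  have h2 : ε (p x - s (d x)) = 0 := by
    rw [map_sub, hεp, zero_sub, neg_eq_zero]; exact hεp _
  simp only [LinearMap.comp_apply, LinearMap.sub_apply]
  rw [hs _ h1 h2, hd, map_zero, sub_zero, hp (d x), hεd, zero_smul, sub_zero, hp]
  abel

end Contraction

/-! ### Algebraic fibrations over a connected base -/

namespace AlgFibration

variable {A : CDGA.{u}} (σ : AlgFibration A)

/-- The algebra `ΛV` of a fibration. -/
abbrev Lam : Type u := FreeGCA σ.grV

/-- The inclusion `ΛV → A ⊗ ΛV` as an algebra map. -/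
def genHom : σ.Lam →ₐ[ℚ] σ.total := FreeGCA.lift σ.grV σ.total σ.gen σ.gen_mem

@[simp]
theorem genHom_ι (v : σ.V) : σ.genHom (FreeGCA.ι σ.grV v) = σ.gen v := FreeGCA.lift_ι _ _ _ _ _

theorem genHom_mem {n : ℕ} {w : σ.Lam} (hw : w ∈ FreeGCA.gr σ.grV n) :
    σ.genHom w ∈ σ.total.gr n := FreeGCA.lift_mem _ _ _ hw

theorem genHom_sign (w : σ.Lam) :
    σ.genHom (gradeSign (FreeGCA.gr σ.grV) w) = σ.total.sgn (σ.genHom w) := by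
  have : σ.genHom.toLinearMap ∘ₗ (gradeSign (FreeGCA.gr σ.grV)).toLinearMap =
      σ.total.sgn.toLinearMap ∘ₗ σ.genHom.toLinearMap :=
    linearMap_ext_of_graded (FreeGCA.gr σ.grV) fun n w hw => by
      simp only [LinearMap.comp_apply, AlgHom.toLinearMap_apply]
      rw [gradeSign_of_mem _ hw, CDGA.sgn_of_mem (σ.genHom_mem hw), map_smul]
  exact LinearMap.congr_fun this w

/-- The multiplication map `(a, w) ↦ a w`. -/
def mulBilin : A →ₗ[ℚ] σ.Lam →ₗ[ℚ] σ.total :=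
  (LinearMap.mul ℚ σ.total).compl₁₂ σ.incl.toAlgHom.toLinearMap σ.genHom.toLinearMap

/-- The identification of `A ⊗ ΛV` with the total space. -/
def equiv : A ⊗[ℚ] σ.Lam ≃ₗ[ℚ] σ.total :=
  LinearEquiv.ofBijective (TensorProduct.lift σ.mulBilin) σ.bijective

@[simp]
theorem equiv_tmul (a : A) (w : σ.Lam) :
    σ.equiv (a ⊗ₜ w) = σ.incl.toAlgHom a * σ.genHom w := rfl

theorem equiv_symm_incl_mul_genHom (a : A) (w : σ.Lam) :
    σ.equiv.symm (σ.incl.toAlgHom a * σ.genHom w) = a ⊗ₜ w := by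
  rw [← equiv_tmul, LinearEquiv.symm_apply_apply]

/-- Induction on elements of the total space as sums of products `a w`. -/
@[elab_as_elim]
theorem total_induction {P : σ.total → Prop} (e : σ.total) (zero : P 0)
    (mul : ∀ a w, P (σ.incl.toAlgHom a * σ.genHom w)) (add : ∀ x y, P x → P y → P (x + y)) :
    P e := by
  obtain ⟨t, rfl⟩ := σ.equiv.surjective e
  induction t using TensorProduct.induction_on with
  | zero => rw [map_zero]; exact zero
  | tmul a w => exact mul a w
  | add x y hx hy => rw [map_add]; exact add _ _ hx hy

/-- The augmentation `ΛV → ℚ`. -/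
def augLam : σ.Lam →ₐ[ℚ] ℚ := FreeGCA.liftAlg σ.grV 0 (by simp)

variable {σ} in
theorem total_isConnected (hA : A.IsConnected) : σ.total.IsConnected where
  one_ne_zero := by
    intro h
    have h1 : σ.equiv ((1 : A) ⊗ₜ (1 : σ.Lam)) = 0 := by
      rw [equiv_tmul, map_one, map_one, one_mul, h]
    have h2 := congrArg (TensorProduct.lid ℚ ℚ ∘
      TensorProduct.map hA.aug.toLinearMap σ.augLam.toLinearMap)
      ((LinearEquiv.map_eq_zero_iff σ.equiv).1 h1)
    simp at h2
  gr_zero := by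
    set E := σ.total with hE
    have hone : (1 : E) ∈ E.gr 0 := SetLike.GradedOne.one_mem
    refine le_antisymm ?_ (Submodule.span_le.2 (by simpa using hone))
    -- the elements whose degree zero part is a scalar form a subalgebra containing all generators
    let T : Subalgebra ℚ E := (⊥ : Subalgebra ℚ E).comap
      { GradedRing.projZeroRingHom E.gr with
        commutes' := fun r => proj_of_mem_same E.gr (SetLike.algebraMap_mem_graded E.gr r) }
    have hT : ∀ x : E, x ∈ T ↔ GradedAlgebra.proj E.gr 0 x ∈ (⊥ : Subalgebra ℚ E) :=
      fun x => Iff.rfl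
    have hA' : ∀ a : A, σ.incl.toAlgHom a ∈ T := by
      intro a
      rw [hT, ← σ.incl.map_proj, ← hA.aug_smul_one, map_smul, map_one]
      exact Subalgebra.smul_mem _ (one_mem _) _
    have hV : ∀ w : σ.Lam, σ.genHom w ∈ T := by
      intro w
      induction w using FreeGCA.induction with
      | algebraMap r => rw [AlgHom.commutes]; exact T.algebraMap_mem r
      | ι v =>
        rw [genHom_ι]
        induction v using DirectSum.Decomposition.inductionOn σ.grV with
        | zero => rw [map_zero]; exact zero_mem _
        | @homogeneous m v =>
          rcases Nat.eq_zero_or_pos m with rfl | hm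
          · have : (v : σ.V) = 0 := (Submodule.mem_bot ℚ).1 (σ.grV_zero.le v.2)
            rw [this, map_zero]; exact zero_mem _
          · rw [hT, proj_of_mem_ne _ (σ.gen_mem v.2) hm.ne']; exact zero_mem _
        | add v w hv hw => rw [map_add]; exact add_mem hv hw
      | mul x y hx hy => rw [map_mul]; exact mul_mem hx hy
      | add x y hx hy => rw [map_add]; exact add_mem hx hy
    have htop : ∀ x : E, x ∈ T := by
      intro x
      induction x using σ.total_induction with
      | zero => exact zero_mem _
      | mul a w => exact mul_mem (hA' a) (hV w)
      | add x y hx hy => exact add_mem hx hy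
    intro x hx
    have := (hT x).1 (htop x)
    rw [proj_of_mem_same _ hx, Algebra.mem_bot] at this
    obtain ⟨r, rfl⟩ := this
    rw [Algebra.algebraMap_eq_smul_one]
    exact Submodule.smul_mem _ _ (Submodule.mem_span_singleton_self _)

theorem incl_mul_mem_fiberIdeal {i : ℕ} (hi : 0 < i) {a : A} (ha : a ∈ A.gr i) (e : σ.total) :
    σ.incl.toAlgHom a * e ∈ σ.fiberIdeal := by
  have h := CDGA.mul_comm_of_mem (σ.incl.map_gr ha) (σ.total.sgn^[i] e)
  have hinv : σ.total.sgn^[i] (σ.total.sgn^[i] e) = e :=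
    Function.LeftInverse.iterate (g := σ.total.sgn) (f := σ.total.sgn) CDGA.sgn_sgn i e
  rw [hinv] at h
  rw [← h]
  exact Submodule.subset_span ⟨_, i, a, hi, ha, rfl⟩

theorem proj_zero_of_mem_fiberIdeal {e : σ.total} (he : e ∈ σ.fiberIdeal) :
    GradedAlgebra.proj σ.total.gr 0 e = 0 := by
  refine (Submodule.span_le (p := LinearMap.ker (GradedAlgebra.proj σ.total.gr 0))).2 ?_ he
  rintro _ ⟨e, i, a, hi, ha, rfl⟩
  have h : GradedRing.projZeroRingHom σ.total.gr (e * σ.incl.toAlgHom a) =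
    GradedAlgebra.proj σ.total.gr 0 e * GradedAlgebra.proj σ.total.gr 0 (σ.incl.toAlgHom a) :=
    map_mul _ _ _
  rw [proj_of_mem_ne _ (σ.incl.map_gr ha) hi.ne', mul_zero] at h
  exact h

variable {σ} in
/-- Vanishing of the fiber cohomology in degree `n`, in terms of elements of the total space. -/
theorem exists_sub_d_mem_fiberIdeal {n : ℕ} (h : cohomologyDeg σ.fiberGr σ.fiberD n = ⊥)
    {e : σ.total} (he : e ∈ σ.total.gr n) (hde : σ.total.d e ∈ σ.fiberIdeal) :
    ∃ z, e - σ.total.d z ∈ σ.fiberIdeal := by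
  unfold cohomologyDeg at h
  rw [← le_bot_iff, Submodule.map_le_iff_le_comap, Submodule.comap_bot, Submodule.ker_mkQ] at h
  have hk : σ.fiberD (σ.fiberIdeal.mkQ e) = 0 := (Submodule.Quotient.mk_eq_zero _).2 hde
  obtain ⟨z, hz⟩ := h (show (⟨_, hk⟩ : LinearMap.ker σ.fiberD) ∈ _ from ⟨e, he, rfl⟩)
  obtain ⟨z, rfl⟩ := Submodule.Quotient.mk_surjective _ z
  refine ⟨z, ?_⟩
  rw [← Submodule.Quotient.mk_eq_zero, Submodule.Quotient.mk_sub, sub_eq_zero]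
  exact hz.symm

section FiberProjection

variable (hA : A.IsConnected)

/-- The projection `A ⊗ ΛV → ΛV` induced by the augmentation of `A`; its kernel is the ideal
generated by `A⁺`. -/
def fiberProj : σ.total →ₗ[ℚ] σ.Lam :=
  ((TensorProduct.lid ℚ σ.Lam).toLinearMap ∘ₗ hA.aug.toLinearMap.rTensor σ.Lam) ∘ₗ
    σ.equiv.symm.toLinearMap

theorem fiberProj_incl_mul_genHom (a : A) (w : σ.Lam) :
    σ.fiberProj hA (σ.incl.toAlgHom a * σ.genHom w) = hA.aug a • w := by
  simp only [fiberProj, LinearMap.comp_apply, LinearEquiv.coe_coe, equiv_symm_incl_mul_genHom,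
    LinearMap.rTensor_tmul, TensorProduct.lid_tmul, AlgHom.toLinearMap_apply]

theorem fiberProj_incl_mul (a : A) (e : σ.total) :
    σ.fiberProj hA (σ.incl.toAlgHom a * e) = hA.aug a • σ.fiberProj hA e := by
  induction e using σ.total_induction with
  | zero => simp
  | mul a' w =>
    rw [← mul_assoc, ← map_mul, fiberProj_incl_mul_genHom, fiberProj_incl_mul_genHom, map_mul,
      mul_smul]
  | add x y hx hy => rw [mul_add, map_add, hx, hy, map_add, smul_add]

theorem sub_fiberProj_mem (e : σ.total) : e - σ.genHom (σ.fiberProj hA e) ∈ σ.fiberIdeal := by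
  induction e using σ.total_induction with
  | zero => simp
  | mul a w =>
    rw [fiberProj_incl_mul_genHom, map_smul, ← one_mul (σ.genHom w), ← smul_mul_assoc, ← map_one
      σ.incl.toAlgHom, ← map_smul, hA.aug_smul_one, ← mul_assoc, ← map_mul, mul_one, ← sub_mul,
      ← map_sub]
    induction a using DirectSum.Decomposition.inductionOn A.gr with
    | zero => simp
    | @homogeneous m a =>
      rcases Nat.eq_zero_or_pos m with rfl | hm
      · rw [proj_of_mem_same _ a.2, sub_self, map_zero, zero_mul]; exact zero_mem _
      · rw [proj_of_mem_ne _ a.2 hm.ne', sub_zero]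
        exact σ.incl_mul_mem_fiberIdeal hm a.2 _
    | add a b ha hb =>
      rw [map_add, add_sub_add_comm, map_add, add_mul]; exact add_mem ha hb
  | add x y hx hy =>
    rw [map_add, map_add, add_sub_add_comm]; exact add_mem hx hy

theorem mem_fiberIdeal_iff (e : σ.total) : e ∈ σ.fiberIdeal ↔ σ.fiberProj hA e = 0 := by
  constructor
  · intro he
    refine (Submodule.span_le (p := LinearMap.ker (σ.fiberProj hA))).2 ?_ he
    rintro _ ⟨e, i, a, hi, ha, rfl⟩
    rw [CDGA.mul_comm_of_mem (σ.incl.map_gr ha)]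
    change σ.fiberProj hA _ = 0
    rw [fiberProj_incl_mul, hA.aug_of_mem hi ha, zero_smul]
  · intro he
    have := σ.sub_fiberProj_mem hA e
    rwa [he, map_zero, sub_zero] at this

end FiberProjection

/-! ### The nilpotence filtration of the fiber -/

/-- The `A`-submodule `A · N` of the total space generated by a subspace `N` of `ΛV`. -/
def baseSpan (N : Submodule ℚ σ.Lam) : Submodule ℚ σ.total := Submodule.map₂ σ.mulBilin ⊤ N

theorem baseSpan_mono {N N' : Submodule ℚ σ.Lam} (h : N ≤ N') : σ.baseSpan N ≤ σ.baseSpan N' :=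
  Submodule.map₂_le_map₂_right h

theorem incl_mul_genHom_mem {N : Submodule ℚ σ.Lam} (a : A) {w : σ.Lam} (hw : w ∈ N) :
    σ.incl.toAlgHom a * σ.genHom w ∈ σ.baseSpan N :=
  Submodule.apply_mem_map₂ σ.mulBilin Submodule.mem_top hw

theorem genHom_mem_baseSpan {N : Submodule ℚ σ.Lam} {w : σ.Lam} (hw : w ∈ N) :
    σ.genHom w ∈ σ.baseSpan N := by
  simpa using σ.incl_mul_genHom_mem 1 hw

/-- The filtration `L₀ = 0`, `Lₘ₊₁ = {w | d w ∈ A · Lₘ}` of `ΛV`.  It measures how the differential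
of the total space is built up, and is exhaustive because `V` is nilpotent. -/
def nilFil : ℕ → Submodule ℚ σ.Lam
  | 0 => ⊥
  | m + 1 => (σ.baseSpan (nilFil m)).comap (σ.total.d ∘ₗ σ.genHom.toLinearMap)

theorem mem_nilFil_succ {m : ℕ} {w : σ.Lam} :
    w ∈ σ.nilFil (m + 1) ↔ σ.total.d (σ.genHom w) ∈ σ.baseSpan (σ.nilFil m) := Iff.rfl

theorem nilFil_mono : Monotone σ.nilFil := by
  refine monotone_nat_of_le_succ fun m => ?_
  induction m with
  | zero => exact bot_le
  | succ m ih => exact fun w hw => σ.baseSpan_mono ih hw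

theorem sgn_mem_baseSpan {N : Submodule ℚ σ.Lam}
    (hN : ∀ w ∈ N, gradeSign (FreeGCA.gr σ.grV) w ∈ N) {e : σ.total} (he : e ∈ σ.baseSpan N) :
    σ.total.sgn e ∈ σ.baseSpan N := by
  suffices h : σ.baseSpan N ≤ (σ.baseSpan N).comap σ.total.sgn.toLinearMap from h he
  refine Submodule.map₂_le.2 fun a _ w hw => ?_
  change σ.total.sgn (σ.incl.toAlgHom a * σ.genHom w) ∈ σ.baseSpan N
  rw [map_mul, ← σ.incl.map_sgn, ← genHom_sign]
  exact σ.incl_mul_genHom_mem _ (hN w hw)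

theorem sign_mem_nilFil (m : ℕ) : ∀ w ∈ σ.nilFil m,
    gradeSign (FreeGCA.gr σ.grV) w ∈ σ.nilFil m := by
  induction m with
  | zero =>
    intro w hw
    rw [(Submodule.mem_bot ℚ).1 hw, map_zero]; exact zero_mem _
  | succ m ih =>
    intro w hw
    rw [mem_nilFil_succ, genHom_sign, ← neg_neg (σ.total.d _), ← CDGA.sgn_d]
    exact neg_mem (σ.sgn_mem_baseSpan ih hw)

theorem mul_mem_baseSpan {N₁ N₂ N₃ : Submodule ℚ σ.Lam}
    (hsgn : ∀ w ∈ N₁, gradeSign (FreeGCA.gr σ.grV) w ∈ N₁)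
    (hmul : ∀ w₁ ∈ N₁, ∀ w₂ ∈ N₂, w₁ * w₂ ∈ N₃) {e₁ e₂ : σ.total}
    (h₁ : e₁ ∈ σ.baseSpan N₁) (h₂ : e₂ ∈ σ.baseSpan N₂) : e₁ * e₂ ∈ σ.baseSpan N₃ := by
  suffices h : Submodule.map₂ (LinearMap.mul ℚ σ.total) (σ.baseSpan N₁) (σ.baseSpan N₂) ≤
      σ.baseSpan N₃ from h (Submodule.apply_mem_map₂ _ h₁ h₂)
  clear h₁ h₂
  refine Submodule.map₂_le.2 fun e₁ h₁ e₂ h₂ => ?_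
  suffices h : σ.baseSpan N₁ ≤ (σ.baseSpan N₃).comap (LinearMap.mulRight ℚ e₂) from h h₁
  refine Submodule.map₂_le.2 fun a _ w hw => ?_
  change σ.incl.toAlgHom a * σ.genHom w * e₂ ∈ σ.baseSpan N₃
  suffices h : σ.baseSpan N₂ ≤ (σ.baseSpan N₃).comap
    (LinearMap.mulLeft ℚ (σ.incl.toAlgHom a * σ.genHom w)) from h h₂
  refine Submodule.map₂_le.2 fun a' _ w' hw' => ?_
  change σ.incl.toAlgHom a * σ.genHom w * (σ.incl.toAlgHom a' * σ.genHom w') ∈ σ.baseSpan N₃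
  induction a' using DirectSum.Decomposition.inductionOn A.gr with
  | zero => simp
  | @homogeneous p a' =>
    have hit : ∀ p : ℕ, ∃ w₁ ∈ N₁, σ.total.sgn^[p] (σ.genHom w) = σ.genHom w₁ := by
      intro p
      induction p with
      | zero => exact ⟨w, hw, rfl⟩
      | succ p ih =>
        obtain ⟨w₁, hw₁, h⟩ := ih
        exact ⟨_, hsgn _ hw₁, by rw [Function.iterate_succ_apply', h, genHom_sign]⟩
    obtain ⟨w₁, hw₁, h⟩ := hit p
    have : σ.incl.toAlgHom a * σ.genHom w * (σ.incl.toAlgHom a' * σ.genHom w') =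
        σ.incl.toAlgHom (a * a') * σ.genHom (w₁ * w') := by
      rw [mul_assoc, ← mul_assoc (σ.genHom w), CDGA.mul_comm_of_mem (σ.incl.map_gr a'.2), h,
        map_mul, map_mul]
      simp only [mul_assoc]
    rw [this]
    exact σ.incl_mul_genHom_mem _ (hmul _ hw₁ _ hw')
  | add a b ha hb => rw [map_add, add_mul, mul_add]; exact add_mem (ha trivial) (hb trivial)

theorem mul_mem_nilFil {i j : ℕ} {w w' : σ.Lam} (hw : w ∈ σ.nilFil (i + 1))
    (hw' : w' ∈ σ.nilFil (j + 1)) : w * w' ∈ σ.nilFil (i + j + 1) := by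
  induction hn : i + j generalizing i j w w' with
  | zero =>
    obtain ⟨rfl, rfl⟩ : i = 0 ∧ j = 0 := by omega
    have h0 : σ.baseSpan (σ.nilFil 0) = ⊥ := by simp [baseSpan, nilFil]
    rw [mem_nilFil_succ, h0, Submodule.mem_bot] at hw hw'
    rw [mem_nilFil_succ, h0, map_mul, CDGA.d_mul, hw, hw', zero_mul, mul_zero, add_zero]
    exact zero_mem _
  | succ n ih =>
    rw [mem_nilFil_succ, map_mul, CDGA.d_mul, ← genHom_sign]
    refine add_mem (σ.mul_mem_baseSpan (σ.sign_mem_nilFil i) ?_ (σ.mem_nilFil_succ.1 hw)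
      (σ.genHom_mem_baseSpan hw')) (σ.mul_mem_baseSpan (σ.sign_mem_nilFil (i + 1)) ?_
      (σ.genHom_mem_baseSpan (σ.sign_mem_nilFil _ _ hw)) (σ.mem_nilFil_succ.1 hw'))
    · intro w₁ h₁ w₂ h₂
      rcases i with _ | i
      · rw [(Submodule.mem_bot ℚ).1 h₁, zero_mul]; exact zero_mem _
      · exact ih h₁ h₂ (by omega)
    · intro w₁ h₁ w₂ h₂
      rcases j with _ | j
      · rw [(Submodule.mem_bot ℚ).1 h₂, mul_zero]; exact zero_mem _
      · exact ih h₁ h₂ (by omega)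

theorem one_mem_nilFil : (1 : σ.Lam) ∈ σ.nilFil 1 := by
  rw [mem_nilFil_succ, map_one, CDGA.d_one]; exact zero_mem _

/-- The union of the nilpotence filtration. -/
def nilSubalgebra : Subalgebra ℚ σ.Lam where
  carrier := {w | ∃ m, w ∈ σ.nilFil (m + 1)}
  mul_mem' := fun ⟨i, hi⟩ ⟨j, hj⟩ => ⟨i + j, σ.mul_mem_nilFil hi hj⟩
  add_mem' := fun ⟨i, hi⟩ ⟨j, hj⟩ => ⟨max i j,
    add_mem (σ.nilFil_mono (by omega) hi) (σ.nilFil_mono (by omega) hj)⟩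
  algebraMap_mem' := fun r => ⟨0, by
    rw [Algebra.algebraMap_eq_smul_one]; exact Submodule.smul_mem _ _ σ.one_mem_nilFil⟩

/-- The union of the subspaces `A · Lₘ`. -/
def nilTotal : Subalgebra ℚ σ.total where
  carrier := {e | ∃ m, e ∈ σ.baseSpan (σ.nilFil (m + 1))}
  mul_mem' := fun ⟨i, hi⟩ ⟨j, hj⟩ => ⟨i + j, σ.mul_mem_baseSpan (σ.sign_mem_nilFil _)
    (fun _ h₁ _ h₂ => σ.mul_mem_nilFil h₁ h₂) hi hj⟩
  add_mem' := fun ⟨i, hi⟩ ⟨j, hj⟩ => ⟨max i j,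
    add_mem (σ.baseSpan_mono (σ.nilFil_mono (by omega)) hi)
      (σ.baseSpan_mono (σ.nilFil_mono (by omega)) hj)⟩
  algebraMap_mem' := fun r => ⟨0, by
    have := σ.incl_mul_genHom_mem (algebraMap ℚ A r) σ.one_mem_nilFil
    simpa using this⟩

theorem exists_mem_nilFil (w : σ.Lam) : ∃ m, w ∈ σ.nilFil m := by
  have hincl : σ.incl.toAlgHom.range ≤ σ.nilTotal := by
    rintro _ ⟨a, rfl⟩
    refine ⟨0, ?_⟩
    have := σ.incl_mul_genHom_mem a σ.one_mem_nilFil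
    rwa [map_one, mul_one] at this
  have hd : ∀ v, σ.total.d (σ.gen v) ∈ σ.nilTotal →
      FreeGCA.ι σ.grV v ∈ σ.nilSubalgebra := by
    rintro v ⟨m, hm⟩
    exact ⟨m + 1, by rw [mem_nilFil_succ, genHom_ι]; exact hm⟩
  have hfil : ∀ n, ∀ v ∈ σ.fil n, FreeGCA.ι σ.grV v ∈ σ.nilSubalgebra := by
    intro n
    induction n with
    | zero => exact fun v hv => hd v (hincl (σ.d_fil_zero v hv))
    | succ n ih =>
      intro v hv
      refine hd v ((sup_le hincl ?_ : _ ≤ σ.nilTotal) (σ.d_fil_succ n v hv))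
      refine Algebra.adjoin_le ?_
      rintro _ ⟨v', hv', rfl⟩
      obtain ⟨m, hm⟩ := ih v' hv'
      refine ⟨m, ?_⟩
      rw [← genHom_ι]
      exact σ.genHom_mem_baseSpan hm
  have htop : w ∈ σ.nilSubalgebra := by
    have : Algebra.adjoin ℚ (Set.range (FreeGCA.ι σ.grV)) ≤ σ.nilSubalgebra := by
      refine Algebra.adjoin_le ?_
      rintro _ ⟨v, rfl⟩
      obtain ⟨n, hn⟩ := σ.fil_exhaust v
      exact hfil n v hn
    rw [FreeGCA.adjoin_range_ι] at this
    exact this trivial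
  obtain ⟨m, hm⟩ := htop
  exact ⟨_, hm⟩

end AlgFibration

/-! ### Base change of a fibration to the twisted word module -/

section NegOneSMul

variable {M : Type*} [AddCommMonoid M] [Module ℚ M]

/-- Negatives in tensor products are written as multiples by `-1`, so that only the structure of an
additive commutative monoid is needed. -/
theorem add_neg_one_smul (x : M) : x + (-1 : ℚ) • x = 0 := by
  nth_rewrite 1 [← one_smul ℚ x]
  rw [← add_smul]
  simp

theorem add_add_neg_one_smul_add (p q r x y : M) :
    p + x + (q + y) + (-1 : ℚ) • (p + q + r) + r = x + y := by
  calc p + x + (q + y) + (-1 : ℚ) • (p + q + r) + r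
      = x + y + ((p + q + r) + (-1 : ℚ) • (p + q + r)) := by abel
    _ = x + y := by rw [add_neg_one_smul, add_zero]

end NegOneSMul

namespace AlgFibration

variable {A B : CDGA.{u}} (σ : AlgFibration A) (f : CDGA.Hom A B) {J : Type u}

open WordModule

/-- The base change `S ⊗_A (A ⊗ ΛV)`, realized as `S ⊗ ΛV`, where `S` is a word module over `B`. -/
abbrev BaseChange (B : CDGA.{u}) (J : Type u) : Type u := WordModule B J ⊗[ℚ] σ.Lam

/-- The canonical `A`-balanced map `S × (A ⊗ ΛV) → S ⊗_A (A ⊗ ΛV)`. -/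
def balanced : WordModule B J →ₗ[ℚ] σ.total →ₗ[ℚ] σ.BaseChange B J :=
  (LinearMap.rTensorHom σ.Lam ∘ₗ act.compl₂ f.toAlgHom.toLinearMap).compl₂
    σ.equiv.symm.toLinearMap

theorem balanced_mul_genHom (s : WordModule B J) (a : A) (w : σ.Lam) :
    σ.balanced f s (σ.incl.toAlgHom a * σ.genHom w) = act s (f.toAlgHom a) ⊗ₜ w := by
  simp only [balanced, LinearMap.compl₂_apply, LinearMap.comp_apply, LinearEquiv.coe_coe,
    equiv_symm_incl_mul_genHom]
  rfl

theorem balanced_incl_mul (s : WordModule B J) (a : A) (e : σ.total) :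
    σ.balanced f s (σ.incl.toAlgHom a * e) = σ.balanced f (act s (f.toAlgHom a)) e := by
  induction e using σ.total_induction with
  | zero => simp
  | mul a' w =>
    rw [← mul_assoc, ← map_mul, balanced_mul_genHom, balanced_mul_genHom, act_act, map_mul]
  | add x y hx hy => rw [mul_add, map_add, hx, hy, map_add]

/-- The differential of the base change. -/
def baseChangeD (c : List J → B) : σ.BaseChange B J →ₗ[ℚ] σ.BaseChange B J :=
  (diff c).rTensor σ.Lam + TensorProduct.lift
    ((σ.balanced f).compl₁₂ sgn (σ.total.d ∘ₗ σ.genHom.toLinearMap))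

theorem baseChangeD_tmul (c : List J → B) (s : WordModule B J) (w : σ.Lam) :
    σ.baseChangeD f c (s ⊗ₜ w) =
      diff c s ⊗ₜ w + σ.balanced f (sgn s) (σ.total.d (σ.genHom w)) := rfl

theorem baseChangeD_balanced (c : List J → B) (s : WordModule B J) (e : σ.total) :
    σ.baseChangeD f c (σ.balanced f s e) =
      σ.balanced f (diff c s) e + σ.balanced f (sgn s) (σ.total.d e) := by
  induction e using σ.total_induction with
  | zero => simp
  | mul a w =>
    rw [balanced_mul_genHom, baseChangeD_tmul, diff_act, TensorProduct.add_tmul, CDGA.d_mul,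
      balanced_mul_genHom, map_add, ← σ.incl.map_d, balanced_mul_genHom, ← σ.incl.map_sgn,
      balanced_incl_mul, sgn_act, f.map_d, f.map_sgn, add_assoc]
  | add x y hx hy => simp only [map_add, hx, hy]; abel

theorem baseChangeD_baseChangeD {c : List J → B} (hc : IsTwisting c) (x : σ.BaseChange B J) :
    σ.baseChangeD f c (σ.baseChangeD f c x) = 0 := by
  induction x using TensorProduct.induction_on with
  | zero => simp
  | add x y hx hy => rw [map_add, map_add, hx, hy, add_zero]
  | tmul s w =>
    rw [baseChangeD_tmul, map_add, baseChangeD_tmul, baseChangeD_balanced, diff_diff hc,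
      diff_sgn hc, sgn_sgn, σ.total.d_d, ← neg_one_smul ℚ (sgn _), map_smul, LinearMap.smul_apply,
      TensorProduct.zero_tmul, map_zero, zero_add, add_zero, add_neg_one_smul]

section Projection

variable (hA : A.IsConnected) (hB : B.IsConnected)

include hA hB in
theorem aug_hom (a : A) : hB.aug (f.toAlgHom a) = hA.aug a := by
  apply smul_left_injective ℚ hB.one_ne_zero
  simp only
  rw [hB.aug_smul_one, ← f.map_proj, ← hA.aug_smul_one, map_smul, map_one]

/-- The augmentation of the word module: the constant term of the coefficient of the empty word. -/
def wordAug : WordModule B J →ₗ[ℚ] ℚ := hB.aug.toLinearMap ∘ₗ Finsupp.lapply []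

theorem wordAug_apply (x : WordModule B J) : wordAug hB x = hB.aug (x []) := rfl

theorem wordAug_sgn (x : WordModule B J) : wordAug hB (sgn x) = wordAug hB x := by
  simp only [wordAug_apply, sgn, Finsupp.mapRange.linearMap_apply, Finsupp.mapRange_apply,
    AlgHom.toLinearMap_apply, hB.aug_sgn]

/-- The map `S ⊗_A (A ⊗ ΛV) → ΛV` induced by the augmentation of `S`. -/
def baseChangeProj : σ.BaseChange B J →ₗ[ℚ] σ.Lam :=
  (TensorProduct.lid ℚ σ.Lam).toLinearMap ∘ₗ (wordAug hB).rTensor σ.Lam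

theorem baseChangeProj_tmul (s : WordModule B J) (w : σ.Lam) :
    σ.baseChangeProj hB (s ⊗ₜ w) = wordAug hB s • w := by
  simp [baseChangeProj]

theorem baseChangeProj_balanced (s : WordModule B J) (e : σ.total) :
    σ.baseChangeProj hB (σ.balanced f s e) = wordAug hB s • σ.fiberProj hA e := by
  induction e using σ.total_induction with
  | zero => simp
  | mul a w =>
    rw [balanced_mul_genHom, baseChangeProj_tmul, fiberProj_incl_mul_genHom, wordAug_apply,
      act_apply_nil, map_mul, aug_hom f hA hB, mul_smul, wordAug_apply]
  | add x y hx hy => rw [map_add, map_add, hx, hy, map_add, smul_add]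

theorem baseChangeProj_D {c : List J → B} (hc : IsTwisting c) (x : σ.BaseChange B J) :
    σ.baseChangeProj hB (σ.baseChangeD f c x) =
      σ.fiberProj hA (σ.total.d (σ.genHom (σ.baseChangeProj hB x))) := by
  induction x using TensorProduct.induction_on with
  | zero => simp
  | add x y hx hy => simp only [map_add, hx, hy]
  | tmul s w =>
    rw [baseChangeD_tmul, map_add, baseChangeProj_tmul, wordAug_apply, aug_diff hc hB, zero_smul,
      zero_add, baseChangeProj_balanced σ f hA, wordAug_sgn, baseChangeProj_tmul]
    simp only [map_smul]

/-- The subspaces `S ⊗ Lₘ` of the base change. -/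
def baseChangeFil (B : CDGA.{u}) (J : Type u) (m : ℕ) : Submodule ℚ (σ.BaseChange B J) :=
  Submodule.map₂ (TensorProduct.mk ℚ (WordModule B J) σ.Lam) ⊤ (σ.nilFil m)

theorem tmul_mem_baseChangeFil {m : ℕ} (s : WordModule B J) {w : σ.Lam} (hw : w ∈ σ.nilFil m) :
    s ⊗ₜ w ∈ σ.baseChangeFil B J m :=
  Submodule.apply_mem_map₂ (TensorProduct.mk ℚ (WordModule B J) σ.Lam) Submodule.mem_top hw

theorem balanced_mem_baseChangeFil {m : ℕ} (s : WordModule B J) {e : σ.total}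
    (he : e ∈ σ.baseSpan (σ.nilFil m)) : σ.balanced f s e ∈ σ.baseChangeFil B J m := by
  suffices h : σ.baseSpan (σ.nilFil m) ≤ (σ.baseChangeFil B J m).comap (σ.balanced f s) from h he
  refine Submodule.map₂_le.2 fun a _ w hw => ?_
  change σ.balanced f s (σ.incl.toAlgHom a * σ.genHom w) ∈ σ.baseChangeFil B J m
  rw [balanced_mul_genHom]
  exact σ.tmul_mem_baseChangeFil _ hw

theorem exists_mem_baseChangeFil (x : σ.BaseChange B J) : ∃ m, x ∈ σ.baseChangeFil B J m := by
  have hmono : Monotone (σ.baseChangeFil B J) := fun m n h =>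
    Submodule.map₂_le_map₂_right (σ.nilFil_mono h)
  induction x using TensorProduct.induction_on with
  | zero => exact ⟨0, zero_mem _⟩
  | tmul s w =>
    obtain ⟨m, hm⟩ := σ.exists_mem_nilFil w
    exact ⟨m, σ.tmul_mem_baseChangeFil s hm⟩
  | add x y hx hy =>
    obtain ⟨m, hm⟩ := hx
    obtain ⟨n, hn⟩ := hy
    exact ⟨max m n, add_mem (hmono (le_max_left _ _) hm) (hmono (le_max_right _ _) hn)⟩

include hA in
/-- If the augmented word module is exact, the base change has the cohomology of the fiber: cocycles
which vanish in the fiber are coboundaries.  A contraction of the word module, extended to the base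
change, is a contraction up to an operator that lowers the nilpotence filtration. -/
theorem exists_baseChangeD_eq {c : List J → B} (hc : IsTwisting c)
    (hex : ∀ x, diff c x = 0 → hB.aug (x []) = 0 → ∃ y, diff c y = x)
    {x : σ.BaseChange B J} (hx : σ.baseChangeD f c x = 0) (hπ : σ.baseChangeProj hB x = 0) :
    ∃ y, σ.baseChangeD f c y = x := by
  obtain ⟨h, hh, hcontr⟩ := exists_contraction (diff c) (wordAug hB) (Finsupp.single [] 1)
    (diff_diff hc) (aug_diff hc hB) (by simp [wordAug_apply]) (by simp) hex
  let H : σ.BaseChange B J →ₗ[ℚ] σ.BaseChange B J := h.rTensor σ.Lam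
  have hH : ∀ s w, H (s ⊗ₜ w) = h s ⊗ₜ w := fun s w => rfl
  have hHfil : ∀ m, ∀ x ∈ σ.baseChangeFil B J m, H x ∈ σ.baseChangeFil B J m := by
    intro m x hx
    suffices h' : σ.baseChangeFil B J m ≤ (σ.baseChangeFil B J m).comap H from h' hx
    refine Submodule.map₂_le.2 fun s _ w hw => ?_
    exact σ.tmul_mem_baseChangeFil (h s) hw
  have hπH : ∀ x, σ.baseChangeProj hB (H x) = 0 := by
    intro x
    induction x using TensorProduct.induction_on with
    | zero => simp
    | tmul s w => rw [hH, baseChangeProj_tmul, hh, zero_smul]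
    | add x y hx hy => rw [map_add, map_add, hx, hy, add_zero]
  let N : σ.BaseChange B J →ₗ[ℚ] σ.BaseChange B J :=
    σ.baseChangeD f c ∘ₗ H + H ∘ₗ σ.baseChangeD f c + (-1 : ℚ) • LinearMap.id +
      TensorProduct.mk ℚ _ _ (Finsupp.single [] 1) ∘ₗ σ.baseChangeProj hB
  have hN : ∀ m, ∀ x ∈ σ.baseChangeFil B J (m + 1), N x ∈ σ.baseChangeFil B J m := by
    intro m x hx
    suffices h' : σ.baseChangeFil B J (m + 1) ≤ (σ.baseChangeFil B J m).comap N from h' hx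
    refine Submodule.map₂_le.2 fun s _ w hw => ?_
    have hcomm : N (s ⊗ₜ w) = σ.balanced f (sgn (h s)) (σ.total.d (σ.genHom w)) +
        H (σ.balanced f (sgn s) (σ.total.d (σ.genHom w))) := by
      change σ.baseChangeD f c (H (s ⊗ₜ w)) + H (σ.baseChangeD f c (s ⊗ₜ w)) +
        (-1 : ℚ) • s ⊗ₜ[ℚ] w +
        (Finsupp.single [] 1 : WordModule B J) ⊗ₜ[ℚ] σ.baseChangeProj hB (s ⊗ₜ w) = _
      have h1 : s ⊗ₜ[ℚ] w = diff c (h s) ⊗ₜ[ℚ] w + h (diff c s) ⊗ₜ[ℚ] w +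
          (Finsupp.single [] 1 : WordModule B J) ⊗ₜ[ℚ] (wordAug hB s • w) := by
        rw [← TensorProduct.smul_tmul, ← TensorProduct.add_tmul, ← TensorProduct.add_tmul, hcontr,
          sub_add_cancel]
      rw [hH, baseChangeD_tmul, baseChangeD_tmul, map_add, hH, baseChangeProj_tmul]
      rw [h1]
      exact add_add_neg_one_smul_add _ _ _ _ _
    change N (s ⊗ₜ w) ∈ σ.baseChangeFil B J m
    rw [hcomm]
    exact add_mem (σ.balanced_mem_baseChangeFil f _ hw)
      (hHfil _ _ (σ.balanced_mem_baseChangeFil f _ hw))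
  have key : ∀ m, ∀ x ∈ σ.baseChangeFil B J m, σ.baseChangeD f c x = 0 →
      σ.baseChangeProj hB x = 0 → ∃ y, σ.baseChangeD f c y = x := by
    intro m
    induction m with
    | zero =>
      intro x hx _ _
      have h0 : σ.baseChangeFil B J 0 = ⊥ := by simp [baseChangeFil, nilFil]
      rw [h0, Submodule.mem_bot] at hx
      exact ⟨0, by rw [hx, map_zero]⟩
    | succ m ih =>
      intro x hx hdx hπ
      have hNx : N x = σ.baseChangeD f c (H x) + (-1 : ℚ) • x := by
        change σ.baseChangeD f c (H x) + H (σ.baseChangeD f c x) + (-1 : ℚ) • x +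
          (Finsupp.single [] 1 : WordModule B J) ⊗ₜ[ℚ] σ.baseChangeProj hB x = _
        rw [hdx, hπ, map_zero, TensorProduct.tmul_zero, add_zero, add_zero]
      obtain ⟨y, hy⟩ := ih (N x) (hN m x hx)
        (by rw [hNx, map_add, map_smul, baseChangeD_baseChangeD σ f hc, hdx, smul_zero, add_zero])
        (by rw [hNx, map_add, map_smul, baseChangeProj_D σ f hA hB hc, hπH, hπ]; simp)
      refine ⟨H x + (-1 : ℚ) • y, ?_⟩
      rw [map_add, map_smul, hy, hNx, smul_add, ← add_assoc, add_neg_one_smul, zero_add, smul_smul]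
      norm_num
  obtain ⟨m, hm⟩ := σ.exists_mem_baseChangeFil x
  exact key m x hm hx hπ

end Projection

/-- Stripping a first letter, on the base change. -/
def baseChangeStrip (j : J) : σ.BaseChange B J →ₗ[ℚ] σ.BaseChange B J := (strip j).rTensor σ.Lam

theorem baseChangeStrip_balanced (j : J) (s : WordModule B J) (e : σ.total) :
    σ.baseChangeStrip j (σ.balanced f s e) = σ.balanced f (strip j s) e := by
  induction e using σ.total_induction with
  | zero => simp
  | mul a w => rw [balanced_mul_genHom, balanced_mul_genHom, ← strip_act]; rfl
  | add x y hx hy => rw [map_add, map_add, hx, hy, map_add]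

theorem baseChangeStrip_D (c : List J → B) (j : J) (x : σ.BaseChange B J) :
    σ.baseChangeStrip j (σ.baseChangeD f c x) = σ.baseChangeD f c (σ.baseChangeStrip j x) := by
  induction x using TensorProduct.induction_on with
  | zero => simp
  | add x y hx hy => simp only [map_add, hx, hy]
  | tmul s w =>
    have h : ∀ s : WordModule B J, σ.baseChangeStrip j (s ⊗ₜ w) = strip j s ⊗ₜ w := fun _ => rfl
    rw [baseChangeD_tmul, map_add, h, h, baseChangeD_tmul, baseChangeStrip_balanced, strip_diff,
      strip_sgn]

end AlgFibration

/-! ### Fibers of finite cohomological dimension -/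

/-- A non-exact odd cocycle belongs to a family of odd cocycles representing a basis of the odd
cohomology. -/
theorem CDGA.exists_odd_cohomology_basis {B : CDGA.{u}} {a : B} (ha : B.sgn a = -a)
    (hda : B.d a = 0) (hex : ¬ ∃ b, B.d b = a) :
    ∃ (J : Type u) (z : J → B) (j₀ : J), z j₀ = a ∧ (∀ j, B.sgn (z j) = -z j) ∧
      (∀ j, B.d (z j) = 0) ∧
      (∀ x, B.sgn x = -x → B.d x = 0 →
        ∃ (l : J →₀ ℚ) (y : B), x = (l.sum fun j r => r • z j) + B.d y) ∧
      ∀ (l : J →₀ ℚ) (y : B), (l.sum fun j r => r • z j) = B.d y → l = 0 := by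
  classical
  let Z : Submodule ℚ B := LinearMap.ker (B.sgn.toLinearMap + LinearMap.id) ⊓ LinearMap.ker B.d
  have hZ : ∀ x, x ∈ Z ↔ B.sgn x = -x ∧ B.d x = 0 := by
    intro x
    change B.sgn x + x = 0 ∧ _ ↔ _
    rw [add_eq_zero_iff_eq_neg]; rfl
  let R : Submodule ℚ Z := (LinearMap.range B.d).submoduleOf Z
  have hR : ∀ x : Z, R.mkQ x = 0 ↔ ∃ y, B.d y = x := by
    intro x
    rw [Submodule.mkQ_apply, Submodule.Quotient.mk_eq_zero]; rfl
  let a' : Z := ⟨a, (hZ a).2 ⟨ha, hda⟩⟩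
  have ha' : R.mkQ a' ≠ 0 := fun h => hex ((hR a').1 h)
  have hs : LinearIndepOn ℚ id ({R.mkQ a'} : Set (Z ⧸ R)) := LinearIndepOn.singleton ha'
  let b := Module.Basis.extend hs
  have hmem : R.mkQ a' ∈ hs.extend (Set.subset_univ _) := hs.subset_extend _ rfl
  let t : hs.extend (Set.subset_univ _) → Z := fun j =>
    if (j : Z ⧸ R) = R.mkQ a' then a' else (R.mkQ_surjective j).choose
  have ht : ∀ j, R.mkQ (t j) = b j := by
    intro j
    rw [Module.Basis.extend_apply_self]
    by_cases h : (j : Z ⧸ R) = R.mkQ a'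
    · simp only [t, if_pos h, h]
    · simp only [t, if_neg h]; exact (R.mkQ_surjective j).choose_spec
  have hsum : ∀ l, R.mkQ (l.sum fun j r => r • t j) = b.repr.symm l := by
    intro l
    rw [Finsupp.sum, map_sum, Module.Basis.repr_symm_apply, Finsupp.linearCombination_apply,
      Finsupp.sum]
    exact Finset.sum_congr rfl fun j _ => by rw [map_smul, ht]
  have hcoe : ∀ l : hs.extend (Set.subset_univ _) →₀ ℚ,
      ((l.sum fun j r => r • t j : Z) : B) = l.sum fun j r => r • (t j : B) := by
    intro l
    simp [Finsupp.sum]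
  refine ⟨_, fun j => (t j : B), ⟨_, hmem⟩, by simp [t, a'], fun j => ((hZ _).1 (t j).2).1,
    fun j => ((hZ _).1 (t j).2).2, ?_, ?_⟩
  · intro x hx hdx
    let x' : Z := ⟨x, (hZ x).2 ⟨hx, hdx⟩⟩
    obtain ⟨y, hy⟩ := (hR (x' - (b.repr (R.mkQ x')).sum fun j r => r • t j)).1 (by
      rw [map_sub, hsum, LinearEquiv.symm_apply_apply, sub_self])
    refine ⟨b.repr (R.mkQ x'), y, ?_⟩
    rw [hy, ← hcoe, Submodule.coe_sub, add_sub_cancel]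
  · intro l y hy
    rw [← hcoe] at hy
    have := (hR _).2 ⟨y, hy.symm⟩
    rwa [hsum, LinearEquiv.map_eq_zero_iff] at this

theorem CDGA.d_pow_succ {E : CDGA.{u}} {y a : E} (hy : E.sgn y = y) (hd : E.d y = a)
    (hc : Commute y a) (n : ℕ) : E.d (y ^ (n + 1)) = (n + 1 : ℚ) • (a * y ^ n) := by
  induction n with
  | zero => simp [hd]
  | succ n ih =>
    rw [pow_succ, CDGA.d_mul, ih, map_pow, hy, hd, smul_mul_assoc, mul_assoc, ← pow_succ,
      (hc.pow_left _).eq]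
    push_cast
    rw [add_smul (n + 1 : ℚ) 1, one_smul]

namespace AlgFibration

variable {A B : CDGA.{u}} (σ : AlgFibration A) (f : CDGA.Hom A B) {J : Type u}

open WordModule Nat

/-- The word consisting of `i` copies of the letter `j`. -/
abbrev powerWord (B : CDGA.{u}) (j : J) (i : ℕ) : WordModule B J :=
  Finsupp.single (List.replicate i j) 1

/-- The divided power `(y - j)^N / N!` of the difference of two primitives of the same element:
`y` in the total space, and the letter `j` in the word module. -/
def dividedPower (j : J) (y : σ.total) (N : ℕ) : σ.BaseChange B J :=
  ∑ p ∈ Finset.HasAntidiagonal.antidiagonal N,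
    ((-1 : ℚ) ^ p.1 * (p.2 ! : ℚ)⁻¹) • σ.balanced f (powerWord B j p.1) (y ^ p.2)

theorem baseChangeD_dividedPower {c : List J → B} {j : J}
    (hj : ∀ n, c (List.replicate (n + 2) j) = 0) {a : A} (ha : f.toAlgHom a = c [j])
    {y : σ.total} (hy : σ.total.sgn y = y) (hd : σ.total.d y = σ.incl.toAlgHom a)
    (hcomm : Commute y (σ.incl.toAlgHom a)) (N : ℕ) :
    σ.baseChangeD f c (σ.dividedPower f j y N) = 0 := by
  have h0 : diff c (powerWord B j 0) = 0 := by simp [powerWord]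
  have h1 : ∀ i, diff c (powerWord B j (i + 1)) = act (powerWord B j i) (f.toAlgHom a) := by
    intro i
    rw [powerWord, diff_replicate j hj, CDGA.d_one, Finsupp.single_zero, add_zero, ha,
      powerWord, act_single, one_mul, mul_one]
  have hs : ∀ i, sgn (powerWord B j i) = powerWord B j i := by
    intro i; rw [powerWord, sgn_single, map_one]
  have hterm : ∀ p : ℕ × ℕ, σ.baseChangeD f c (σ.balanced f (powerWord B j p.1) (y ^ p.2)) =
      σ.balanced f (diff c (powerWord B j p.1)) (y ^ p.2) +
        σ.balanced f (powerWord B j p.1) (σ.total.d (y ^ p.2)) := by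
    intro p; rw [baseChangeD_balanced, hs]
  rw [dividedPower, map_sum]
  simp only [map_smul, hterm, smul_add, Finset.sum_add_distrib]
  rcases N with _ | N
  · simp [h0]
  · rw [Finset.Nat.sum_antidiagonal_succ, Finset.Nat.sum_antidiagonal_succ']
    simp only [h0, h1, pow_zero, CDGA.d_one, map_zero, LinearMap.zero_apply, smul_zero, zero_add,
      CDGA.d_pow_succ hy hd hcomm, ← balanced_incl_mul, map_smul]
    rw [← Finset.sum_add_distrib]
    refine Finset.sum_eq_zero fun p _ => ?_
    rw [smul_smul, ← add_smul]
    convert zero_smul ℚ _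
    rw [Nat.factorial_succ]
    have h1 : (p.2 ! : ℚ) ≠ 0 := by positivity
    have h2 : (p.2 + 1 : ℚ) ≠ 0 := by positivity
    push_cast
    field_simp
    ring

theorem baseChangeStrip_dividedPower (j : J) (y : σ.total) (N : ℕ) :
    σ.baseChangeStrip j (σ.dividedPower f j y (N + 1)) = (-1 : ℚ) • σ.dividedPower f j y N := by
  rw [dividedPower, map_sum, Finset.Nat.sum_antidiagonal_succ, dividedPower, Finset.smul_sum]
  have h0 : strip j (powerWord B j 0) = 0 := by simp [powerWord]
  have h1 : ∀ i, strip j (powerWord B j (i + 1)) = powerWord B j i := by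
    intro i; rw [powerWord, List.replicate_succ, strip_single_cons]
  simp only [map_smul, baseChangeStrip_balanced, h0, h1, map_zero, LinearMap.zero_apply, smul_zero,
    zero_add, smul_smul]
  refine Finset.sum_congr rfl fun p _ => ?_
  rw [pow_succ]
  congr 1
  ring

/-- If the fiber of a fibration has finite cohomological dimension, a class of odd degree at least
three which dies in the total space dies in every connected algebra without even cohomology.
Otherwise the divided powers of the difference of two primitives would be infinitely many nontrivial
cohomology classes of the fiber: the operation of stripping a letter lowers them to `1`. -/
theorem exists_primitive_of_fiber (hA : A.IsConnected) (hB : B.IsConnected)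
    (hev : ∀ i : ℕ, 0 < i → B.Hdeg (2 * i) = ⊥) (hσ : σ.FiberHasFiniteCohomDim)
    {k : ℕ} (hk : 0 < k) {a : A} (ha : a ∈ A.gr (2 * k + 1)) (hda : A.d a = 0)
    {y : σ.total} (hy : y ∈ σ.total.gr (2 * k)) (hdy : σ.total.d y = σ.incl.toAlgHom a) :
    ∃ b, B.d b = f.toAlgHom a := by
  by_contra hex
  have hfa := f.map_gr ha
  have hodd : Odd (2 * k + 1) := odd_two_mul_add_one k
  obtain ⟨J, z, j, hj, hzodd, hzd, hspan, hindep⟩ := CDGA.exists_odd_cohomology_basis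
    (CDGA.sgn_of_odd hodd hfa) (by rw [← f.map_d, hda, map_zero]) hex
  have hsq : z j * z j = 0 := by
    have h := B.graded_comm hfa hfa
    rw [(hodd.mul hodd).neg_one_pow, neg_one_smul] at h
    have h2 : (2 : ℚ) • (f.toAlgHom a * f.toAlgHom a) = 0 := by
      rw [two_smul]; exact eq_neg_iff_add_eq_zero.1 h
    rw [hj]
    exact (smul_eq_zero.1 h2).resolve_left two_ne_zero
  obtain ⟨c, hc, hone, hrep⟩ := exists_isTwisting hB hev z hzodd hzd
  have hacyclic : ∀ x, diff c x = 0 → hB.aug (x []) = 0 → ∃ y, diff c y = x := fun x hx hx' =>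
    exists_primitive hc hB hev (by simpa only [hone] using hspan)
      (by simpa only [hone] using hindep) hx hx'
  have hsy : σ.total.sgn y = y := CDGA.sgn_of_even (even_two_mul k) hy
  have hcomm : Commute y (σ.incl.toAlgHom a) := by
    have := CDGA.mul_comm_of_mem (σ.incl.map_gr ha) y
    rwa [Function.iterate_fixed hsy] at this
  have hD : ∀ N, σ.baseChangeD f c (σ.dividedPower f j y N) = 0 :=
    σ.baseChangeD_dividedPower f (hrep j hsq) (by rw [hone, hj]) hsy hdy hcomm
  -- high divided powers are exact
  have hhigh : ∃ N x, σ.baseChangeD f c x = σ.dividedPower f j y N := by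
    obtain ⟨N₀, hN₀⟩ := hσ
    have hdeg : N₀ < (N₀ + 1) * (2 * k) :=
      Nat.lt_of_succ_le (Nat.le_mul_of_pos_right _ (by omega))
    have hmem : y ^ (N₀ + 1) ∈ σ.total.gr ((N₀ + 1) * (2 * k)) := by
      have := SetLike.pow_mem_graded (A := σ.total.gr) (N₀ + 1) hy
      rwa [smul_eq_mul] at this
    obtain ⟨w, hw⟩ := exists_sub_d_mem_fiberIdeal (hN₀ _ hdeg) hmem (by
      rw [CDGA.d_pow_succ hsy hdy hcomm]
      exact Submodule.smul_mem _ _ (σ.incl_mul_mem_fiberIdeal (by omega) ha _))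
    rw [σ.mem_fiberIdeal_iff hA, map_sub, sub_eq_zero] at hw
    have hπ : σ.baseChangeProj hB (σ.dividedPower f j y (N₀ + 1)) =
        ((N₀ + 1) ! : ℚ)⁻¹ • σ.fiberProj hA (y ^ (N₀ + 1)) := by
      have h0 : wordAug hB (powerWord B j 0) = 1 := by simp [wordAug_apply, powerWord]
      have h1 : ∀ i, wordAug hB (powerWord B j (i + 1)) = 0 := by
        intro i; simp [wordAug_apply, powerWord, List.replicate_succ]
      rw [dividedPower, map_sum, Finset.Nat.sum_antidiagonal_succ]
      simp [baseChangeProj_balanced σ f hA, h0, h1]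
    set e₀ : WordModule B J := Finsupp.single [] 1 with he₀
    have hbd : σ.baseChangeD f c (σ.balanced f e₀ w) = σ.balanced f e₀ (σ.total.d w) := by
      rw [baseChangeD_balanced, he₀, diff_single_nil, CDGA.d_one, Finsupp.single_zero, map_zero,
        LinearMap.zero_apply, zero_add, sgn_single, map_one]
    set q : ℚ := ((N₀ + 1) ! : ℚ)⁻¹ with hq
    obtain ⟨x, hx⟩ := σ.exists_baseChangeD_eq f hA hB hc hacyclic
      (x := σ.dividedPower f j y (N₀ + 1) +
        (-1 : ℚ) • σ.baseChangeD f c (q • σ.balanced f e₀ w))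
      (by rw [map_add, hD, map_smul, baseChangeD_baseChangeD σ f hc, smul_zero, add_zero])
      (by
        rw [map_add, hπ, map_smul, map_smul, hbd, map_smul, baseChangeProj_balanced σ f hA, ← hw]
        have : wordAug hB e₀ = 1 := by simp [wordAug_apply, he₀]
        rw [this, one_smul, add_neg_one_smul])
    refine ⟨N₀ + 1, x + q • σ.balanced f e₀ w, ?_⟩
    rw [map_add, hx, add_assoc, add_comm ((-1 : ℚ) • _), add_neg_one_smul, add_zero]
  -- hence so is the zeroth one
  have hlow : ∀ N, (∃ x, σ.baseChangeD f c x = σ.dividedPower f j y N) →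
      ∃ x, σ.baseChangeD f c x = σ.dividedPower f j y 0 := by
    intro N
    induction N with
    | zero => exact id
    | succ N ih =>
      rintro ⟨x, hx⟩
      refine ih ⟨(-1 : ℚ) • σ.baseChangeStrip j x, ?_⟩
      rw [map_smul, ← baseChangeStrip_D, hx, baseChangeStrip_dividedPower, smul_smul]
      norm_num
  obtain ⟨N, hN⟩ := hhigh
  obtain ⟨x, hx⟩ := hlow N hN
  have h1 : σ.fiberProj hA (σ.total.d (σ.genHom (σ.baseChangeProj hB x))) =
      σ.fiberProj hA 1 := by
    rw [← σ.baseChangeProj_D f hA hB hc, hx]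
    simp [dividedPower, baseChangeProj_balanced σ f hA, wordAug_apply, powerWord]
  rw [← sub_eq_zero, ← map_sub, ← mem_fiberIdeal_iff] at h1
  have h2 := σ.proj_zero_of_mem_fiberIdeal h1
  rw [map_sub, CDGA.proj_zero_d, proj_of_mem_same _ SetLike.GradedOne.one_mem, zero_sub,
    neg_eq_zero] at h2
  exact (total_isConnected (σ := σ) hA).one_ne_zero h2

/-- A class which is annihilated by a fibration whose fiber has finite cohomological dimension
vanishes in every connected algebra without even cohomology. -/
theorem mapH_eq_zero_of_mem_ann (hA : A.IsConnected) (hB : B.IsConnected)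
    (hev : ∀ i : ℕ, 0 < i → B.Hdeg (2 * i) = ⊥) {a : A.H} (ha : a ∈ A.ann) : f.mapH a = 0 := by
  obtain ⟨σ, hσ, hσa⟩ := ha
  obtain ⟨⟨a, hda⟩, rfl⟩ := Submodule.Quotient.mk_surjective _ a
  rw [CDGA.mapH_mk_eq_zero] at hσa ⊢
  obtain ⟨y, hy⟩ := hσa
  have hda' : A.d a = 0 := hda
  have hE := total_isConnected (σ := σ) hA
  change f.toAlgHom a ∈ LinearMap.range B.d
  refine mem_of_proj_mem B.gr _ fun n => ?_
  rw [← f.map_proj]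
  have hcoc : A.d (GradedAlgebra.proj A.gr n a) = 0 := by rw [CDGA.d_proj, hda', map_zero]
  rcases n with _ | n
  · -- a constant which is exact in the total space vanishes
    have h1 : hE.aug (σ.incl.toAlgHom a) = 0 := by rw [← hy, hE.aug_d]
    rw [aug_hom σ.incl hA hE] at h1
    rw [(hA.aug_eq_zero_iff a).1 h1, map_zero]
    exact zero_mem _
  · have hyn : σ.total.d (GradedAlgebra.proj σ.total.gr n y) =
        σ.incl.toAlgHom (GradedAlgebra.proj A.gr (n + 1) a) := by
      rw [CDGA.d_proj, hy, σ.incl.map_proj]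
    rcases Nat.even_or_odd' n with ⟨k, rfl | rfl⟩
    · rcases Nat.eq_zero_or_pos k with rfl | hk
      · -- in degree zero the total space consists of cocycles
        rw [Nat.mul_zero, ← hE.aug_smul_one, map_smul, CDGA.d_one, smul_zero] at hyn
        have hinj : ∀ x : A, σ.incl.toAlgHom x = 0 → x = 0 := by
          intro x hx
          have h2 : (x ⊗ₜ[ℚ] (1 : σ.Lam)) = 0 := by
            rw [← σ.equiv_symm_incl_mul_genHom, hx, zero_mul, map_zero]
          have h3 := congrArg (TensorProduct.rid ℚ A ∘ σ.augLam.toLinearMap.lTensor A) h2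
          simpa using h3
        rw [Nat.mul_zero, hinj _ hyn.symm, map_zero]
        exact zero_mem _
      · exact σ.exists_primitive_of_fiber f hA hB hev hσ hk (proj_mem _ _ _) hcoc (proj_mem _ _ _)
          hyn
    · exact (CDGA.hdeg_eq_bot_iff _).1 (hev (k + 1) (by omega)) _
        (f.map_gr (proj_mem A.gr (2 * k + 1 + 1) a))
        (by rw [← f.map_d, hcoc, map_zero])

end AlgFibration

/-! ### The graded commutative algebra `A ⊗ ΛV` -/

theorem neg_one_units_smul {M : Type*} [AddCommGroup M] [Module ℚ M] (n : ℕ) (x : M) :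
    (-1 : ℤˣ) ^ n • x = (-1 : ℚ) ^ n • x := by
  rcases Nat.even_or_odd n with h | h
  · rw [h.neg_one_pow, h.neg_one_pow, one_smul, one_smul]
  · rw [h.neg_one_pow, h.neg_one_pow, Units.neg_smul, one_smul, neg_one_smul]

section FreeExt

variable (A : CDGA.{u}) {V : Type u} [AddCommGroup V] [Module ℚ V] (𝒱 : ℕ → Submodule ℚ V)
  [DirectSum.Decomposition 𝒱]

/-- The graded commutative algebra `A ⊗ ΛV`, with the product that obeys the Koszul sign rule. -/
abbrev FreeExt : Type u := GradedTensorProduct ℚ A.gr (FreeGCA.gr 𝒱)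

namespace FreeExt

/-- The pure tensor `a ⊗ w`. -/
abbrev tmul (a : A) (w : FreeGCA 𝒱) : FreeExt A 𝒱 := GradedTensorProduct.tmul ℚ a w

/-- The inclusion `a ↦ a ⊗ 1`. -/
def incl : A →ₐ[ℚ] FreeExt A 𝒱 := GradedTensorProduct.includeLeft A.gr (FreeGCA.gr 𝒱)

/-- The inclusion `w ↦ 1 ⊗ w`. -/
def inr : FreeGCA 𝒱 →ₐ[ℚ] FreeExt A 𝒱 := GradedTensorProduct.includeRight A.gr (FreeGCA.gr 𝒱)

/-- The inclusion `v ↦ 1 ⊗ v` of the generators. -/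
def gen : V →ₗ[ℚ] FreeExt A 𝒱 := (inr A 𝒱).toLinearMap ∘ₗ FreeGCA.ι 𝒱

theorem inr_ι (v : V) : inr A 𝒱 (FreeGCA.ι 𝒱 v) = gen A 𝒱 v := rfl

variable {A 𝒱}

theorem incl_mul_inr (a : A) (w : FreeGCA 𝒱) : incl A 𝒱 a * inr A 𝒱 w = tmul A 𝒱 a w :=
  GradedTensorProduct.tmul_one_mul_one_tmul _ _ a w

theorem tmul_mul_tmul {i j : ℕ} (a : A) {w : FreeGCA 𝒱} (hw : w ∈ FreeGCA.gr 𝒱 j) {a' : A}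
    (ha' : a' ∈ A.gr i) (w' : FreeGCA 𝒱) :
    tmul A 𝒱 a w * tmul A 𝒱 a' w' = (-1 : ℚ) ^ (j * i) • tmul A 𝒱 (a * a') (w * w') := by
  rw [← neg_one_units_smul]
  exact GradedTensorProduct.tmul_coe_mul_coe_tmul A.gr (FreeGCA.gr 𝒱) a ⟨w, hw⟩ ⟨a', ha'⟩ w'

@[elab_as_elim]
theorem tmul_induction {P : FreeExt A 𝒱 → Prop} (x : FreeExt A 𝒱) (zero : P 0)
    (tmul : ∀ a w, P (tmul A 𝒱 a w)) (add : ∀ x y, P x → P y → P (x + y)) : P x :=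
  TensorProduct.induction_on (motive := fun t => P (GradedTensorProduct.of ℚ A.gr _ t))
    ((GradedTensorProduct.of ℚ A.gr (FreeGCA.gr 𝒱)).symm x) (by rw [map_zero]; exact zero) tmul
    (fun x y hx hy => by rw [map_add]; exact add _ _ hx hy)

/-- Induction on elements of `A ⊗ ΛV` as sums of products of elements of `A` and `V`. -/
@[elab_as_elim]
theorem induction {P : FreeExt A 𝒱 → Prop} (x : FreeExt A 𝒱) (incl : ∀ a, P (incl A 𝒱 a))
    (gen : ∀ v, P (gen A 𝒱 v)) (mul : ∀ x y, P x → P y → P (x * y))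
    (add : ∀ x y, P x → P y → P (x + y)) : P x := by
  have hinr : ∀ w, P (inr A 𝒱 w) := by
    intro w
    induction w using FreeGCA.induction with
    | algebraMap r => rw [AlgHom.commutes, ← AlgHom.commutes (FreeExt.incl A 𝒱)]; exact incl _
    | ι v => exact gen v
    | mul x y hx hy => rw [map_mul]; exact mul _ _ hx hy
    | add x y hx hy => rw [map_add]; exact add _ _ hx hy
  induction x using tmul_induction with
  | zero => rw [← map_zero (FreeExt.incl A 𝒱)]; exact incl 0
  | tmul a w => rw [← incl_mul_inr]; exact mul _ _ (incl a) (hinr w)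
  | add x y hx hy => exact add _ _ hx hy

variable (A 𝒱)

/-- The degree `n` part of `A ⊗ ΛV`. -/
def gr (n : ℕ) : Submodule ℚ (FreeExt A 𝒱) :=
  Submodule.span ℚ {x | ∃ i j : ℕ, i + j = n ∧ ∃ a ∈ A.gr i, ∃ w ∈ FreeGCA.gr 𝒱 j,
    tmul A 𝒱 a w = x}

variable {A 𝒱}

theorem tmul_mem {i j n : ℕ} (h : i + j = n) {a : A} (ha : a ∈ A.gr i) {w : FreeGCA 𝒱}
    (hw : w ∈ FreeGCA.gr 𝒱 j) : tmul A 𝒱 a w ∈ gr A 𝒱 n :=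
  Submodule.subset_span ⟨i, j, h, a, ha, w, hw, rfl⟩

theorem incl_mem {n : ℕ} {a : A} (ha : a ∈ A.gr n) : incl A 𝒱 a ∈ gr A 𝒱 n :=
  tmul_mem (add_zero n) ha SetLike.GradedOne.one_mem

theorem inr_mem {n : ℕ} {w : FreeGCA 𝒱} (hw : w ∈ FreeGCA.gr 𝒱 n) : inr A 𝒱 w ∈ gr A 𝒱 n :=
  tmul_mem (zero_add n) SetLike.GradedOne.one_mem hw

theorem gen_mem {n : ℕ} {v : V} (hv : v ∈ 𝒱 n) : gen A 𝒱 v ∈ gr A 𝒱 n :=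
  inr_mem (FreeGCA.ι_mem 𝒱 hv)

instance : SetLike.GradedMonoid (gr A 𝒱) where
  one_mem := by rw [← map_one (incl A 𝒱)]; exact incl_mem SetLike.GradedOne.one_mem
  mul_mem := by
    intro m n x y hx hy
    induction hx, hy using Submodule.span_induction₂ with
    | mem_mem x y hx hy =>
      obtain ⟨i, j, rfl, a, ha, w, hw, rfl⟩ := hx
      obtain ⟨i', j', rfl, a', ha', w', hw', rfl⟩ := hy
      rw [tmul_mul_tmul a hw ha' w']
      exact Submodule.smul_mem _ _ (tmul_mem (by omega) (SetLike.GradedMul.mul_mem ha ha')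
        (SetLike.GradedMul.mul_mem hw hw'))
    | zero_left y hy => rw [zero_mul]; exact zero_mem _
    | zero_right x hx => rw [mul_zero]; exact zero_mem _
    | add_left x y z _ _ _ hx hy => rw [add_mul]; exact add_mem hx hy
    | add_right x y z _ _ _ hx hy => rw [mul_add]; exact add_mem hx hy
    | smul_left r x y _ _ h => rw [smul_mul_assoc]; exact Submodule.smul_mem _ _ h
    | smul_right r x y _ _ h => rw [mul_smul_comm]; exact Submodule.smul_mem _ _ h

variable (A 𝒱) in
/-- The projection to the degree `n` part. -/
def projLinear (n : ℕ) : FreeExt A 𝒱 →ₗ[ℚ] FreeExt A 𝒱 :=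
  ∑ p ∈ Finset.HasAntidiagonal.antidiagonal n,
    (GradedTensorProduct.of ℚ A.gr (FreeGCA.gr 𝒱)).toLinearMap ∘ₗ
      TensorProduct.map (GradedAlgebra.proj A.gr p.1) (GradedAlgebra.proj (FreeGCA.gr 𝒱) p.2) ∘ₗ
        (GradedTensorProduct.of ℚ A.gr (FreeGCA.gr 𝒱)).symm.toLinearMap

theorem projLinear_tmul (n : ℕ) (a : A) (w : FreeGCA 𝒱) :
    projLinear A 𝒱 n (tmul A 𝒱 a w) = ∑ p ∈ Finset.HasAntidiagonal.antidiagonal n,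
      tmul A 𝒱 (GradedAlgebra.proj A.gr p.1 a) (GradedAlgebra.proj (FreeGCA.gr 𝒱) p.2 w) := by
  rw [projLinear, LinearMap.sum_apply]
  rfl

theorem projLinear_of_mem_same {n : ℕ} {x : FreeExt A 𝒱} (hx : x ∈ gr A 𝒱 n) :
    projLinear A 𝒱 n x = x := by
  suffices h : gr A 𝒱 n ≤ LinearMap.eqLocus (projLinear A 𝒱 n) LinearMap.id from h hx
  refine Submodule.span_le.2 ?_
  rintro _ ⟨i, j, rfl, a, ha, w, hw, rfl⟩
  change projLinear A 𝒱 _ _ = _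
  rw [projLinear_tmul, Finset.sum_eq_single (i, j)]
  · rw [proj_of_mem_same _ ha, proj_of_mem_same _ hw]; rfl
  · rintro ⟨i', j'⟩ hp hne
    rw [Finset.HasAntidiagonal.mem_antidiagonal] at hp
    have : i ≠ i' := by
      rintro rfl
      exact hne (Prod.ext rfl (by simpa using hp))
    rw [proj_of_mem_ne _ ha this, tmul, GradedTensorProduct.tmul, TensorProduct.zero_tmul, map_zero]
  · intro h
    exact (h (Finset.HasAntidiagonal.mem_antidiagonal.2 rfl)).elim

theorem projLinear_of_mem_ne {m n : ℕ} {x : FreeExt A 𝒱} (hx : x ∈ gr A 𝒱 m) (hmn : m ≠ n) :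
    projLinear A 𝒱 n x = 0 := by
  suffices h : gr A 𝒱 m ≤ LinearMap.ker (projLinear A 𝒱 n) from h hx
  refine Submodule.span_le.2 ?_
  rintro _ ⟨i, j, rfl, a, ha, w, hw, rfl⟩
  change projLinear A 𝒱 _ _ = _
  rw [projLinear_tmul]
  refine Finset.sum_eq_zero fun ⟨i', j'⟩ hp => ?_
  rw [Finset.HasAntidiagonal.mem_antidiagonal] at hp
  by_cases h : i = i'
  · have : j ≠ j' := by rintro rfl; exact hmn (by rw [h]; exact hp)
    rw [proj_of_mem_ne _ hw this, tmul, GradedTensorProduct.tmul, TensorProduct.tmul_zero, map_zero]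
  · rw [proj_of_mem_ne _ ha h, tmul, GradedTensorProduct.tmul, TensorProduct.zero_tmul, map_zero]

theorem iSup_gr : ⨆ n, gr A 𝒱 n = ⊤ := by
  rw [eq_top_iff]
  rintro x -
  induction x using tmul_induction with
  | zero => exact zero_mem _
  | tmul a w =>
    induction a using DirectSum.Decomposition.inductionOn A.gr with
    | zero =>
      rw [tmul, GradedTensorProduct.tmul, TensorProduct.zero_tmul, map_zero]; exact zero_mem _
    | @homogeneous i a =>
      induction w using DirectSum.Decomposition.inductionOn (FreeGCA.gr 𝒱) with
      | zero =>
        rw [tmul, GradedTensorProduct.tmul, TensorProduct.tmul_zero, map_zero]; exact zero_mem _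
      | @homogeneous j w => exact Submodule.mem_iSup_of_mem _ (tmul_mem rfl a.2 w.2)
      | add w w' h h' =>
        rw [tmul, GradedTensorProduct.tmul, TensorProduct.tmul_add, map_add]; exact add_mem h h'
    | add a a' h h' =>
      rw [tmul, GradedTensorProduct.tmul, TensorProduct.add_tmul, map_add]; exact add_mem h h'
  | add x y hx hy => exact add_mem hx hy

instance : GradedAlgebra (gr A 𝒱) where
  toDecomposition :=
    (isInternal_of_projections (gr A 𝒱) (projLinear A 𝒱) projLinear_of_mem_same
      projLinear_of_mem_ne iSup_gr).chooseDecomposition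

theorem graded_comm {m n : ℕ} {x y : FreeExt A 𝒱} (hx : x ∈ gr A 𝒱 m) (hy : y ∈ gr A 𝒱 n) :
    x * y = (-1 : ℚ) ^ (m * n) • (y * x) := by
  induction hx, hy using Submodule.span_induction₂ with
  | mem_mem x y hx hy =>
    obtain ⟨i, j, rfl, a, ha, w, hw, rfl⟩ := hx
    obtain ⟨i', j', rfl, a', ha', w', hw', rfl⟩ := hy
    rw [tmul_mul_tmul a hw ha' w', tmul_mul_tmul a' hw' ha w, A.graded_comm ha ha',
      FreeGCA.graded_comm hw hw']
    have : tmul A 𝒱 ((-1 : ℚ) ^ (i * i') • (a' * a)) ((-1 : ℚ) ^ (j * j') • (w' * w)) =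
        (-1 : ℚ) ^ (i * i' + j * j') • tmul A 𝒱 (a' * a) (w' * w) := by
      rw [tmul, GradedTensorProduct.tmul, TensorProduct.smul_tmul_smul, map_smul, pow_add]
    rw [this, smul_smul, smul_smul, ← pow_add, ← pow_add]
    congr 1
    rw [show (i + j) * (i' + j') + j' * i = j * i' + (i * i' + j * j') + 2 * (i * j') by ring,
      pow_add _ _ (2 * _), pow_mul, neg_one_sq, one_pow, mul_one]
  | zero_left y hy => rw [zero_mul, mul_zero, smul_zero]
  | zero_right x hx => rw [zero_mul, mul_zero, smul_zero]
  | add_left x y z _ _ _ hx hy => rw [add_mul, mul_add, hx, hy, smul_add]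
  | add_right x y z _ _ _ hx hy => rw [mul_add, add_mul, hx, hy, smul_add]
  | smul_left r x y _ _ h => rw [smul_mul_assoc, mul_smul_comm, h, smul_comm]
  | smul_right r x y _ _ h => rw [smul_mul_assoc, mul_smul_comm, h, smul_comm]

end FreeExt
end FreeExt

/-! ### Derivations of `A ⊗ ΛV` -/

namespace FreeExt

variable {A : CDGA.{u}} {V : Type u} [AddCommGroup V] [Module ℚ V] {𝒱 : ℕ → Submodule ℚ V}
  [DirectSum.Decomposition 𝒱]

variable (A 𝒱) in
/-- The grading involution of `A ⊗ ΛV`. -/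
abbrev sgn : FreeExt A 𝒱 →ₐ[ℚ] FreeExt A 𝒱 := gradeSign (gr A 𝒱)

theorem sgn_incl (a : A) : sgn A 𝒱 (incl A 𝒱 a) = incl A 𝒱 (A.sgn a) := by
  induction a using DirectSum.Decomposition.inductionOn A.gr with
  | zero => simp
  | @homogeneous n a =>
    rw [gradeSign_of_mem _ (incl_mem a.2), CDGA.sgn_of_mem a.2, map_smul]
  | add a b ha hb => rw [map_add, map_add, ha, hb, map_add, map_add]

/-- The upper triangular matrix with diagonal `(-1)^|x| x`, `x` and corner `y`.  For a derivation
`D` of degree one, the Leibniz rule says that `x ↦ tri x (D x)` is multiplicative. -/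
def tri (x y : FreeExt A 𝒱) : Matrix (Fin 2) (Fin 2) (FreeExt A 𝒱) := !![sgn A 𝒱 x, y; 0, x]

theorem tri_mul (x y x' y' : FreeExt A 𝒱) :
    tri x y * tri x' y' = tri (x * x') (y * x' + sgn A 𝒱 x * y') := by
  simp [tri, add_comm]

theorem tri_add (x y x' y' : FreeExt A 𝒱) :
    tri x y + tri x' y' = tri (x + x') (y + y') := by
  simp [tri]

theorem tri_smul (r : ℚ) (x y : FreeExt A 𝒱) : r • tri x y = tri (r • x) (r • y) := by
  simp [tri]

theorem tri_zero : tri (0 : FreeExt A 𝒱) 0 = 0 := by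
  ext i j; fin_cases i <;> fin_cases j <;> simp [tri]

theorem tri_one : tri (1 : FreeExt A 𝒱) 0 = 1 := by
  ext i j; fin_cases i <;> fin_cases j <;> simp [tri]

/-- The matrices `tri x x'` of homogeneous `x`, `x'` with `|x'| = |x| + 1` commute up to the same sign
as the elements `x`. -/
theorem tri_comm {m n : ℕ} {x x' y y' : FreeExt A 𝒱} (hx : x ∈ gr A 𝒱 m)
    (hx' : x' ∈ gr A 𝒱 (m + 1)) (hy : y ∈ gr A 𝒱 n) (hy' : y' ∈ gr A 𝒱 (n + 1)) :
    tri x x' * tri y y' = (-1 : ℚ) ^ (m * n) • (tri y y' * tri x x') := by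
  rw [tri_mul, tri_mul, tri_smul, graded_comm hx hy, gradeSign_of_mem _ hx, gradeSign_of_mem _ hy,
    smul_add, smul_mul_assoc, smul_mul_assoc, graded_comm hx hy', graded_comm hx' hy, smul_smul,
    smul_smul, ← pow_add, ← pow_add, add_comm]
  congr 3
  · rw [show m + m * (n + 1) = m * n + 2 * m by ring, pow_add _ _ (2 * _), pow_mul _ 2, neg_one_sq,
      one_pow, mul_one]
  · ring

/-- The linear map `v ↦ tri v (δ v)`. -/
def triGen (δ : V →ₗ[ℚ] FreeExt A 𝒱) : V →ₗ[ℚ] Matrix (Fin 2) (Fin 2) (FreeExt A 𝒱) where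
  toFun v := tri (gen A 𝒱 v) (δ v)
  map_add' v w := by rw [tri_add, map_add, map_add]
  map_smul' r v := by rw [RingHom.id_apply, tri_smul, map_smul, map_smul]

/-- The algebra map `a ↦ tri a (d a)`. -/
def triIncl : A →ₐ[ℚ] Matrix (Fin 2) (Fin 2) (FreeExt A 𝒱) :=
  AlgHom.ofLinearMap
    { toFun := fun a => tri (incl A 𝒱 a) (incl A 𝒱 (A.d a))
      map_add' := fun a b => by simp only [tri_add, map_add]
      map_smul' := fun r a => by rw [RingHom.id_apply, tri_smul, map_smul, map_smul, map_smul] }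
    (by
      change tri _ _ = _
      rw [CDGA.d_one, map_one, map_zero, tri_one])
    (fun a b => by
      change tri _ _ = tri _ _ * tri _ _
      rw [tri_mul, CDGA.d_mul, map_mul, map_add, map_mul, map_mul, sgn_incl])

variable (δ : V →ₗ[ℚ] FreeExt A 𝒱) (hδ : ∀ {k : ℕ} {v : V}, v ∈ 𝒱 k → δ v ∈ gr A 𝒱 (k + 1))

/-- The algebra map `w ↦ tri w (D w)` on `ΛV`, where `D` extends `δ`. -/
def triInr : FreeGCA 𝒱 →ₐ[ℚ] Matrix (Fin 2) (Fin 2) (FreeExt A 𝒱) :=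
  FreeGCA.liftAlg 𝒱 (triGen δ) fun hv hw => tri_comm (gen_mem hv) (hδ hv) (gen_mem hw) (hδ hw)

theorem triInr_ι (v : V) : triInr δ hδ (FreeGCA.ι 𝒱 v) = tri (gen A 𝒱 v) (δ v) :=
  FreeGCA.liftAlg_ι 𝒱 (triGen δ) _ v

/-- The diagonal of `triInr w` is determined by `w`, and its corner has degree `|w| + 1`. -/
theorem triInr_eq {n : ℕ} {w : FreeGCA 𝒱} (hw : w ∈ FreeGCA.gr 𝒱 n) :
    ∃ y ∈ gr A 𝒱 (n + 1), triInr δ hδ w = tri (inr A 𝒱 w) y := by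
  refine (FreeGCA.gr_induction (P := fun n w => inr A 𝒱 w ∈ gr A 𝒱 n ∧ ∃ y ∈ gr A 𝒱 (n + 1),
    triInr δ hδ w = tri (inr A 𝒱 w) y) hw (fun n => ?_) (fun r => ?_) (fun k v hv => ?_)
    (fun m n x x' hx hx' => ?_) (fun n x x' hx hx' => ?_)).2
  · rw [map_zero]
    exact ⟨zero_mem _, 0, zero_mem _, by rw [map_zero, tri_zero]⟩
  · rw [AlgHom.commutes]
    refine ⟨SetLike.algebraMap_mem_graded _ r, 0, zero_mem _, ?_⟩
    rw [AlgHom.commutes, Algebra.algebraMap_eq_smul_one,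
      Algebra.algebraMap_eq_smul_one, ← tri_one, tri_smul, smul_zero]
  · exact ⟨gen_mem hv, δ v, hδ hv, triInr_ι δ hδ v⟩
  · obtain ⟨hx, y, hy, h⟩ := hx
    obtain ⟨hx', y', hy', h'⟩ := hx'
    rw [map_mul, map_mul, h, h', tri_mul]
    refine ⟨SetLike.GradedMul.mul_mem hx hx', _, add_mem ?_ ?_, rfl⟩
    · rw [show m + n + 1 = m + 1 + n by ring]
      exact SetLike.GradedMul.mul_mem hy hx'
    · rw [gradeSign_of_mem _ hx, smul_mul_assoc]
      rw [add_assoc]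
      exact Submodule.smul_mem _ _ (SetLike.GradedMul.mul_mem hx hy')
  · obtain ⟨hx, y, hy, h⟩ := hx
    obtain ⟨hx', y', hy', h'⟩ := hx'
    rw [map_add, map_add, h, h', tri_add]
    exact ⟨add_mem hx hx', _, add_mem hy hy', rfl⟩

theorem triIncl_mul_triInr ⦃i j : ℕ⦄ (a : A.gr i) (w : FreeGCA.gr 𝒱 j) :
    triIncl (a : A) * triInr δ hδ (w : FreeGCA 𝒱) =
      (-1 : ℤˣ) ^ (j * i) • (triInr δ hδ (w : FreeGCA 𝒱) * triIncl (a : A)) := by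
  obtain ⟨y, hy, h⟩ := triInr_eq δ hδ w.2
  rw [h, neg_one_units_smul, mul_comm j i]
  exact tri_comm (incl_mem a.2) (incl_mem (A.d_mem a.2)) (inr_mem w.2) hy

/-- The algebra map `x ↦ tri x (D x)` on `A ⊗ ΛV`, where `D` extends `d` and `δ`. -/
def triHom : FreeExt A 𝒱 →ₐ[ℚ] Matrix (Fin 2) (Fin 2) (FreeExt A 𝒱) :=
  GradedTensorProduct.lift A.gr (FreeGCA.gr 𝒱) triIncl (triInr δ hδ) (triIncl_mul_triInr δ hδ)

theorem triHom_tmul (a : A) (w : FreeGCA 𝒱) :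
    triHom δ hδ (tmul A 𝒱 a w) = triIncl a * triInr δ hδ w :=
  GradedTensorProduct.lift_tmul A.gr (FreeGCA.gr 𝒱) _ _ _ a w

theorem triHom_incl (a : A) :
    triHom δ hδ (incl A 𝒱 a) = tri (incl A 𝒱 a) (incl A 𝒱 (A.d a)) := by
  have h := triHom_tmul δ hδ a 1
  rwa [map_one, mul_one] at h

theorem triHom_inr (w : FreeGCA 𝒱) : triHom δ hδ (inr A 𝒱 w) = triInr δ hδ w := by
  have h := triHom_tmul δ hδ 1 w
  rwa [map_one, one_mul] at h

theorem triHom_gen (v : V) : triHom δ hδ (gen A 𝒱 v) = tri (gen A 𝒱 v) (δ v) := by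
  rw [← inr_ι, triHom_inr, triInr_ι]; rfl

/-- The derivation of `A ⊗ ΛV` of degree one that extends `d` on `A` and `δ` on `V`. -/
def der : FreeExt A 𝒱 →ₗ[ℚ] FreeExt A 𝒱 where
  toFun x := triHom δ hδ x 0 1
  map_add' x y := by rw [map_add]; rfl
  map_smul' r x := by rw [map_smul]; rfl

theorem der_apply (x : FreeExt A 𝒱) : der δ hδ x = triHom δ hδ x 0 1 := rfl

theorem triHom_eq (x : FreeExt A 𝒱) : triHom δ hδ x = tri x (der δ hδ x) := by
  have h : ∀ {x y : FreeExt A 𝒱}, triHom δ hδ x = tri x y → triHom δ hδ x = tri x (der δ hδ x) := by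
    intro x y h
    have : der δ hδ x = y := by rw [der_apply, h]; rfl
    rw [this, h]
  induction x using FreeExt.induction with
  | incl a => exact h (triHom_incl δ hδ a)
  | gen v => exact h (triHom_gen δ hδ v)
  | mul x y hx hy => exact h (by rw [map_mul, hx, hy, tri_mul])
  | add x y hx hy => exact h (by rw [map_add, hx, hy, tri_add])

theorem der_incl (a : A) : der δ hδ (incl A 𝒱 a) = incl A 𝒱 (A.d a) := by
  rw [der_apply, triHom_incl]; rfl

theorem der_gen (v : V) : der δ hδ (gen A 𝒱 v) = δ v := by
  rw [der_apply, triHom_gen]; rfl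

theorem der_mul (x y : FreeExt A 𝒱) :
    der δ hδ (x * y) = der δ hδ x * y + sgn A 𝒱 x * der δ hδ y := by
  rw [der_apply, map_mul, triHom_eq, triHom_eq, tri_mul]; rfl

theorem der_mem {n : ℕ} {x : FreeExt A 𝒱} (hx : x ∈ gr A 𝒱 n) :
    der δ hδ x ∈ gr A 𝒱 (n + 1) := by
  suffices h : gr A 𝒱 n ≤ (gr A 𝒱 (n + 1)).comap (der δ hδ) from h hx
  refine Submodule.span_le.2 ?_
  rintro _ ⟨i, j, rfl, a, ha, w, hw, rfl⟩
  change der δ hδ (tmul A 𝒱 a w) ∈ gr A 𝒱 _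
  obtain ⟨y, hy, h⟩ := triInr_eq δ hδ hw
  have hd : der δ hδ (inr A 𝒱 w) = y := by
    rw [der_apply, triHom_inr, h]; rfl
  rw [← incl_mul_inr, der_mul, der_incl, hd, gradeSign_of_mem _ (incl_mem ha), smul_mul_assoc]
  refine add_mem ?_ (Submodule.smul_mem _ _ ?_)
  · rw [show i + j + 1 = i + 1 + j by ring]
    exact SetLike.GradedMul.mul_mem (incl_mem (A.d_mem ha)) (inr_mem hw)
  · rw [add_assoc]
    exact SetLike.GradedMul.mul_mem (incl_mem ha) hy

theorem der_sgn (x : FreeExt A 𝒱) : der δ hδ (sgn A 𝒱 x) = -sgn A 𝒱 (der δ hδ x) := by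
  induction x using DirectSum.Decomposition.inductionOn (gr A 𝒱) with
  | zero => simp
  | @homogeneous n x =>
    rw [gradeSign_of_mem _ x.2, gradeSign_of_mem _ (der_mem δ hδ x.2), map_smul, pow_succ]
    simp
  | add x y hx hy => rw [map_add, map_add, hx, hy, map_add, map_add, neg_add]

theorem der_der (h : ∀ v, der δ hδ (δ v) = 0) (x : FreeExt A 𝒱) :
    der δ hδ (der δ hδ x) = 0 := by
  induction x using FreeExt.induction with
  | incl a => rw [der_incl, der_incl, A.d_d, map_zero]
  | gen v => rw [der_gen, h]
  | mul x y hx hy =>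
    rw [der_mul, map_add, der_mul, der_mul, hx, hy, der_sgn, zero_mul, mul_zero, add_zero, zero_add,
      neg_mul, add_neg_cancel]
  | add x y hx hy => rw [map_add, map_add, hx, hy, add_zero]

variable {δ}

/-- Derivations that agree on the generators from `W` agree on the subalgebra `A ⊗ ΛW`. -/
theorem der_congr {δ' : V →ₗ[ℚ] FreeExt A 𝒱}
    (hδ' : ∀ {k : ℕ} {v : V}, v ∈ 𝒱 k → δ' v ∈ gr A 𝒱 (k + 1)) {W : Set V}
    (h : ∀ v ∈ W, δ v = δ' v) {x : FreeExt A 𝒱}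
    (hx : x ∈ (incl A 𝒱).range ⊔ Algebra.adjoin ℚ (gen A 𝒱 '' W)) :
    der δ hδ x = der δ' hδ' x := by
  have : (incl A 𝒱).range ⊔ Algebra.adjoin ℚ (gen A 𝒱 '' W) ≤
      AlgHom.equalizer (triHom δ hδ) (triHom δ' hδ') := by
    refine sup_le ?_ (Algebra.adjoin_le ?_)
    · rintro _ ⟨a, rfl⟩
      exact (triHom_incl δ hδ a).trans (triHom_incl δ' hδ' a).symm
    · rintro _ ⟨v, hv, rfl⟩
      change triHom δ hδ _ = triHom δ' hδ' _
      rw [triHom_gen, triHom_gen, h v hv]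
  exact congrFun (congrFun (this hx) 0) 1

variable (δ)

/-- The commutative DGA `(A ⊗ ΛV, D)` given by the differential `δ` on generators. -/
def cdga (h : ∀ v, der δ hδ (δ v) = 0) : CDGA.{u} where
  carrier := FreeExt A 𝒱
  gr := gr A 𝒱
  d := der δ hδ
  d_mem := der_mem δ hδ
  d_d := der_der δ hδ h
  leibniz y hx := by rw [der_mul, gradeSign_of_mem _ hx, smul_mul_assoc]
  graded_comm := graded_comm

/-- The fibration `A ↪ (A ⊗ ΛV, D)` given by the differential `δ` on generators. -/
def fibration (h : ∀ v, der δ hδ (δ v) = 0) (h0 : 𝒱 0 = ⊥) (fil : ℕ → Submodule ℚ V)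
    (fil_mono : Monotone fil)
    (fil_graded : ∀ (n : ℕ) (v : V), v ∈ fil n → ∀ k : ℕ, (DirectSum.decompose 𝒱 v k : V) ∈ fil n)
    (fil_exhaust : ∀ v : V, ∃ n : ℕ, v ∈ fil n)
    (d_zero : ∀ v ∈ fil 0, δ v ∈ (incl A 𝒱).range)
    (d_succ : ∀ n : ℕ, ∀ v ∈ fil (n + 1),
      δ v ∈ (incl A 𝒱).range ⊔ Algebra.adjoin ℚ (gen A 𝒱 '' (fil n : Set V))) :
    AlgFibration A where
  total := cdga δ hδ h
  incl := ⟨incl A 𝒱, incl_mem, fun a => (der_incl δ hδ a).symm⟩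
  V := V
  grV := 𝒱
  grV_zero := h0
  gen := gen A 𝒱
  gen_mem := gen_mem
  bijective := by
    have hlift : FreeGCA.lift 𝒱 (cdga δ hδ h) (gen A 𝒱) gen_mem = inr A 𝒱 :=
      FreeGCA.algHom_ext fun v => FreeGCA.lift_ι 𝒱 (cdga δ hδ h) (gen A 𝒱) gen_mem v
    rw [hlift]
    refine (congrArg Function.Bijective (funext fun t => ?_)).mpr
      (GradedTensorProduct.of ℚ A.gr (FreeGCA.gr 𝒱)).bijective
    induction t using TensorProduct.induction_on with
    | zero => rw [map_zero, map_zero]; rfl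
    | tmul a w => exact incl_mul_inr a w
    | add x y hx hy => rw [map_add, map_add, hx, hy]; rfl
  fil := fil
  fil_mono := fil_mono
  fil_graded := fil_graded
  fil_exhaust := fil_exhaust
  d_fil_zero v hv := by
    have := d_zero v hv
    rwa [← der_gen δ hδ] at this
  d_fil_succ n v hv := by
    have := d_succ n v hv
    rwa [← der_gen δ hδ] at this

end FreeExt

/-! ### Graded vector spaces with a homogeneous basis -/

section Basis

variable {I : Type u} (deg : I → ℕ)

/-- The grading of the vector space on the basis `I` in which `i` has degree `deg i`. -/
def basisGr (n : ℕ) : Submodule ℚ (I →₀ ℚ) := Finsupp.supported ℚ ℚ {i | deg i = n}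

theorem single_mem_basisGr (i : I) (r : ℚ) : Finsupp.single i r ∈ basisGr deg (deg i) :=
  Finsupp.single_mem_supported ℚ r rfl

instance : DirectSum.Decomposition (basisGr deg) := by
  classical
  refine (isInternal_of_projections (basisGr deg)
    (fun n => (Finsupp.supported ℚ ℚ {i | deg i = n}).subtype ∘ₗ
      Finsupp.restrictDom ℚ ℚ {i | deg i = n}) ?_ ?_ ?_).chooseDecomposition
  · intro n x hx
    refine Finsupp.filter_eq_self_iff _ _ |>.2 fun i hi => ?_
    exact hx (Finsupp.mem_support_iff.2 hi)
  · intro m n x hx hmn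
    refine Finsupp.filter_eq_zero_iff _ _ |>.2 fun i hi => ?_
    by_contra h
    have : deg i = m := hx (Finsupp.mem_support_iff.2 h)
    exact hmn (this.symm.trans hi)
  · rw [eq_top_iff]
    rintro x -
    induction x using Finsupp.induction_linear with
    | zero => exact zero_mem _
    | add x y hx hy => exact add_mem hx hy
    | single i r => exact Submodule.mem_iSup_of_mem _ (single_mem_basisGr deg i r)

theorem decompose_basisGr_apply (v : I →₀ ℚ) (k : ℕ) (i : I) :
    (DirectSum.decompose (basisGr deg) v k : I →₀ ℚ) i = if deg i = k then v i else 0 := by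
  induction v using DirectSum.Decomposition.inductionOn (basisGr deg) with
  | zero => simp
  | @homogeneous m v =>
    have hv : ∀ i, deg i ≠ m → (v : I →₀ ℚ) i = 0 := (Finsupp.mem_supported' ℚ _).1 v.2
    rcases eq_or_ne m k with rfl | h
    · rw [DirectSum.decompose_coe, DirectSum.of_eq_same]
      split_ifs with hi
      · rfl
      · exact hv i hi
    · rw [DirectSum.decompose_coe, DirectSum.of_eq_of_ne _ _ _ h.symm]
      split_ifs with hi
      · exact (hv i (by omega)).symm
      · rfl
  | add v w hv hw =>
    rw [DirectSum.decompose_add, DirectSum.add_apply, Submodule.coe_add, Finsupp.add_apply, hv, hw]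
    split_ifs <;> simp

theorem decompose_mem_supported {s : Set I} {v : I →₀ ℚ} (hv : v ∈ Finsupp.supported ℚ ℚ s)
    (k : ℕ) : (DirectSum.decompose (basisGr deg) v k : I →₀ ℚ) ∈ Finsupp.supported ℚ ℚ s := by
  rw [Finsupp.mem_supported'] at *
  intro i hi
  rw [decompose_basisGr_apply, hv i hi, ite_self]

variable {M : Type*} [AddCommGroup M] [Module ℚ M]

theorem linearCombination_mem_of_supported {s : Set I} {g : I → M} {N : Submodule ℚ M}
    (h : ∀ i ∈ s, g i ∈ N) {v : I →₀ ℚ} (hv : v ∈ Finsupp.supported ℚ ℚ s) :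
    Finsupp.linearCombination ℚ g v ∈ N := by
  rw [Finsupp.linearCombination_apply]
  exact Submodule.sum_mem _ fun i hi => Submodule.smul_mem _ _ (h i (hv hi))

theorem linearCombination_congr_of_supported {s : Set I} {g g' : I → M}
    (h : ∀ i ∈ s, g i = g' i) {v : I →₀ ℚ} (hv : v ∈ Finsupp.supported ℚ ℚ s) :
    Finsupp.linearCombination ℚ g v = Finsupp.linearCombination ℚ g' v := by
  rw [Finsupp.linearCombination_apply, Finsupp.linearCombination_apply]
  exact Finsupp.sum_congr fun i hi => by rw [h i (hv hi)]

end Basis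

/-! ### Killing all even cocycles by odd generators -/

namespace OddExt

variable (A : CDGA.{u})

/-- The index set of the generators: `(m, k, x)` indexes a generator of degree `2 k + 1` that is
added at stage `m`; the label `x` stands for the cocycle of degree `2 k + 2` to be killed. -/
abbrev Ind : Type u := ℕ × ℕ × A

/-- The degree of a generator. -/
abbrev deg (i : Ind A) : ℕ := 2 * i.2.1 + 1

/-- The algebra `A ⊗ ΛV` on all generators. -/
abbrev Alg : Type u := FreeExt A (basisGr (deg A))

/-- The span of the generators of stages `< n`. -/
def stage (n : ℕ) : Submodule ℚ (Ind A →₀ ℚ) := Finsupp.supported ℚ ℚ {i | i.1 < n}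

/-- The subalgebra of `A ⊗ ΛV` on the generators of stages `< n`. -/
def stageAlg (n : ℕ) : Subalgebra ℚ (Alg A) :=
  (FreeExt.incl A _).range ⊔ Algebra.adjoin ℚ (FreeExt.gen A _ '' (stage A n : Set (Ind A →₀ ℚ)))

variable {A}

theorem stage_mono : Monotone (stage A) := fun _ _ h =>
  Finsupp.supported_mono fun _ hi => lt_of_lt_of_le hi h

theorem stageAlg_mono : Monotone (stageAlg A) := fun _ _ h =>
  sup_le_sup_left (Algebra.adjoin_mono (Set.image_mono (stage_mono h))) _

theorem exists_mem_stage (v : Ind A →₀ ℚ) : ∃ n, v ∈ stage A n := by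
  refine ⟨v.support.sup Prod.fst + 1, fun i hi => ?_⟩
  exact Nat.lt_succ_of_le (Finset.le_sup (f := Prod.fst) hi)

theorem incl_mem_stageAlg (n : ℕ) (a : A) : FreeExt.incl A _ a ∈ stageAlg A n :=
  (le_sup_left : (FreeExt.incl A (basisGr (deg A))).range ≤ stageAlg A n) ⟨a, rfl⟩

theorem gen_mem_stageAlg {n : ℕ} {v : Ind A →₀ ℚ} (hv : v ∈ stage A n) :
    FreeExt.gen A _ v ∈ stageAlg A n :=
  (le_sup_right : Algebra.adjoin ℚ (FreeExt.gen A _ '' (stage A n : Set _)) ≤ stageAlg A n)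
    (Algebra.subset_adjoin ⟨v, hv, rfl⟩)

theorem exists_mem_stageAlg (x : Alg A) : ∃ n, x ∈ stageAlg A n := by
  induction x using FreeExt.induction with
  | incl a => exact ⟨0, incl_mem_stageAlg 0 a⟩
  | gen v => exact (exists_mem_stage v).imp fun _ => gen_mem_stageAlg
  | mul x y hx hy =>
    obtain ⟨m, hm⟩ := hx
    obtain ⟨n, hn⟩ := hy
    exact ⟨max m n, mul_mem (stageAlg_mono (le_max_left m n) hm)
      (stageAlg_mono (le_max_right m n) hn)⟩
  | add x y hx hy =>
    obtain ⟨m, hm⟩ := hx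
    obtain ⟨n, hn⟩ := hy
    exact ⟨max m n, add_mem (stageAlg_mono (le_max_left m n) hm)
      (stageAlg_mono (le_max_right m n) hn)⟩

open Cardinal in
/-- The elements of `A ⊗ ΛV` can be labelled by those of `A`, since `V` has no more generators than
`A` has elements. -/
theorem exists_surjective (hA : A.IsConnected) : ∃ s : A → Alg A, Function.Surjective s := by
  have : Nontrivial A := ⟨1, 0, hA.one_ne_zero⟩
  have : Infinite A := Infinite.of_injective _ (algebraMap ℚ A).injective
  have haleph : ℵ₀ ≤ #A := Cardinal.aleph0_le_mk A
  let S : Set (Alg A) := Set.range (FreeExt.incl A _) ∪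
    Set.range fun i => FreeExt.gen A (basisGr (deg A)) (Finsupp.single i 1)
  have hS : Algebra.adjoin ℚ S = ⊤ := by
    rw [eq_top_iff]
    rintro x -
    induction x using FreeExt.induction with
    | incl a => exact Algebra.subset_adjoin (Or.inl ⟨a, rfl⟩)
    | gen v =>
      induction v using Finsupp.induction_linear with
      | zero => rw [map_zero]; exact zero_mem _
      | add x y hx hy => rw [map_add]; exact add_mem hx hy
      | single i r =>
        rw [← mul_one r, ← smul_eq_mul, ← Finsupp.smul_single, map_smul]
        exact (Algebra.adjoin ℚ S).smul_mem (Algebra.subset_adjoin (Or.inr ⟨i, rfl⟩)) r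
    | mul x y hx hy => exact mul_mem hx hy
    | add x y hx hy => exact add_mem hx hy
  have hI : #(Ind A) ≤ #A := by
    simp only [Ind, Cardinal.mk_prod, Cardinal.lift_uzero, Cardinal.mk_nat, Cardinal.lift_aleph0]
    rw [Cardinal.aleph0_mul_eq haleph, Cardinal.aleph0_mul_eq haleph]
  have hcard : #(Alg A) ≤ #A := by
    have h := Algebra.lift_cardinalMk_adjoin_le ℚ S
    rw [hS, Cardinal.lift_uzero, Cardinal.lift_uzero] at h
    have h1 : #(⊤ : Subalgebra ℚ (Alg A)) = #(Alg A) :=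
      Cardinal.mk_congr Subalgebra.topEquiv.toEquiv
    rw [h1] at h
    refine h.trans (max_le (max_le ?_ ?_) haleph)
    · simp
    · refine (Cardinal.mk_union_le _ _).trans ((add_le_add (Cardinal.mk_range_le.trans le_rfl)
        (Cardinal.mk_range_le.trans hI)).trans ?_)
      rw [Cardinal.add_eq_self haleph]
  obtain ⟨f⟩ := hcard
  exact ⟨Function.invFun f, Function.invFun_surjective f.injective⟩

variable (s : A → Alg A)

theorem linearCombination_mem_gr {g : Ind A → Alg A}
    (hg : ∀ i, g i ∈ FreeExt.gr A (basisGr (deg A)) (deg A i + 1)) {k : ℕ} {v : Ind A →₀ ℚ}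
    (hv : v ∈ basisGr (deg A) k) :
    Finsupp.linearCombination ℚ g v ∈ FreeExt.gr A (basisGr (deg A)) (k + 1) :=
  linearCombination_mem_of_supported (fun i (hi : deg A i = k) => hi ▸ hg i) hv

/-- The derivation of `A ⊗ ΛV` with the values `g` on the generators. -/
def basisDer (g : Ind A → Alg A)
    (hg : ∀ i, g i ∈ FreeExt.gr A (basisGr (deg A)) (deg A i + 1)) : Alg A →ₗ[ℚ] Alg A :=
  FreeExt.der (Finsupp.linearCombination ℚ g) (linearCombination_mem_gr hg)

open Classical in
/-- The differential on generators of stages `< n`, and `0` on the other ones.  The generator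
`(n, k, x)` kills `s x` if this is a cocycle of degree `2 k + 2` in the subalgebra of stage `n`. -/
def value : ℕ → {g : Ind A → Alg A // ∀ i, g i ∈ FreeExt.gr A (basisGr (deg A)) (deg A i + 1)}
  | 0 => ⟨0, fun _ => zero_mem _⟩
  | n + 1 => ⟨fun i =>
      if i.1 = n then
        if s i.2.2 ∈ FreeExt.gr A (basisGr (deg A)) (deg A i + 1) ∧ s i.2.2 ∈ stageAlg A n ∧
          basisDer (value n).1 (value n).2 (s i.2.2) = 0 then s i.2.2 else 0
      else (value n).1 i, fun i => by
        dsimp only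
        split_ifs with h1 h2
        · exact h2.1
        · exact zero_mem _
        · exact (value n).2 i⟩

/-- The differential on all generators. -/
def limitValue (i : Ind A) : Alg A := (value s (i.1 + 1)).1 i

theorem limitValue_mem (i : Ind A) :
    limitValue s i ∈ FreeExt.gr A (basisGr (deg A)) (deg A i + 1) := (value s (i.1 + 1)).2 i

theorem value_eq_limitValue {n : ℕ} {i : Ind A} (hi : i.1 < n) :
    (value s n).1 i = limitValue s i := by
  induction n with
  | zero => omega
  | succ n ih =>
    rcases eq_or_ne i.1 n with rfl | h
    · rfl
    · rw [← ih (by omega)]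
      exact if_neg h

theorem limitValue_cases (i : Ind A) : limitValue s i = 0 ∨ limitValue s i ∈ stageAlg A i.1 ∧
    basisDer (value s i.1).1 (value s i.1).2 (limitValue s i) = 0 := by
  by_cases h : s i.2.2 ∈ FreeExt.gr A (basisGr (deg A)) (deg A i + 1) ∧ s i.2.2 ∈ stageAlg A i.1 ∧
    basisDer (value s i.1).1 (value s i.1).2 (s i.2.2) = 0
  · have : limitValue s i = s i.2.2 := (if_pos rfl).trans (if_pos h)
    rw [this]
    exact Or.inr h.2
  · exact Or.inl ((if_pos rfl).trans (if_neg h))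

theorem limitValue_mem_stageAlg (i : Ind A) : limitValue s i ∈ stageAlg A i.1 := by
  rcases limitValue_cases s i with h | h
  · rw [h]; exact zero_mem _
  · exact h.1

/-- The differential of `A ⊗ ΛV`. -/
def diff : Alg A →ₗ[ℚ] Alg A := basisDer (limitValue s) (limitValue_mem s)

theorem diff_eq {n : ℕ} {x : Alg A} (hx : x ∈ stageAlg A n) :
    diff s x = basisDer (value s n).1 (value s n).2 x :=
  FreeExt.der_congr (linearCombination_mem_gr (limitValue_mem s))
    (linearCombination_mem_gr (value s n).2) (fun _ hv => linearCombination_congr_of_supported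
    (fun _ hi => (value_eq_limitValue s hi).symm) hv) hx

theorem diff_limitValue (i : Ind A) : diff s (limitValue s i) = 0 := by
  rcases limitValue_cases s i with h | h
  · rw [h, map_zero]
  · rw [diff_eq s h.1, h.2]

theorem diff_linearCombination (v : Ind A →₀ ℚ) :
    diff s (Finsupp.linearCombination ℚ (limitValue s) v) = 0 :=
  linearCombination_mem_of_supported (s := Set.univ) (N := LinearMap.ker (diff s))
    (fun i _ => diff_limitValue s i) (Set.subset_univ _)

theorem linearCombination_mem_stageAlg {n : ℕ} {v : Ind A →₀ ℚ} (hv : v ∈ stage A (n + 1)) :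
    Finsupp.linearCombination ℚ (limitValue s) v ∈ stageAlg A n := by
  have h : ∀ i ∈ {i : Ind A | i.1 < n + 1},
      limitValue s i ∈ Subalgebra.toSubmodule (stageAlg A n) := fun i hi =>
    stageAlg_mono (Nat.le_of_lt_succ hi) (limitValue_mem_stageAlg s i)
  exact linearCombination_mem_of_supported h hv

/-- The fibration that is obtained by killing all even cocycles repeatedly. -/
def fibration : AlgFibration A :=
  FreeExt.fibration (Finsupp.linearCombination ℚ (limitValue s))
    (linearCombination_mem_gr (limitValue_mem s)) (diff_linearCombination s)
    (by
      rw [eq_bot_iff]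
      intro v hv
      refine (Submodule.mem_bot ℚ).2 (Finsupp.ext fun i => ?_)
      exact (Finsupp.mem_supported' ℚ v).1 hv i (Nat.succ_ne_zero _))
    (fun n => stage A (n + 1)) (fun _ _ h => stage_mono (Nat.succ_le_succ h))
    (fun _ _ hv k => decompose_mem_supported _ hv k)
    (fun v => (exists_mem_stage v).imp fun n hn => stage_mono n.le_succ hn)
    (fun v hv => by
      have h := linearCombination_mem_stageAlg s hv
      refine (sup_le le_rfl (Algebra.adjoin_le ?_) : stageAlg A 0 ≤ _) h
      rintro _ ⟨w, hw, rfl⟩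
      have : w = 0 := Finsupp.ext fun i =>
        (Finsupp.mem_supported' ℚ w).1 hw i (Nat.not_lt_zero _)
      rw [this, map_zero]
      exact zero_mem _)
    (fun n v hv => linearCombination_mem_stageAlg s hv)

theorem fibration_isIteratedOdd : (fibration s).IsIteratedOdd := by
  intro k hk
  rw [eq_bot_iff]
  intro v hv
  refine (Submodule.mem_bot ℚ).2 (Finsupp.ext fun i => ?_)
  refine (Finsupp.mem_supported' ℚ v).1 hv i fun h => ?_
  exact Nat.not_even_iff_odd.2 ⟨i.2.1, h.symm⟩ hk

theorem fibration_hdeg (hs : Function.Surjective s) {i : ℕ} (hi : 0 < i) :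
    (fibration s).total.Hdeg (2 * i) = ⊥ := by
  rw [CDGA.hdeg_eq_bot_iff]
  intro (z : Alg A) (hz : z ∈ FreeExt.gr A _ (2 * i)) (hdz : diff s z = 0)
  obtain ⟨n, hn⟩ := exists_mem_stageAlg z
  obtain ⟨x, rfl⟩ := hs z
  obtain ⟨k, rfl⟩ : ∃ k, i = k + 1 := ⟨i - 1, by omega⟩
  refine ⟨FreeExt.gen A _ (Finsupp.single (n, k, x) 1), ?_⟩
  have h : limitValue s (n, k, x) = s x :=
    (if_pos rfl).trans (if_pos ⟨hz, hn, by rw [← diff_eq s hn]; exact hdz⟩)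
  refine (FreeExt.der_gen _ (linearCombination_mem_gr (limitValue_mem s)) _).trans ?_
  rw [Finsupp.linearCombination_single, one_smul, h]

end OddExt

theorem CDGA.IsConnected.exists_iteratedOdd {A : CDGA.{u}} (hA : A.IsConnected) :
    ∃ τ : AlgFibration A, τ.IsIteratedOdd ∧ ∀ i : ℕ, 0 < i → τ.total.Hdeg (2 * i) = ⊥ :=
  let ⟨s, hs⟩ := OddExt.exists_surjective hA
  ⟨OddExt.fibration s, OddExt.fibration_isIteratedOdd s, fun _ => OddExt.fibration_hdeg s hs⟩

/-! ### Graded subspaces -/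

section GradedSubspace

variable {V : Type u} [AddCommGroup V] [Module ℚ V] (𝒱 : ℕ → Submodule ℚ V)
  [DirectSum.Decomposition 𝒱]

/-- A subspace is graded if it contains the homogeneous components of its elements. -/
def IsGradedSubspace (W : Submodule ℚ V) : Prop :=
  ∀ v ∈ W, ∀ k : ℕ, (DirectSum.decompose 𝒱 v k : V) ∈ W

variable {𝒱}

theorem IsGradedSubspace.sup {W W' : Submodule ℚ V} (hW : IsGradedSubspace 𝒱 W)
    (hW' : IsGradedSubspace 𝒱 W') : IsGradedSubspace 𝒱 (W ⊔ W') := by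
  intro v hv k
  obtain ⟨w, hw, w', hw', rfl⟩ := Submodule.mem_sup.1 hv
  rw [DirectSum.decompose_add, DirectSum.add_apply, Submodule.coe_add]
  exact Submodule.add_mem_sup (hW w hw k) (hW' w' hw' k)

theorem isGradedSubspace_bot : IsGradedSubspace 𝒱 (⊥ : Submodule ℚ V) := by
  intro v hv k
  rw [(Submodule.mem_bot ℚ).1 hv]
  simp

/-- Every element of a graded subspace `W` lies in a finite-dimensional graded subspace of `W`. -/
theorem IsGradedSubspace.exists_fg {W : Submodule ℚ V} (hW : IsGradedSubspace 𝒱 W) {v : V}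
    (hv : v ∈ W) : ∃ G ≤ W, G.FG ∧ IsGradedSubspace 𝒱 G ∧ v ∈ G := by
  classical
  let s : Finset V :=
    (DirectSum.decompose 𝒱 v).support.image fun k => (DirectSum.decompose 𝒱 v k : V)
  have hs : ∀ k, (DirectSum.decompose 𝒱 v k : V) ∈ Submodule.span ℚ (s : Set V) := by
    intro k
    by_cases hk : k ∈ (DirectSum.decompose 𝒱 v).support
    · exact Submodule.subset_span (Finset.mem_coe.2 (Finset.mem_image_of_mem _ hk))
    · rw [DFinsupp.notMem_support_iff.1 hk]; exact zero_mem _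
  refine ⟨Submodule.span ℚ (s : Set V), Submodule.span_le.2 ?_, ⟨s, rfl⟩, ?_, ?_⟩
  · intro u hu
    obtain ⟨k, -, rfl⟩ := Finset.mem_image.1 (Finset.mem_coe.1 hu)
    exact hW v hv k
  · intro u hu k
    induction hu using Submodule.span_induction with
    | mem u hu =>
      obtain ⟨j, -, rfl⟩ := Finset.mem_image.1 (Finset.mem_coe.1 hu)
      rcases eq_or_ne j k with rfl | h
      · rw [DirectSum.decompose_coe, DirectSum.of_eq_same]; exact hs j
      · rw [DirectSum.decompose_coe, DirectSum.of_eq_of_ne _ _ _ h.symm]; exact zero_mem _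
    | zero => rw [DirectSum.decompose_zero]; exact zero_mem _
    | add x y _ _ hx hy =>
      rw [DirectSum.decompose_add, DirectSum.add_apply, Submodule.coe_add]; exact add_mem hx hy
    | smul r x _ hx =>
      rw [DirectSum.decompose_smul]; exact Submodule.smul_mem _ r hx
  · have h := Submodule.sum_mem _ fun k (_ : k ∈ (DirectSum.decompose 𝒱 v).support) => hs k
    rwa [DirectSum.sum_support_decompose] at h

/-- The projection of a graded subspace to its degree `k` part. -/
def IsGradedSubspace.proj {W : Submodule ℚ V} (hW : IsGradedSubspace 𝒱 W) (k : ℕ) : W →ₗ[ℚ] W where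
  toFun w := ⟨DirectSum.decompose 𝒱 (w : V) k, hW w w.2 k⟩
  map_add' w w' := Subtype.ext (by
    simp only [Submodule.coe_add, DirectSum.decompose_add, DirectSum.add_apply])
  map_smul' r w := Subtype.ext (by
    simp only [Submodule.coe_smul, DirectSum.decompose_smul, DirectSum.smul_apply,
      RingHom.id_apply])

variable (𝒱) in
/-- The induced grading of a subspace. -/
def subGr (W : Submodule ℚ V) (k : ℕ) : Submodule ℚ W := (𝒱 k).comap W.subtype

theorem coe_decompose_subGr {W : Submodule ℚ V} [DirectSum.Decomposition (subGr 𝒱 W)] (w : W)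
    (k : ℕ) : ((DirectSum.decompose (subGr 𝒱 W) w k : W) : V) = DirectSum.decompose 𝒱 (w : V) k := by
  induction w using DirectSum.Decomposition.inductionOn (subGr 𝒱 W) with
  | zero => simp
  | @homogeneous m w =>
    have hw : ((w : W) : V) ∈ 𝒱 m := w.2
    rcases eq_or_ne m k with rfl | h
    · rw [DirectSum.decompose_of_mem_same _ w.2, DirectSum.decompose_of_mem_same _ hw]
    · rw [DirectSum.decompose_of_mem_ne _ w.2 h, DirectSum.decompose_of_mem_ne _ hw h]; rfl
  | add v w hv hw =>
    simp only [DirectSum.decompose_add, DirectSum.add_apply, Submodule.coe_add, hv, hw]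

theorem IsGradedSubspace.proj_mem {W : Submodule ℚ V} (hW : IsGradedSubspace 𝒱 W) (k : ℕ) (w : W) :
    hW.proj k w ∈ subGr 𝒱 W k := (DirectSum.decompose 𝒱 (w : V) k).2

theorem IsGradedSubspace.proj_of_mem {W : Submodule ℚ V} (hW : IsGradedSubspace 𝒱 W) {k : ℕ} {w : W}
    (hw : w ∈ subGr 𝒱 W k) : hW.proj k w = w :=
  Subtype.ext (DirectSum.decompose_of_mem_same 𝒱 hw)

/-- The decomposition of a graded subspace. -/
@[reducible]
def IsGradedSubspace.decomposition {W : Submodule ℚ V} (hW : IsGradedSubspace 𝒱 W) :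
    DirectSum.Decomposition (subGr 𝒱 W) := by
  classical
  refine (isInternal_of_projections (subGr 𝒱 W) hW.proj hW.proj_of_mem ?_ ?_).chooseDecomposition
  · intro m n w hw hmn
    exact Subtype.ext (DirectSum.decompose_of_mem_ne 𝒱 hw hmn)
  · rw [eq_top_iff]
    rintro w -
    have : w = ∑ k ∈ (DirectSum.decompose 𝒱 (w : V)).support, hW.proj k w := by
      refine Subtype.ext ?_
      conv_lhs => rw [← DirectSum.sum_support_decompose 𝒱 (w : V)]
      rw [Submodule.coe_sum]
      rfl
    rw [this]
    exact Submodule.sum_mem _ fun k _ => Submodule.mem_iSup_of_mem k (hW.proj_mem k w)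

/-- A graded subspace of a graded vector space has a graded retraction. -/
theorem IsGradedSubspace.exists_retraction {W : Submodule ℚ V} (hW : IsGradedSubspace 𝒱 W) :
    ∃ r : V →ₗ[ℚ] W, (∀ k, ∀ v ∈ 𝒱 k, r v ∈ subGr 𝒱 W k) ∧
      ∀ k, ∀ w ∈ subGr 𝒱 W k, r w = w := by
  obtain ⟨ρ, hρ⟩ := W.subtype.exists_leftInverse_of_injective W.ker_subtype
  refine ⟨ofComponents 𝒱 fun k => hW.proj k ∘ₗ ρ, fun k v hv => ?_, fun k w hw => ?_⟩
  · rw [ofComponents_of_mem _ _ hv]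
    exact hW.proj_mem k _
  · rw [ofComponents_of_mem 𝒱 _ (x := (w : V)) hw, LinearMap.comp_apply]
    have : ρ w = w := LinearMap.congr_fun hρ w
    rw [this, hW.proj_of_mem hw]

/-- The algebra map `ΛW → ΛV` is injective for a graded subspace `W` of `V`. -/
theorem FreeGCA.exists_injective {W : Submodule ℚ V} (hW : IsGradedSubspace 𝒱 W) :
    ∃ φ : FreeGCA (subGr 𝒱 W) →ₐ[ℚ] FreeGCA 𝒱, (∀ w : W, φ (ι _ w) = ι 𝒱 w) ∧
      Function.Injective φ := by
  let := hW.decomposition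
  obtain ⟨r, hr, hrw⟩ := hW.exists_retraction
  let φ : FreeGCA (subGr 𝒱 W) →ₐ[ℚ] FreeGCA 𝒱 :=
    liftAlg _ (ι 𝒱 ∘ₗ W.subtype) fun hv hw => ι_mul_ι 𝒱 hv hw
  let ψ : FreeGCA 𝒱 →ₐ[ℚ] FreeGCA (subGr 𝒱 W) :=
    liftAlg _ (ι (subGr 𝒱 W) ∘ₗ r) fun hv hw => ι_mul_ι _ (hr _ _ hv) (hr _ _ hw)
  have hφ : ∀ w : W, φ (ι _ w) = ι 𝒱 w := fun w => liftAlg_ι _ _ _ w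
  have hψ : ∀ v, ψ (ι 𝒱 v) = ι _ (r v) := fun v => liftAlg_ι _ _ _ v
  refine ⟨φ, hφ, Function.LeftInverse.injective (g := ψ) fun x => ?_⟩
  have : ψ.comp φ = AlgHom.id ℚ _ := algHom_ext fun w => by
    rw [AlgHom.comp_apply, hφ, hψ, AlgHom.id_apply]
    congr 1
    induction w using DirectSum.Decomposition.inductionOn (subGr 𝒱 W) with
    | zero => exact map_zero r
    | homogeneous w => exact hrw _ _ w.2
    | add w w' h h' => rw [Submodule.coe_add, map_add, h, h']
  exact DFunLike.congr_fun this x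

end GradedSubspace

/-! ### Finite-dimensional subfibrations -/

namespace AlgFibration

variable {A : CDGA.{u}} (σ : AlgFibration A)

/-- The subalgebra `A ⊗ ΛW` of the total space. -/
def subalg (W : Submodule ℚ σ.V) : Subalgebra ℚ σ.total :=
  σ.incl.toAlgHom.range ⊔ Algebra.adjoin ℚ (σ.gen '' (W : Set σ.V))

variable {σ}

theorem subalg_mono {W W' : Submodule ℚ σ.V} (h : W ≤ W') : σ.subalg W ≤ σ.subalg W' :=
  sup_le_sup_left (Algebra.adjoin_mono (Set.image_mono h)) _

theorem range_le_subalg (W : Submodule ℚ σ.V) : σ.incl.toAlgHom.range ≤ σ.subalg W := le_sup_left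

theorem gen_mem_subalg {W : Submodule ℚ σ.V} {v : σ.V} (hv : v ∈ W) : σ.gen v ∈ σ.subalg W :=
  (le_sup_right : Algebra.adjoin ℚ (σ.gen '' (W : Set σ.V)) ≤ σ.subalg W)
    (Algebra.subset_adjoin ⟨v, hv, rfl⟩)

theorem subalg_le_iff {W : Submodule ℚ σ.V} {S : Subalgebra ℚ σ.total} :
    σ.subalg W ≤ S ↔ (∀ a, σ.incl.toAlgHom a ∈ S) ∧ ∀ v ∈ W, σ.gen v ∈ S := by
  rw [subalg, sup_le_iff, Algebra.adjoin_le_iff, Set.image_subset_iff]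
  refine and_congr ⟨fun h a => h ⟨a, rfl⟩, ?_⟩ Iff.rfl
  rintro h _ ⟨a, rfl⟩
  exact h a

theorem exists_mem_subalg_fil (b : σ.total) : ∃ n, b ∈ σ.subalg (σ.fil n) := by
  have h : ∀ w : σ.Lam, ∃ n, σ.genHom w ∈ σ.subalg (σ.fil n) := by
    intro w
    induction w using FreeGCA.induction with
    | algebraMap r => exact ⟨0, by rw [AlgHom.commutes]; exact Subalgebra.algebraMap_mem _ r⟩
    | ι v =>
      refine (σ.fil_exhaust v).imp fun n hn => ?_
      rw [genHom_ι]
      exact gen_mem_subalg hn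
    | mul x y hx hy =>
      obtain ⟨m, hm⟩ := hx
      obtain ⟨n, hn⟩ := hy
      rw [map_mul]
      exact ⟨max m n, mul_mem (subalg_mono (σ.fil_mono (le_max_left m n)) hm)
        (subalg_mono (σ.fil_mono (le_max_right m n)) hn)⟩
    | add x y hx hy =>
      obtain ⟨m, hm⟩ := hx
      obtain ⟨n, hn⟩ := hy
      rw [map_add]
      exact ⟨max m n, add_mem (subalg_mono (σ.fil_mono (le_max_left m n)) hm)
        (subalg_mono (σ.fil_mono (le_max_right m n)) hn)⟩
  induction b using σ.total_induction with
  | zero => exact ⟨0, zero_mem _⟩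
  | mul a w => exact (h w).imp fun n hn => mul_mem (range_le_subalg _ ⟨a, rfl⟩) hn
  | add x y hx hy =>
    obtain ⟨m, hm⟩ := hx
    obtain ⟨n, hn⟩ := hy
    exact ⟨max m n, add_mem (subalg_mono (σ.fil_mono (le_max_left m n)) hm)
      (subalg_mono (σ.fil_mono (le_max_right m n)) hn)⟩

/-- An element of `A ⊗ ΛW` involves only a finite-dimensional graded subspace of `W`. -/
theorem exists_fg_of_mem_subalg {W : Submodule ℚ σ.V} (hW : IsGradedSubspace σ.grV W)
    {x : σ.total} (hx : x ∈ σ.subalg W) :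
    ∃ G ≤ W, G.FG ∧ IsGradedSubspace σ.grV G ∧ x ∈ σ.subalg G := by
  let S : Subalgebra ℚ σ.total :=
    { carrier := {x | ∃ G ≤ W, G.FG ∧ IsGradedSubspace σ.grV G ∧ x ∈ σ.subalg G}
      mul_mem' := by
        rintro x y ⟨G, hG, hGf, hGg, hx⟩ ⟨G', hG', hGf', hGg', hy⟩
        exact ⟨G ⊔ G', sup_le hG hG', hGf.sup hGf', hGg.sup hGg',
          mul_mem (subalg_mono le_sup_left hx) (subalg_mono le_sup_right hy)⟩
      add_mem' := by
        rintro x y ⟨G, hG, hGf, hGg, hx⟩ ⟨G', hG', hGf', hGg', hy⟩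
        exact ⟨G ⊔ G', sup_le hG hG', hGf.sup hGf', hGg.sup hGg',
          add_mem (subalg_mono le_sup_left hx) (subalg_mono le_sup_right hy)⟩
      algebraMap_mem' := fun r =>
        ⟨⊥, bot_le, Submodule.fg_bot, isGradedSubspace_bot, Subalgebra.algebraMap_mem _ r⟩ }
  refine (subalg_le_iff (S := S)).2 ⟨fun a => ?_, fun v hv => ?_⟩ hx
  · exact ⟨⊥, bot_le, Submodule.fg_bot, isGradedSubspace_bot, range_le_subalg _ ⟨a, rfl⟩⟩
  · obtain ⟨G, hG, hGf, hGg, hvG⟩ := hW.exists_fg hv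
    exact ⟨G, hG, hGf, hGg, gen_mem_subalg hvG⟩

/-- The differential of a finite-dimensional subspace of generators involves only finitely many
generators. -/
theorem exists_fg_d_gen_mem {W G : Submodule ℚ σ.V} (hW : IsGradedSubspace σ.grV W) (hG : G.FG)
    (h : ∀ v ∈ G, σ.total.d (σ.gen v) ∈ σ.subalg W) :
    ∃ G' ≤ W, G'.FG ∧ IsGradedSubspace σ.grV G' ∧
      ∀ v ∈ G, σ.total.d (σ.gen v) ∈ σ.subalg G' := by
  induction G, hG using Submodule.fg_induction with
  | singleton x =>
    obtain ⟨G', hG', hGf, hGg, hx⟩ :=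
      exists_fg_of_mem_subalg hW (h x (Submodule.mem_span_singleton_self x))
    refine ⟨G', hG', hGf, hGg, fun v hv => ?_⟩
    obtain ⟨r, rfl⟩ := Submodule.mem_span_singleton.1 hv
    rw [map_smul, map_smul]
    exact Subalgebra.smul_mem _ hx r
  | sup M₁ M₂ _ _ h₁ h₂ =>
    obtain ⟨G₁, hG₁, hf₁, hg₁, hd₁⟩ := h₁ fun v hv => h v (Submodule.mem_sup_left hv)
    obtain ⟨G₂, hG₂, hf₂, hg₂, hd₂⟩ := h₂ fun v hv => h v (Submodule.mem_sup_right hv)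
    refine ⟨G₁ ⊔ G₂, sup_le hG₁ hG₂, hf₁.sup hf₂, hg₁.sup hg₂, fun v hv => ?_⟩
    obtain ⟨w, hw, w', hw', rfl⟩ := Submodule.mem_sup.1 hv
    rw [map_add, map_add]
    exact add_mem (subalg_mono le_sup_left (hd₁ w hw)) (subalg_mono le_sup_right (hd₂ w' hw'))

/-- A nilpotence filtration of a finite-dimensional graded subspace `W` of the generators. -/
structure IsFiniteChain (H : ℕ → Submodule ℚ σ.V) (W : Submodule ℚ σ.V) : Prop where
  mono : Monotone H
  graded : ∀ n, IsGradedSubspace σ.grV (H n)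
  fg : W.FG
  eventually : ∃ n, H n = W
  le : ∀ n, H n ≤ W
  d_zero : ∀ v ∈ H 0, σ.total.d (σ.gen v) ∈ σ.incl.toAlgHom.range
  d_succ : ∀ n, ∀ v ∈ H (n + 1), σ.total.d (σ.gen v) ∈ σ.subalg (H n)

/-- Every finite-dimensional space of generators is contained in a finite-dimensional one that is
closed under the differential and nilpotent. -/
theorem exists_isFiniteChain (n : ℕ) {G : Submodule ℚ σ.V} (hG : G ≤ σ.fil n) (hf : G.FG)
    (hg : IsGradedSubspace σ.grV G) :
    ∃ H W, IsFiniteChain (σ := σ) H W ∧ G ≤ W := by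
  induction n generalizing G with
  | zero =>
    have h0 : ∀ v ∈ G, σ.total.d (σ.gen v) ∈ σ.incl.toAlgHom.range := fun v hv =>
      σ.d_fil_zero v (hG hv)
    exact ⟨fun _ => G, G, ⟨monotone_const, fun _ => hg, hf, ⟨0, rfl⟩, fun _ => le_rfl, h0,
      fun _ v hv => range_le_subalg _ (h0 v hv)⟩, le_rfl⟩
  | succ n ih =>
    obtain ⟨G', hG', hf', hg', hd⟩ := exists_fg_d_gen_mem (fun v hv k => σ.fil_graded n v hv k) hf
      fun v hv => σ.d_fil_succ n v (hG hv)
    obtain ⟨H, W, hH, hW⟩ := ih hG' hf' hg'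
    obtain ⟨N, hN⟩ := hH.eventually
    have hWG : IsGradedSubspace σ.grV (W ⊔ G) := (hN ▸ hH.graded N).sup hg
    have hle : ∀ i, H i ≤ W ⊔ G := fun i => (hH.le i).trans le_sup_left
    refine ⟨fun i => if i ≤ N then H i else W ⊔ G, W ⊔ G, ⟨?_, fun i => ?_, hH.fg.sup hf,
      ⟨N + 1, if_neg (by omega)⟩, fun i => ?_, ?_, fun i v hv => ?_⟩, le_sup_right⟩
    · intro i j hij
      beta_reduce
      split_ifs with h1 h2 h2
      · exact hH.mono hij
      · exact hle i
      · omega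
      · exact le_rfl
    · split_ifs
      · exact hH.graded i
      · exact hWG
    · split_ifs
      · exact hle i
      · exact le_rfl
    · intro v hv
      rw [if_pos (Nat.zero_le N)] at hv
      exact hH.d_zero v hv
    · beta_reduce at hv ⊢
      have hWd : ∀ w ∈ W, σ.total.d (σ.gen w) ∈ σ.subalg W := fun w hw => by
        refine subalg_mono (hH.le N) (hH.d_succ N w ?_)
        exact hH.mono N.le_succ (hN.symm ▸ hw)
      by_cases h : i + 1 ≤ N
      · rw [if_pos h] at hv
        rw [if_pos (by omega)]
        exact hH.d_succ i v hv
      · rw [if_neg h] at hv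
        have hsub : σ.subalg W ≤ σ.subalg (if i ≤ N then H i else W ⊔ G) := by
          refine subalg_mono ?_
          split_ifs with h2
          · rw [show i = N by omega, hN]
          · exact le_sup_left
        refine hsub ?_
        obtain ⟨w, hw, g, hg, rfl⟩ := Submodule.mem_sup.1 hv
        rw [map_add, map_add]
        exact add_mem (hWd w hw) (subalg_mono hW (hd g hg))

end AlgFibration

/-! ### Maps out of `A ⊗ ΛV` -/

namespace FreeExt

variable {A B : CDGA.{u}} {V : Type u} [AddCommGroup V] [Module ℚ V] {𝒱 : ℕ → Submodule ℚ V}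
  [DirectSum.Decomposition 𝒱] (f : CDGA.Hom A B) (j : V →ₗ[ℚ] B)
  (hj : ∀ {k : ℕ} {v : V}, v ∈ 𝒱 k → j v ∈ B.gr k)

/-- The algebra map `A ⊗ ΛV → B` that extends maps on `A` and `V`. -/
def extend : FreeExt A 𝒱 →ₐ[ℚ] B :=
  GradedTensorProduct.lift A.gr (FreeGCA.gr 𝒱) f.toAlgHom (FreeGCA.lift 𝒱 B j hj) fun k l a w => by
    rw [neg_one_units_smul, mul_comm l k]
    exact B.graded_comm (f.map_gr a.2) (FreeGCA.lift_mem B j hj w.2)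

theorem extend_tmul (a : A) (w : FreeGCA 𝒱) :
    extend f j hj (tmul A 𝒱 a w) = f.toAlgHom a * FreeGCA.lift 𝒱 B j hj w :=
  GradedTensorProduct.lift_tmul A.gr (FreeGCA.gr 𝒱) _ _ _ a w

theorem extend_incl (a : A) : extend f j hj (incl A 𝒱 a) = f.toAlgHom a := by
  have h := extend_tmul f j hj a 1
  rwa [map_one, mul_one] at h

theorem extend_gen (v : V) : extend f j hj (gen A 𝒱 v) = j v := by
  have h := extend_tmul f j hj 1 (FreeGCA.ι 𝒱 v)
  rwa [map_one, one_mul, FreeGCA.lift_ι] at h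

theorem extend_mem {n : ℕ} {x : FreeExt A 𝒱} (hx : x ∈ gr A 𝒱 n) : extend f j hj x ∈ B.gr n := by
  suffices h : gr A 𝒱 n ≤ (B.gr n).comap (extend f j hj).toLinearMap from h hx
  refine Submodule.span_le.2 ?_
  rintro _ ⟨k, l, rfl, a, ha, w, hw, rfl⟩
  change extend f j hj (tmul A 𝒱 a w) ∈ B.gr _
  rw [extend_tmul]
  exact SetLike.GradedMul.mul_mem (f.map_gr ha) (FreeGCA.lift_mem B j hj hw)

theorem extend_sgn (x : FreeExt A 𝒱) : extend f j hj (sgn A 𝒱 x) = B.sgn (extend f j hj x) := by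
  induction x using DirectSum.Decomposition.inductionOn (gr A 𝒱) with
  | zero => simp
  | @homogeneous n x =>
    rw [gradeSign_of_mem _ x.2, CDGA.sgn_of_mem (extend_mem f j hj x.2), map_smul]
  | add x y hx hy => simp only [map_add, hx, hy]

theorem extend_proj (n : ℕ) (x : FreeExt A 𝒱) :
    extend f j hj (GradedAlgebra.proj (gr A 𝒱) n x) =
      GradedAlgebra.proj B.gr n (extend f j hj x) := by
  induction x using DirectSum.Decomposition.inductionOn (gr A 𝒱) with
  | zero => simp
  | @homogeneous m x =>
    rcases eq_or_ne m n with rfl | h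
    · rw [proj_of_mem_same _ x.2, proj_of_mem_same _ (extend_mem f j hj x.2)]
    · rw [proj_of_mem_ne _ x.2 h, proj_of_mem_ne _ (extend_mem f j hj x.2) h, map_zero]
  | add x y hx hy => simp only [map_add, hx, hy]

variable {f j hj}

theorem mem_gr_of_extend_mem (hinj : Function.Injective (extend f j hj)) {n : ℕ}
    {x : FreeExt A 𝒱} (hx : extend f j hj x ∈ B.gr n) : x ∈ gr A 𝒱 n := by
  refine mem_of_proj_mem (gr A 𝒱) _ fun m => ?_
  rcases eq_or_ne m n with rfl | h
  · exact proj_mem _ _ _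
  · have : GradedAlgebra.proj (gr A 𝒱) m x = 0 := hinj (by
      rw [extend_proj, proj_of_mem_ne _ hx h.symm, map_zero])
    rw [this]
    exact zero_mem _

theorem extend_der {δ : V →ₗ[ℚ] FreeExt A 𝒱}
    {hδ : ∀ {k : ℕ} {v : V}, v ∈ 𝒱 k → δ v ∈ gr A 𝒱 (k + 1)}
    (h : ∀ v, extend f j hj (δ v) = B.d (j v)) (x : FreeExt A 𝒱) :
    extend f j hj (der δ hδ x) = B.d (extend f j hj x) := by
  induction x using FreeExt.induction with
  | incl a => rw [der_incl, extend_incl, extend_incl, f.map_d]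
  | gen v => rw [der_gen, h, extend_gen]
  | mul x y hx hy => rw [der_mul, map_add, map_mul, map_mul, hx, hy, extend_sgn, map_mul, B.d_mul]
  | add x y hx hy => simp only [map_add, hx, hy]

end FreeExt

/-! ### From a kernel class to a finite fibration -/

namespace AlgFibration

variable {A : CDGA.{u}} {σ : AlgFibration A} {W : Submodule ℚ σ.V}

theorem gen_subtype_mem {k : ℕ} {w : W} (hw : w ∈ subGr σ.grV W k) :
    (σ.gen ∘ₗ W.subtype) w ∈ σ.total.gr k := σ.gen_mem hw

section

variable [DirectSum.Decomposition (subGr σ.grV W)]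

variable (W) in
/-- The algebra map `A ⊗ ΛW → A ⊗ ΛV` for a graded subspace `W` of `V`. -/
abbrev subHom : FreeExt A (subGr σ.grV W) →ₐ[ℚ] σ.total :=
  FreeExt.extend σ.incl (σ.gen ∘ₗ W.subtype) gen_subtype_mem

theorem subHom_incl (a : A) : subHom W (FreeExt.incl A _ a) = σ.incl.toAlgHom a :=
  FreeExt.extend_incl _ _ gen_subtype_mem a

theorem subHom_gen (w : W) : subHom W (FreeExt.gen A _ w) = σ.gen w :=
  FreeExt.extend_gen _ _ gen_subtype_mem w

/-- The map `ΛW → ΛV` has a retraction, and tensoring with `A` preserves injectivity. -/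
theorem subHom_injective (hW : IsGradedSubspace σ.grV W) : Function.Injective (subHom W) := by
  obtain ⟨φ, hφ, hinj⟩ := FreeGCA.exists_injective hW
  have hlift : ∀ w, FreeGCA.lift (subGr σ.grV W) σ.total (σ.gen ∘ₗ W.subtype)
      gen_subtype_mem w = σ.genHom (φ w) := by
    intro w
    have : FreeGCA.lift (subGr σ.grV W) σ.total (σ.gen ∘ₗ W.subtype)
      gen_subtype_mem = σ.genHom.comp φ := FreeGCA.algHom_ext fun v => by
        rw [FreeGCA.lift_ι, AlgHom.comp_apply, hφ, genHom_ι]; rfl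
    rw [this]; rfl
  have hT := Module.Flat.lTensor_preserves_injective_linearMap (M := A) φ.toLinearMap hinj
  have key : ∀ t : A ⊗[ℚ] FreeGCA (subGr σ.grV W),
      subHom W (GradedTensorProduct.of ℚ A.gr (FreeGCA.gr (subGr σ.grV W)) t) =
        σ.equiv (φ.toLinearMap.lTensor A t) := by
    intro t
    induction t using TensorProduct.induction_on with
    | zero => simp
    | tmul a w =>
      rw [LinearMap.lTensor_tmul, equiv_tmul, AlgHom.toLinearMap_apply, ← hlift]
      exact FreeExt.extend_tmul _ _ _ a w
    | add x y hx hy => simp only [map_add, hx, hy]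
  intro x y hxy
  obtain ⟨x, rfl⟩ := (GradedTensorProduct.of ℚ A.gr (FreeGCA.gr (subGr σ.grV W))).surjective x
  obtain ⟨y, rfl⟩ := (GradedTensorProduct.of ℚ A.gr (FreeGCA.gr (subGr σ.grV W))).surjective y
  rw [key, key] at hxy
  rw [hT (σ.equiv.injective hxy)]

theorem subalg_le_map_subHom {H : Submodule ℚ σ.V} (hH : H ≤ W) :
    σ.subalg H ≤ ((FreeExt.incl A (subGr σ.grV W)).range ⊔ Algebra.adjoin ℚ
      (FreeExt.gen A (subGr σ.grV W) '' (H.comap W.subtype : Set W))).map (subHom W) := by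
  refine subalg_le_iff.2 ⟨fun a => ?_, fun v hv => ?_⟩
  · refine ⟨FreeExt.incl A _ a, (le_sup_left : (FreeExt.incl A (subGr σ.grV W)).range ≤ _) ⟨a, rfl⟩,
      subHom_incl a⟩
  · exact ⟨FreeExt.gen A _ ⟨v, hH hv⟩, (le_sup_right : Algebra.adjoin ℚ _ ≤ _)
      (Algebra.subset_adjoin ⟨⟨v, hH hv⟩, hv, rfl⟩), subHom_gen _⟩

end

/-- A finite-dimensional nilpotent space of generators gives a subfibration `A ⊗ ΛW`, and a class
that is killed by an element of `A ⊗ ΛW` is killed by this subfibration. -/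
theorem exists_subfibration {H : ℕ → Submodule ℚ σ.V} (hH : IsFiniteChain H W)
    (hσ : σ.IsIteratedOdd) : ∃ ρ : AlgFibration A, ρ.IsFinitelyIteratedOdd ∧
      ∀ (a : A) (b : σ.total), b ∈ σ.subalg W → σ.total.d b = σ.incl.toAlgHom a →
        ∃ y, ρ.total.d y = ρ.incl.toAlgHom a := by
  obtain ⟨N, hN⟩ := hH.eventually
  have hW : IsGradedSubspace σ.grV W := hN ▸ hH.graded N
  let := hW.decomposition
  let Ψ : FreeExt A (subGr σ.grV W) →ₐ[ℚ] σ.total := subHom W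
  have hinj : Function.Injective Ψ := subHom_injective hW
  have hlift : ∀ {F : Submodule ℚ σ.V}, F ≤ W → ∀ {x}, x ∈ σ.subalg F →
      ∃ y ∈ (FreeExt.incl A (subGr σ.grV W)).range ⊔ Algebra.adjoin ℚ
        (FreeExt.gen A (subGr σ.grV W) '' (F.comap W.subtype : Set W)), Ψ y = x :=
    fun hF _ hx => subalg_le_map_subHom hF hx
  have hd : ∀ w : W, σ.total.d (σ.gen w) ∈ LinearMap.range Ψ.toLinearMap := fun w => by
    obtain ⟨y, -, hy⟩ := hlift (hH.le N) (hH.d_succ N w (hH.mono N.le_succ (hN.symm ▸ w.2)))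
    exact ⟨y, hy⟩
  let δ : W →ₗ[ℚ] FreeExt A (subGr σ.grV W) :=
    (LinearEquiv.ofInjective Ψ.toLinearMap hinj).symm.toLinearMap ∘ₗ
      (σ.total.d ∘ₗ σ.gen ∘ₗ W.subtype).codRestrict _ hd
  have hδ : ∀ w : W, Ψ (δ w) = σ.total.d (σ.gen w) := fun w =>
    congrArg Subtype.val ((LinearEquiv.ofInjective Ψ.toLinearMap hinj).apply_symm_apply
      ((σ.total.d ∘ₗ σ.gen ∘ₗ W.subtype).codRestrict _ hd w))
  have hδgr : ∀ {k : ℕ} {w : W}, w ∈ subGr σ.grV W k →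
      δ w ∈ FreeExt.gr A (subGr σ.grV W) (k + 1) := fun {k w} hw =>
    FreeExt.mem_gr_of_extend_mem (f := σ.incl) (j := σ.gen ∘ₗ W.subtype)
      (hj := gen_subtype_mem) hinj (by
      change Ψ (δ w) ∈ _
      rw [hδ]
      exact σ.total.d_mem (σ.gen_mem hw))
  have hΨd : ∀ x, Ψ (FreeExt.der δ hδgr x) = σ.total.d (Ψ x) := FreeExt.extend_der (f := σ.incl)
    (j := σ.gen ∘ₗ W.subtype) (hj := gen_subtype_mem) hδ
  have hsq : ∀ w, FreeExt.der δ hδgr (δ w) = 0 := fun w => hinj (by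
    rw [hΨd, hδ, σ.total.d_d, map_zero])
  have hbot : ∀ k, σ.grV k = ⊥ → subGr σ.grV W k = ⊥ := fun k hk => by
    rw [subGr, hk, Submodule.comap_bot, Submodule.ker_subtype]
  have hkill : ∀ (a : A) (b : σ.total), b ∈ σ.subalg W → σ.total.d b = σ.incl.toAlgHom a →
      ∃ y, FreeExt.der δ hδgr y = FreeExt.incl A _ a := by
    intro a b hb hab
    obtain ⟨y, -, hyb⟩ := hlift (le_refl W) hb
    refine ⟨y, hinj ?_⟩
    rw [hΨd, hyb, hab]
    exact (subHom_incl a).symm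
  refine ⟨FreeExt.fibration δ hδgr hsq (hbot 0 σ.grV_zero) (fun n => (H n).comap W.subtype)
    (fun _ _ h => Submodule.comap_mono (hH.mono h)) ?_ (fun w => ⟨N, ?_⟩) ?_ ?_,
    ⟨fun k hk => hbot k (hσ k hk), Module.Finite.iff_fg.2 hH.fg⟩, hkill⟩
  · intro n w hw k
    rw [Submodule.mem_comap, Submodule.subtype_apply, coe_decompose_subGr]
    exact hH.graded n w hw k
  · change (w : σ.V) ∈ H N
    rw [hN]; exact w.2
  · intro w hw
    obtain ⟨a, ha⟩ := hH.d_zero w hw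
    refine ⟨a, hinj ?_⟩
    rw [hδ]
    exact (subHom_incl a).trans ha
  · intro n w hw
    obtain ⟨y, hy, hyw⟩ := hlift (hH.le n) (hH.d_succ n w hw)
    have hyδ : y = δ w := hinj (by rw [hyw, hδ])
    rwa [hyδ] at hy

theorem exists_finitelyIteratedOdd (hσ : σ.IsIteratedOdd) {a : A.H} (ha : σ.incl.mapH a = 0) :
    ∃ ρ : AlgFibration A, ρ.IsFinitelyIteratedOdd ∧ ρ.incl.mapH a = 0 := by
  obtain ⟨a, rfl⟩ := Submodule.Quotient.mk_surjective _ a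
  obtain ⟨b, hb⟩ := (CDGA.mapH_mk_eq_zero _ a).1 ha
  obtain ⟨n, hn⟩ := exists_mem_subalg_fil b
  obtain ⟨G, hG, hf, hg, hbG⟩ := exists_fg_of_mem_subalg (fun v hv k => σ.fil_graded n v hv k) hn
  obtain ⟨H, W, hH, hGW⟩ := exists_isFiniteChain n hG hf hg
  obtain ⟨ρ, hρ, h⟩ := exists_subfibration hH hσ
  exact ⟨ρ, hρ, (CDGA.mapH_mk_eq_zero _ a).2 (h a b (subalg_mono hGW hbG) hb)⟩

end AlgFibration

/-! ### Finitely iterated odd fibrations have finite-dimensional fibers -/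

theorem ExteriorAlgebra.module_finite (V : Type*) [AddCommGroup V] [Module ℚ V]
    [Module.Finite ℚ V] : Module.Finite ℚ (ExteriorAlgebra ℚ V) := by
  have h0 : ∀ n, Module.finrank ℚ V < n → (⋀[ℚ]^n V) = ⊥ := fun n hn => by
    rw [← Submodule.finrank_eq_zero (R := ℚ), exteriorPower.finrank_eq, Nat.choose_eq_zero_of_lt hn]
  have htop : ⨆ n ∈ Finset.range (Module.finrank ℚ V + 1), (⋀[ℚ]^n V) = ⊤ := by
    rw [eq_top_iff, ← (DirectSum.Decomposition.isInternal
      fun n : ℕ => ⋀[ℚ]^n V).submodule_iSup_eq_top]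
    refine iSup_le fun n => ?_
    rcases Nat.lt_or_ge (Module.finrank ℚ V) n with h | h
    · rw [h0 n h]; exact bot_le
    · exact le_iSup₂_of_le n (Finset.mem_range.2 (Nat.lt_succ_of_le h)) le_rfl
  refine ⟨htop ▸ Submodule.fg_biSup _ _ fun n _ => ?_⟩
  exact Module.Finite.iff_fg.1 inferInstance

namespace AlgFibration

variable {A : CDGA.{u}} {σ : AlgFibration A}

theorem IsIteratedOdd.ι_mul_ι (hσ : σ.IsIteratedOdd) (v w : σ.V) :
    FreeGCA.ι σ.grV v * FreeGCA.ι σ.grV w = -(FreeGCA.ι σ.grV w * FreeGCA.ι σ.grV v) := by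
  have hodd : ∀ {n : ℕ} {v : σ.V}, v ∈ σ.grV n → v = 0 ∨ Odd n := fun {n v} hv => by
    rcases Nat.even_or_odd n with h | h
    · rw [hσ n h] at hv; exact Or.inl ((Submodule.mem_bot ℚ).1 hv)
    · exact Or.inr h
  induction v using DirectSum.Decomposition.inductionOn σ.grV with
  | zero => simp
  | @homogeneous m v =>
    induction w using DirectSum.Decomposition.inductionOn σ.grV with
    | zero => simp
    | @homogeneous n w =>
      rcases hodd v.2 with h | hm
      · simp [h]
      rcases hodd w.2 with h | hn
      · simp [h]
      rw [FreeGCA.ι_mul_ι σ.grV v.2 w.2, (hm.mul hn).neg_one_pow]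
      exact neg_one_smul ℚ (FreeGCA.ι σ.grV w * FreeGCA.ι σ.grV v)
    | add w w' h h' => rw [map_add, mul_add, add_mul, h, h', neg_add]
  | add v v' h h' => rw [map_add, mul_add, add_mul, h, h', neg_add]

/-- `ΛV` is a quotient of the exterior algebra on `V` if `V` is concentrated in odd degrees. -/
theorem IsFinitelyIteratedOdd.finite_lam (hσ : σ.IsFinitelyIteratedOdd) :
    Module.Finite ℚ σ.Lam := by
  have := hσ.2
  have := ExteriorAlgebra.module_finite σ.V
  let φ : ExteriorAlgebra ℚ σ.V →ₐ[ℚ] σ.Lam := ExteriorAlgebra.lift ℚ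
    ⟨FreeGCA.ι σ.grV, fun v => by
      have h : (2 : ℚ) • (FreeGCA.ι σ.grV v * FreeGCA.ι σ.grV v) = 0 := by
        rw [two_smul]
        exact eq_neg_iff_add_eq_zero.1 (hσ.1.ι_mul_ι v v)
      exact (smul_eq_zero.1 h).resolve_left two_ne_zero⟩
  refine Module.Finite.of_surjective φ.toLinearMap ((AlgHom.range_eq_top φ).1 ?_)
  rw [eq_top_iff, ← FreeGCA.adjoin_range_ι, Algebra.adjoin_le_iff]
  rintro _ ⟨v, rfl⟩
  exact ⟨ExteriorAlgebra.ι ℚ v, ExteriorAlgebra.lift_ι_apply ℚ _ _ v⟩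

theorem fiberHasFiniteCohomDim_of_finite [Module.Finite ℚ σ.Lam] : σ.FiberHasFiniteCohomDim := by
  have hfin := WellFoundedGT.finite_ne_bot_of_iSupIndep
    (DirectSum.Decomposition.isInternal (FreeGCA.gr σ.grV)).submodule_iSupIndep
  obtain ⟨N, hN⟩ := hfin.bddAbove
  refine ⟨N, fun n hn => ?_⟩
  have hbot : FreeGCA.gr σ.grV n = ⊥ := by
    by_contra h
    exact absurd (hN h) (not_le.2 hn)
  have hproj : ∀ e : σ.total, GradedAlgebra.proj σ.total.gr n e ∈ σ.fiberIdeal := by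
    intro e
    induction e using σ.total_induction with
    | zero => rw [map_zero]; exact zero_mem _
    | mul a w =>
      induction a using DirectSum.Decomposition.inductionOn A.gr with
      | zero => rw [map_zero, zero_mul, map_zero]; exact zero_mem _
      | @homogeneous i a =>
        induction w using DirectSum.Decomposition.inductionOn (FreeGCA.gr σ.grV) with
        | zero => rw [map_zero, mul_zero, map_zero]; exact zero_mem _
        | @homogeneous j w =>
          have hmem : σ.incl.toAlgHom a * σ.genHom w ∈ σ.total.gr (i + j) :=
            SetLike.GradedMul.mul_mem (σ.incl.map_gr a.2) (σ.genHom_mem w.2)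
          rcases eq_or_ne (i + j) n with h | h
          · rw [h] at hmem
            rw [proj_of_mem_same _ hmem]
            rcases Nat.eq_zero_or_pos i with hi | hi
            · have hj : FreeGCA.gr σ.grV j = ⊥ := by rw [show j = n by omega, hbot]
              have hw : (w : σ.Lam) = 0 := (Submodule.mem_bot ℚ).1 (hj.le w.2)
              rw [hw, map_zero, mul_zero]; exact zero_mem _
            · exact σ.incl_mul_mem_fiberIdeal hi a.2 _
          · rw [proj_of_mem_ne _ hmem h]; exact zero_mem _
        | add w w' h h' => rw [map_add, mul_add, map_add]; exact add_mem h h'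
      | add a a' h h' => rw [map_add, add_mul, map_add]; exact add_mem h h'
    | add x y hx hy => rw [map_add]; exact add_mem hx hy
  have hgr : σ.fiberGr n = ⊥ := by
    rw [fiberGr, ← le_bot_iff, Submodule.map_le_iff_le_comap, Submodule.comap_bot,
      Submodule.ker_mkQ]
    intro e he
    rw [← proj_of_mem_same _ he]
    exact hproj e
  rw [cohomologyDeg, hgr, ← le_bot_iff, Submodule.map_le_iff_le_comap]
  intro x hx
  have : x = 0 := Subtype.ext ((Submodule.mem_bot ℚ).1 hx)
  rw [this]
  exact zero_mem _

end AlgFibration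

end

theorem proposition4p1 (A : CDGA.{u}) (hA : A.IsConnected) :
    (∃ τ : AlgFibration A, τ.IsIteratedOdd ∧ ∀ i : ℕ, 0 < i → τ.total.Hdeg (2 * i) = ⊥) ∧
    ∀ τ : AlgFibration A, τ.IsIteratedOdd →
      (∀ i : ℕ, 0 < i → τ.total.Hdeg (2 * i) = ⊥) →
      ∀ a : A.H, List.TFAE
        [a ∈ A.ann,
         a ∈ LinearMap.ker τ.incl.mapH,
         ∃ σ : AlgFibration A, σ.IsFinitelyIteratedOdd ∧ σ.incl.mapH a = 0] := by
  refine ⟨hA.exists_iteratedOdd, fun τ hτ hev a => ?_⟩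
  tfae_have 1 → 2 := fun ha =>
    AlgFibration.mapH_eq_zero_of_mem_ann τ.incl hA (AlgFibration.total_isConnected hA) hev ha
  tfae_have 2 → 3 := fun ha => AlgFibration.exists_finitelyIteratedOdd hτ ha
  tfae_have 3 → 1 := fun ⟨σ, hσ, ha⟩ =>
    have := hσ.finite_lam
    ⟨σ, AlgFibration.fiberHasFiniteCohomDim_of_finite, ha⟩
  tfae_finish
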